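/- Let $n\ge 1$ and let $\Omega\subset\mathbb R^n$ be a bounded domain with piecewise smooth boundary, that is, $\Omega$ is bounded, open and connected, and outside a set of $(n-1)$-dimensional Hausdorff measure zero its boundary is locally a $C^1$ hypersurface with $\Omega$ on one side. Let $T>0$, $\beta>0$, $Q_T=\Omega\times(0,T)$, $S_T=\partial\Omega\times(0,T)$, and let $$H^2_0(Q_T)=\{v\in H^2(Q_T):\ \partial_n v|_{S_T}=0\},$$ where all functions are real valued, $n(x)$ is the outward unit normal vector at $\partial\Omega$ (it exists almost everywhere on $\partial\Omega$), and the boundary condition is meant in the sense of traces. The symbols $\nabla$ and $\Delta$ refer to the variable $x\in\Omega$ only. Let $a>2$, let $$\varphi_\lambda(t)=e^{2(T-t+a)^\lambda},\quad t\in(0,T),\qquad \lambda_0=16(T+a)^2 .$$ Then every $u\in H^2_0(Q_T)$ has traces $u(\cdot,0),u(\cdot,T)\in H^1(\Omega)$, and for all real $\lambda\ge\lambda_0$ $$\int_{Q_T}(u_t+\beta\Delta u)^2\varphi_\lambda\,dx\,dt\ \ge\ \frac23\sqrt\lambda\,\beta\int_{Q_T}|\nabla u|^2\varphi_\lambda\,dx\,dt+\frac{\lambda^2}{12}a^{\lambda-2}\int_{Q_T}u^2\varphi_\lambda\,dx\,dt$$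 $$-\frac23e^{2a^\lambda}\int_\Omega\Big(\beta|\nabla u|^2+\frac12u^2\Big)(x,T)\,dx-\frac23\lambda(T+a)^{\lambda-1}e^{2(T+a)^\lambda}\int_\Omega u^2(x,0)\,dx .$$ -/

import Mathlib

open Set Filter Topology MeasureTheory
open scoped ContDiff

noncomputable section

section WeakDerivatives

variable {F : Type*} [NormedAddCommGroup F] [NormedSpace ℝ F] [MeasureSpace F]

/-- `g` is the weak derivative of `f` on the open set `U` in the direction `v`: both functions are
locally integrable on `U`, and `∫_U f ∂_v ψ = - ∫_U g ψ` for all test functions `ψ ∈ C_c^∞(U)`. -/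
def HasWeakDeriv (U : Set F) (v : F) (f g : F → ℝ) : Prop :=
  LocallyIntegrableOn f U ∧ LocallyIntegrableOn g U ∧
    ∀ ψ : F → ℝ, ContDiff ℝ ∞ ψ → HasCompactSupport ψ → tsupport ψ ⊆ U →
      ∫ x in U, f x * fderiv ℝ ψ x v = - ∫ x in U, g x * ψ x

open Classical in
/-- The weak derivative of `f` on `U` in the direction `v` (unique up to a null subset of `U`);
it is zero by convention if there is none. -/
def weakDeriv (U : Set F) (v : F) (f : F → ℝ) : F → ℝ :=
  if h : ∃ g, HasWeakDeriv U v f g then h.choose else 0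

/-- The Sobolev space `H¹(U)`: `f` and all its first weak derivatives exist and lie in `L²(U)`. -/
def MemH1 (U : Set F) (f : F → ℝ) : Prop :=
  MemLp f 2 (volume.restrict U) ∧
    ∀ v : F, ∃ g, HasWeakDeriv U v f g ∧ MemLp g 2 (volume.restrict U)

/-- The Sobolev space `H²(U)`: `f` and all its first weak derivatives lie in `H¹(U)`. -/
def MemH2 (U : Set F) (f : F → ℝ) : Prop :=
  MemH1 U f ∧ ∀ v : F, MemH1 U (weakDeriv U v f)

end WeakDerivatives

section Domain

variable {n : ℕ}

/-- `ρ` is a `C¹` defining function of `Ω` in the open neighbourhood `V` of the boundary point `p`: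
its gradient has no zero in `V`, and inside `V` the set `Ω` is the side `ρ < 0`. The outward unit
normal of `Ω` on `∂Ω ∩ V` is then `∇ρ / |∇ρ|`. -/
structure IsDefiningFunction (Ω : Set (EuclideanSpace ℝ (Fin n))) (p : EuclideanSpace ℝ (Fin n))
    (V : Set (EuclideanSpace ℝ (Fin n))) (ρ : EuclideanSpace ℝ (Fin n) → ℝ) : Prop where
  mem_frontier : p ∈ frontier Ω
  isOpen : IsOpen V
  mem : p ∈ V
  contDiff : ContDiff ℝ 1 ρ
  fderiv_ne_zero : ∀ x ∈ V, fderiv ℝ ρ x ≠ 0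
  inter_eq : Ω ∩ V = {x ∈ V | ρ x < 0}

/-- The points near which `∂Ω` is a `C¹` hypersurface with `Ω` on one side of it. -/
def smoothBoundary (Ω : Set (EuclideanSpace ℝ (Fin n))) : Set (EuclideanSpace ℝ (Fin n)) :=
  {p | ∃ V ρ, IsDefiningFunction Ω p V ρ}

/-- A bounded domain with piecewise smooth boundary: the boundary is a `C¹` hypersurface, with the
domain on one side, except for a (closed) set of `(n - 1)`-dimensional Hausdorff measure zero
(the edges, the corners and the like). -/
structure IsPiecewiseSmoothDomain (Ω : Set (EuclideanSpace ℝ (Fin n))) : Prop where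
  isOpen : IsOpen Ω
  isConnected : IsConnected Ω
  isBounded : Bornology.IsBounded Ω
  singular_null : Measure.hausdorffMeasure ((n : ℝ) - 1) (frontier Ω \ smoothBoundary Ω) = 0

end Domain

section Cylinder

variable {n : ℕ}

/-- The cylinder `Q_T = Ω × (0, T)`. -/
def spaceTime (Ω : Set (EuclideanSpace ℝ (Fin n))) (T : ℝ) :
    Set (EuclideanSpace ℝ (Fin n) × ℝ) :=
  Ω ×ˢ Ioo 0 T

/-- The weak time derivative `u_t` on the cylinder. -/
def timeDeriv (Ω : Set (EuclideanSpace ℝ (Fin n))) (T : ℝ) (u : EuclideanSpace ℝ (Fin n) × ℝ → ℝ) :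
    EuclideanSpace ℝ (Fin n) × ℝ → ℝ :=
  weakDeriv (spaceTime Ω T) (0, 1) u

/-- The weak spatial derivative `u_{x_i}` on the cylinder. -/
def spaceDeriv (Ω : Set (EuclideanSpace ℝ (Fin n))) (T : ℝ) (i : Fin n)
    (u : EuclideanSpace ℝ (Fin n) × ℝ → ℝ) : EuclideanSpace ℝ (Fin n) × ℝ → ℝ :=
  weakDeriv (spaceTime Ω T) (EuclideanSpace.single i 1, 0) u

/-- The spatial Laplacian `Δu = ∑ u_{x_i x_i}`, in the weak sense, on the cylinder. -/
def spaceLaplacian (Ω : Set (EuclideanSpace ℝ (Fin n))) (T : ℝ)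
    (u : EuclideanSpace ℝ (Fin n) × ℝ → ℝ) (z : EuclideanSpace ℝ (Fin n) × ℝ) : ℝ :=
  ∑ i, spaceDeriv Ω T i (spaceDeriv Ω T i u) z

/-- `(∇u)² = ∑ u_{x_i}²` on the cylinder. -/
def spaceGradSq (Ω : Set (EuclideanSpace ℝ (Fin n))) (T : ℝ)
    (u : EuclideanSpace ℝ (Fin n) × ℝ → ℝ) (z : EuclideanSpace ℝ (Fin n) × ℝ) : ℝ :=
  ∑ i, (spaceDeriv Ω T i u z) ^ 2

/-- `(∇w)² = ∑ w_{x_i}²`, in the weak sense, for a function `w` on `Ω`. -/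
def gradSq (Ω : Set (EuclideanSpace ℝ (Fin n))) (w : EuclideanSpace ℝ (Fin n) → ℝ)
    (x : EuclideanSpace ℝ (Fin n)) : ℝ :=
  ∑ i, (weakDeriv Ω (EuclideanSpace.single i 1) w x) ^ 2

/-- `∂_n u = 0` on the smooth part of the lateral boundary `∂Ω × (0, T)`, in the sense of traces.
The normal derivative is `∇u · ∇ρ / |∇ρ|` for a local defining function `ρ`. For an `H¹` function
`f` the limit as `ε → 0+` of `ε⁻¹ ∫ |f|` over the inner layer `-ε < ρ < 0` is the integral over the
surface of `|trace f| / |∇ρ|`, hence the trace of `f` vanishes if and only if this limit is `0`. -/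
def NormalDerivVanishes (Ω : Set (EuclideanSpace ℝ (Fin n))) (T : ℝ)
    (u : EuclideanSpace ℝ (Fin n) × ℝ → ℝ) : Prop :=
  ∀ p ∈ smoothBoundary Ω, ∃ V ρ, IsDefiningFunction Ω p V ρ ∧
    Tendsto (fun ε : ℝ => ε⁻¹ * ∫ z in (Ω ∩ V ∩ {x | -ε < ρ x}) ×ˢ Ioo 0 T,
        |∑ i, spaceDeriv Ω T i u z * fderiv ℝ ρ z.1 (EuclideanSpace.single i 1)|)
      (𝓝[>] 0) (𝓝 0)

/-- The space `{u ∈ H²(Q_T) : ∂_n u = 0 on ∂Ω × (0, T)}`. -/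
def MemH2Neumann (Ω : Set (EuclideanSpace ℝ (Fin n))) (T : ℝ)
    (u : EuclideanSpace ℝ (Fin n) × ℝ → ℝ) : Prop :=
  MemH2 (spaceTime Ω T) u ∧ NormalDerivVanishes Ω T u

/-- `w ∈ L²(Ω)` is the trace `u(·, 0)`, as a limit in `L²(Ω)` of averages over thin layers. -/
def HasInitialTrace (Ω : Set (EuclideanSpace ℝ (Fin n)))
    (u : EuclideanSpace ℝ (Fin n) × ℝ → ℝ) (w : EuclideanSpace ℝ (Fin n) → ℝ) : Prop :=
  MemLp w 2 (volume.restrict Ω) ∧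
    Tendsto (fun ε : ℝ => ε⁻¹ * ∫ z in Ω ×ˢ Ioo 0 ε, (u z - w z.1) ^ 2) (𝓝[>] 0) (𝓝 0)

/-- `w ∈ L²(Ω)` is the trace `u(·, T)`, as a limit in `L²(Ω)` of averages over thin layers. -/
def HasTerminalTrace (Ω : Set (EuclideanSpace ℝ (Fin n))) (T : ℝ)
    (u : EuclideanSpace ℝ (Fin n) × ℝ → ℝ) (w : EuclideanSpace ℝ (Fin n) → ℝ) : Prop :=
  MemLp w 2 (volume.restrict Ω) ∧
    Tendsto (fun ε : ℝ => ε⁻¹ * ∫ z in Ω ×ˢ Ioo (T - ε) T, (u z - w z.1) ^ 2) (𝓝[>] 0) (𝓝 0)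

end Cylinder

/-- The Carleman weight `φ_λ(t) = exp (2 (T - t + a)^λ)`. -/
def carlemanWeight (T a lam t : ℝ) : ℝ :=
  Real.exp (2 * (T - t + a) ^ lam)

/-- The threshold `λ₀ = 16 (T + a)²`. -/
def carlemanThreshold (T a : ℝ) : ℝ :=
  16 * (T + a) ^ 2

end

/-!
The estimate is a pointwise inequality integrated against two Green-type identities. Write
`s = T - t + a`, let `φ` be the Carleman weight and `p = λ s^(λ - 1)`, so that `φ' = -2 p φ`.

* Since `u_t + βΔu = (u_t - p u) + (βΔu + p u)`, the square of the left side is at least twice the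
  product of the two summands. Integrated against `φ`, and integrated by parts in `x` and in `t`,
  this product leaves `-p' ∫ u² φ`, where `-p' = λ (λ - 1) s^(λ - 2)`, and terms at `t = 0` and
  `t = T`; the terms with `|∇u|²` in the interior cancel (`MemH2Neumann.le_integral_sq_heat`).
* Testing `u_t + βΔu` with `√λ u φ` bounds `√λ β ∫ |∇u|² φ` by `√λ ∫ p u² φ`, `(λ / 2) ∫ u² φ` and
  half of the left side (`MemH2Neumann.sqrt_mul_integral_gradSq_le`).

In the sum of the two the coefficient of `u² φ` is `-p' - √λ p - λ / 2`, and the threshold on `λ`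
makes this at least `(λ² / 8) a^(λ - 2)` (`le_deriv_carlemanRate`). Dividing by `3 / 2` gives the
claim.

The analytic content is in the justification of the integrations by parts for `H²` functions.

*In time.* A function with a square integrable weak time derivative is absolutely continuous on
almost every vertical line (`HasWeakDeriv.exists_memLp_eq_add_time_primitive`). This gives the
traces at `t = 0` and `t = T`, whose spatial derivatives are the traces of the spatial derivatives
(`HasLayerTrace.hasWeakDeriv`), and the energy identity (`HasWeakDeriv.integral_deriv_mul_sq`). As
weak derivatives commute (`HasWeakDeriv.swap`), it applies to the components of `∇u` too.

*In space.* No trace theory on `∂Ω` is used. For a bounded field `G` the divergence is tested with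
`ζ h(-ρ/ε)`, where `ρ` is a local defining function; the gradient of `h(-ρ/ε)` lives on the layer
by which the normal trace is defined, so its contribution vanishes with `ε`. The singular part of
the boundary has vanishing Hausdorff measure of codimension one, hence is removed by cutoffs whose
gradients are small in `L¹` (`exists_cutoff`), which is negligible against a bounded field
(`HasWeakDivergence.integral_mul_time_eq_zero`). Green's formula for `w ∇u`
(`integral_mul_divergence`) needs an unbounded field `w F`; it is truncated to
`w F / (1 + δ (w² + |F|²))`, which is bounded, has vanishing normal trace because `F` has, and has
a divergence dominated uniformly in `δ`.
-/

noncomputable section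

/-! ### Mollification -/

section Mollification

variable {F : Type*} [NormedAddCommGroup F]

/-- A fixed sequence of bump functions around `0` whose supports shrink to `0`. -/
def mollifierBump (F : Type*) [NormedAddCommGroup F] (k : ℕ) : ContDiffBump (0 : F) where
  rIn := 1 / ((k : ℝ) + 1) / 2
  rOut := 1 / ((k : ℝ) + 1)
  rIn_pos := by positivity
  rIn_lt_rOut := half_lt_self (by positivity)

lemma tendsto_mollifierBump_rOut :
    Tendsto (fun k => (mollifierBump F k).rOut) atTop (𝓝 0) :=
  tendsto_one_div_add_atTop_nhds_zero_nat

lemma mollifierBump_rOut_le_one (k : ℕ) : (mollifierBump F k).rOut ≤ 1 := by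
  change 1 / ((k : ℝ) + 1) ≤ 1
  rw [div_le_one (by positivity)]
  linarith [Nat.cast_nonneg (α := ℝ) k]

variable [NormedSpace ℝ F] [MeasureSpace F] [BorelSpace F] [FiniteDimensional ℝ F]

/-- The convolution of `f` with the `k`-th mollifier. -/
def mollify (k : ℕ) (f : F → ℝ) : F → ℝ :=
  convolution ((mollifierBump F k).normed volume) f (ContinuousLinearMap.lsmul ℝ ℝ) volume

variable [(volume : Measure F).IsAddHaarMeasure]

lemma mollify_apply (k : ℕ) (f : F → ℝ) (x : F) :
    mollify k f x = ∫ y, (mollifierBump F k).normed volume (x - y) * f y := by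
  simp [mollify, convolution_eq_swap]

lemma contDiff_mollify (k : ℕ) {f : F → ℝ} (hf : LocallyIntegrable f) :
    ContDiff ℝ ∞ (mollify k f) :=
  (mollifierBump F k).hasCompactSupport_normed.contDiff_convolution_left _
    (mollifierBump F k).contDiff_normed hf

lemma integrable_mollify (k : ℕ) {f : F → ℝ} (hf : Integrable f) : Integrable (mollify k f) :=
  (mollifierBump F k).integrable_normed.integrable_convolution _ hf

lemma ae_tendsto_mollify {f : F → ℝ} (hf : LocallyIntegrable f) :
    ∀ᵐ x, Tendsto (fun k => mollify k f x) atTop (𝓝 (f x)) :=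
  ContDiffBump.ae_convolution_tendsto_right_of_locallyIntegrable (K := 2)
    tendsto_mollifierBump_rOut
    (Eventually.of_forall fun k => by simp [mollifierBump]; ring_nf; rfl) hf

lemma mollify_sub (k : ℕ) {f g : F → ℝ} (hf : LocallyIntegrable f) (hg : LocallyIntegrable g)
    (x : F) : mollify k (fun y => f y - g y) x = mollify k f x - mollify k g x := by
  have key : ∀ {f : F → ℝ}, LocallyIntegrable f →
      Integrable fun y => (mollifierBump F k).normed volume (x - y) * f y := fun hf =>
    hf.integrable_smul_left_of_hasCompactSupport
      ((mollifierBump F k).continuous_normed.comp (continuous_const.sub continuous_id))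
      ((mollifierBump F k).hasCompactSupport_normed.comp_homeomorph (Homeomorph.subLeft x))
  simp only [mollify_apply, mul_sub]
  exact integral_sub (key hf) (key hg)

lemma integral_abs_mollify_le (k : ℕ) {f : F → ℝ} (hf : Integrable f) :
    ∫ x, |mollify k f x| ≤ ∫ x, |f x| := by
  calc ∫ x, |mollify k f x| ≤ ∫ x, mollify k (fun y => |f y|) x := by
        refine integral_mono (integrable_mollify k hf).abs (integrable_mollify k hf.abs) fun x => ?_
        simp only [mollify_apply]
        refine (abs_integral_le_integral_abs).trans_eq ?_
        simp [abs_mul, abs_of_nonneg ((mollifierBump F k).nonneg_normed _)]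
    _ = ∫ x, |f x| := by
        unfold mollify
        rw [integral_convolution _ (mollifierBump F k).integrable_normed hf.abs,
          (mollifierBump F k).integral_normed]
        simp

lemma tendsto_integral_abs_mollify_sub_of_continuous {h : F → ℝ} (hc : Continuous h)
    (hs : HasCompactSupport h) :
    Tendsto (fun k => ∫ x, |mollify k h x - h x|) atTop (𝓝 0) := by
  obtain ⟨M, hM⟩ := hs.exists_bound_of_continuous hc
  have hK : IsCompact (Metric.cthickening 1 (tsupport h)) := hs.isCompact.cthickening
  have hli : LocallyIntegrable h := hc.locallyIntegrable
  have hzero : ∀ k x, x ∉ Metric.cthickening 1 (tsupport h) → mollify k h x = 0 := by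
    intro k x hx
    by_contra hne
    obtain ⟨y, hy, z, hz, rfl⟩ := support_convolution_subset _ hne
    apply hx
    rw [ContDiffBump.support_normed_eq, mem_ball_zero_iff] at hy
    refine Metric.mem_cthickening_of_dist_le _ z 1 _ (subset_tsupport _ hz) ?_
    rw [dist_eq_norm, add_sub_cancel_right]
    exact hy.le.trans (mollifierBump_rOut_le_one k)
  have hbound : ∀ k x, |mollify k h x| ≤ M := by
    intro k x
    rw [mollify_apply]
    refine (abs_integral_le_integral_abs).trans ?_
    have h1 : ∫ y, (mollifierBump F k).normed volume (x - y) * M = M := by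
      rw [integral_mul_const, integral_sub_left_eq_self
        (fun y => (mollifierBump F k).normed volume y), (mollifierBump F k).integral_normed,
        one_mul]
    refine (integral_mono_of_nonneg (Eventually.of_forall fun _ => abs_nonneg _) ?_
      (Eventually.of_forall fun y => ?_)).trans_eq h1
    · exact ((mollifierBump F k).integrable_normed.comp_sub_left x).mul_const M
    · simp only [abs_mul, abs_of_nonneg ((mollifierBump F k).nonneg_normed _)]
      exact mul_le_mul_of_nonneg_left (hM y) ((mollifierBump F k).nonneg_normed _)
  have hM0 : 0 ≤ M := (norm_nonneg _).trans (hM 0)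
  have := tendsto_integral_of_dominated_convergence (μ := volume)
    (F := fun k x => |mollify k h x - h x|) (f := fun _ => 0)
    ((Metric.cthickening 1 (tsupport h)).indicator fun _ => 2 * M)
    (fun k => (((contDiff_mollify k hli).continuous.sub hc).abs).aestronglyMeasurable)
    ((integrable_indicator_iff hK.measurableSet).2
      (integrableOn_const hK.measure_lt_top.ne))
    (fun k => Eventually.of_forall fun x => ?_)
    (Eventually.of_forall fun x => ?_)
  · simpa using this
  · by_cases hx : x ∈ Metric.cthickening 1 (tsupport h)
    · rw [indicator_of_mem hx, Real.norm_eq_abs, abs_abs]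
      have h2 := hM x
      rw [Real.norm_eq_abs] at h2
      linarith [abs_sub (mollify k h x) (h x), hbound k x]
    · rw [hzero k x hx, image_eq_zero_of_notMem_tsupport
        (fun h' => hx (Metric.self_subset_cthickening _ h'))]
      simp [indicator_of_notMem hx]
  · have := ContDiffBump.convolution_tendsto_right_of_continuous (μ := volume)
      (tendsto_mollifierBump_rOut (F := F)) hc x
    have h3 := (this.sub_const (h x)).abs
    simpa [mollify] using h3

/-- Mollifications of an integrable function converge to it in `L¹`: this holds for continuous
functions of compact support, these are dense, and mollifying does not increase the `L¹` norm. -/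
lemma tendsto_integral_abs_mollify_sub {f : F → ℝ} (hf : Integrable f) :
    Tendsto (fun k => ∫ x, |mollify k f x - f x|) atTop (𝓝 0) := by
  rw [Metric.tendsto_atTop]
  intro ε hε
  obtain ⟨h, hs, hfh, hc, hi⟩ := hf.exists_hasCompactSupport_integral_sub_le
    (show 0 < ε / 3 by positivity)
  obtain ⟨N, hN⟩ := Metric.tendsto_atTop.1
    (tendsto_integral_abs_mollify_sub_of_continuous hc hs) (ε / 3) (by positivity)
  refine ⟨N, fun k hk => ?_⟩
  have hN := hN k hk
  rw [Real.dist_eq, sub_zero, abs_of_nonneg (integral_nonneg fun _ => abs_nonneg _)] at hN ⊢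
  simp only [Real.norm_eq_abs] at hfh
  have hm := integral_abs_mollify_le k (hf.sub hi)
  have hsplit : ∀ x, |mollify k f x - f x| ≤
      |mollify k (f - h) x| + (|mollify k h x - h x| + |f x - h x|) := by
    intro x
    have h1 : mollify k (f - h) x = mollify k f x - mollify k h x :=
      mollify_sub k hf.locallyIntegrable hi.locallyIntegrable x
    rw [h1, show mollify k f x - f x = (mollify k f x - mollify k h x) +
      ((mollify k h x - h x) - (f x - h x)) by ring]
    exact (abs_add_le _ _).trans (add_le_add le_rfl (abs_sub _ _))
  have i1 := (integrable_mollify k (hf.sub hi)).abs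
  have i2 := ((integrable_mollify k hi).sub hi).abs
  have i3 := (hf.sub hi).abs
  calc ∫ x, |mollify k f x - f x|
      ≤ ∫ x, (|mollify k (f - h) x| + (|mollify k h x - h x| + |f x - h x|)) :=
        integral_mono ((integrable_mollify k hf).sub hf).abs (i1.add (i2.add i3)) hsplit
    _ = (∫ x, |mollify k (f - h) x|) + ((∫ x, |mollify k h x - h x|) + ∫ x, |f x - h x|) := by
        have e1 := integral_add i1 (i2.add i3)
        have e2 := integral_add i2 i3
        simp only [Pi.add_apply, Pi.sub_apply] at e1 e2
        rw [e1, e2]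
    _ < ε := by
        simp only [Pi.sub_apply] at hm
        linarith

end Mollification

/-! ### Weak derivatives -/

section WeakDerivativeCalculus

variable {F : Type*} [NormedAddCommGroup F] [NormedSpace ℝ F] [MeasureSpace F]

lemma hasWeakDeriv_weakDeriv {U : Set F} {v : F} {f : F → ℝ} (h : ∃ g, HasWeakDeriv U v f g) :
    HasWeakDeriv U v f (weakDeriv U v f) := by
  rw [weakDeriv, dif_pos h]
  exact h.choose_spec

lemma MemH1.hasWeakDeriv {U : Set F} {f : F → ℝ} (h : MemH1 U f) (v : F) :
    HasWeakDeriv U v f (weakDeriv U v f) :=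
  hasWeakDeriv_weakDeriv ((h.2 v).imp fun _ hg => hg.1)

variable [BorelSpace F] [FiniteDimensional ℝ F]

lemma HasWeakDeriv.ae_unique {U : Set F} (hU : IsOpen U) {v : F} {f g g' : F → ℝ}
    (h : HasWeakDeriv U v f g) (h' : HasWeakDeriv U v f g') :
    g =ᵐ[volume.restrict U] g' := by
  have key := hU.ae_eq_zero_of_integral_contDiff_smul_eq_zero (h.2.1.sub h'.2.1)
    fun ψ hψ hc hs => ?_
  · rw [EventuallyEq, ae_restrict_iff' hU.measurableSet]
    filter_upwards [key] with x hx hxU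
    exact sub_eq_zero.1 (hx hxU)
  · have e := (h.2.2 ψ hψ hc hs).symm.trans (h'.2.2 ψ hψ hc hs)
    have hi : ∀ {k : F → ℝ}, LocallyIntegrableOn k U → IntegrableOn (fun x => k x * ψ x) U :=
      @fun k hk => by
        have h1 : IntegrableOn (fun x => k x * ψ x) (tsupport ψ) :=
          (hk.integrableOn_compact_subset hs hc).mul_continuousOn
            hψ.continuous.continuousOn hc
        refine h1.of_forall_sdiff_eq_zero hU.measurableSet fun x hx => ?_
        rw [image_eq_zero_of_notMem_tsupport hx.2, mul_zero]
    have hset : ∫ x, ψ x • (g - g') x = ∫ x in U, ψ x • (g - g') x :=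
      (setIntegral_eq_integral_of_forall_compl_eq_zero fun x hx => by
        rw [image_eq_zero_of_notMem_tsupport fun h' => hx (hs h'), zero_smul]).symm
    rw [hset]
    have : ∀ x, ψ x • (g - g') x = g x * ψ x - g' x * ψ x := fun x => by
      simp only [Pi.sub_apply, smul_eq_mul]; ring
    simp only [this]
    rw [integral_sub (hi h.2.1) (hi h'.2.1), neg_inj.1 e, sub_self]

lemma MemH1.memLp_weakDeriv {U : Set F} (hU : IsOpen U) {f : F → ℝ} (h : MemH1 U f) (v : F) :
    MemLp (weakDeriv U v f) 2 (volume.restrict U) := by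
  obtain ⟨g, hg, hL⟩ := h.2 v
  exact (memLp_congr_ae (hg.ae_unique hU (h.hasWeakDeriv v))).1 hL

omit [BorelSpace F] [FiniteDimensional ℝ F] in
/-- Weak derivatives commute, because the second derivative of a test function is symmetric. -/
lemma HasWeakDeriv.swap {U : Set F} {v w : F} {f fv fw fvw : F → ℝ}
    (hv : HasWeakDeriv U v f fv) (hw : HasWeakDeriv U w f fw) (hvw : HasWeakDeriv U w fv fvw) :
    HasWeakDeriv U v fw fvw := by
  refine ⟨hw.2.1, hvw.2.1, fun ψ hψ hc hs => ?_⟩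
  have hd : ∀ z : F, ContDiff ℝ ∞ (fun x => fderiv ℝ ψ x z) := fun z =>
    (hψ.fderiv_right (m := ∞) (by simp)).clm_apply contDiff_const
  have hdc : ∀ z : F, HasCompactSupport (fun x => fderiv ℝ ψ x z) := fun z =>
    hc.fderiv_apply ℝ z
  have hds : ∀ z : F, tsupport (fun x => fderiv ℝ ψ x z) ⊆ U := fun z =>
    (tsupport_fderiv_apply_subset ℝ z).trans hs
  have hsymm : ∀ x, fderiv ℝ (fun x => fderiv ℝ ψ x v) x w
      = fderiv ℝ (fun x => fderiv ℝ ψ x w) x v := by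
    intro x
    have hdiff : DifferentiableAt ℝ (fderiv ℝ ψ) x :=
      (hψ.fderiv_right (m := 1) (by norm_cast)).differentiable (by simp) x
    rw [fderiv_clm_apply hdiff (differentiableAt_const _),
      fderiv_clm_apply hdiff (differentiableAt_const _)]
    have := (hψ.contDiffAt (x := x)).isSymmSndFDerivAt
      (by simp only [minSmoothness_of_isRCLikeNormedField]; norm_cast)
    simpa using this w v
  have e1 := hw.2.2 _ (hd v) (hdc v) (hds v)
  have e2 := hv.2.2 _ (hd w) (hdc w) (hds w)
  have e3 := hvw.2.2 ψ hψ hc hs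
  simp only [hsymm] at e1
  linarith

variable [(volume : Measure F).IsAddHaarMeasure]

/-- Differentiation commutes with mollification, as long as the mollifier does not reach outside
the set to which the function has been restricted. -/
lemma HasWeakDeriv.fderiv_mollify_indicator {U L : Set F} (hL : IsCompact L)
    (hLU : L ⊆ U) {v : F} {f g : F → ℝ} (h : HasWeakDeriv U v f g) {k : ℕ} {x : F}
    (hx : Metric.closedBall x (mollifierBump F k).rOut ⊆ L) :
    fderiv ℝ (mollify k (L.indicator f)) x v = mollify k (L.indicator g) x := by
  have hint : ∀ {f : F → ℝ}, LocallyIntegrableOn f U → Integrable (L.indicator f) := fun hf =>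
    (integrable_indicator_iff hL.measurableSet).2 (hf.integrableOn_compact_subset hLU hL)
  set B : F → ℝ := (mollifierBump F k).normed volume with hB
  have hBd : ContDiff ℝ ∞ B := (mollifierBump F k).contDiff_normed
  have hBs : tsupport B = Metric.closedBall 0 (mollifierBump F k).rOut :=
    (mollifierBump F k).tsupport_normed_eq
  have hBc : HasCompactSupport B := (mollifierBump F k).hasCompactSupport_normed
  have hfd := HasCompactSupport.hasFDerivAt_convolution_left (ContinuousLinearMap.lsmul ℝ ℝ) hBc
    (hBd.of_le (by norm_cast)) (hint h.1).locallyIntegrable (μ := volume) x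
  have hψ : ContDiff ℝ ∞ (fun y => B (x - y)) := hBd.comp (contDiff_const.sub contDiff_id)
  have hψs : tsupport (fun y => B (x - y)) ⊆ Metric.closedBall x (mollifierBump F k).rOut := by
    refine closure_minimal (fun y hy => ?_) Metric.isClosed_closedBall
    have : x - y ∈ tsupport B := subset_tsupport _ hy
    rw [hBs, mem_closedBall_zero_iff] at this
    rwa [Metric.mem_closedBall, dist_comm, dist_eq_norm]
  have hψc : HasCompactSupport (fun y => B (x - y)) :=
    (isCompact_closedBall x _).of_isClosed_subset (isClosed_tsupport _) hψs
  have hψd : ∀ y, fderiv ℝ (fun y => B (x - y)) y v = - fderiv ℝ B (x - y) v := by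
    intro y
    have h1 : HasFDerivAt (fun y => B (x - y))
        ((fderiv ℝ B (x - y)).comp (-(ContinuousLinearMap.id ℝ F))) y :=
      ((hBd.differentiable (by simp) (x - y)).hasFDerivAt).comp y
        ((hasFDerivAt_id y).const_sub x)
    rw [h1.fderiv]
    simp
  have htest := h.2.2 _ hψ hψc (hψs.trans (hx.trans hLU))
  have hsupp : ∀ (c q : F → ℝ), (∀ y, y ∉ L → c y = 0) →
      ∫ y, c y * L.indicator q y = ∫ y in U, q y * c y := by
    intro c q hc
    rw [← setIntegral_eq_integral_of_forall_compl_eq_zero (s := U)]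
    · congr 1
      ext y
      by_cases hy : y ∈ L
      · rw [indicator_of_mem hy, mul_comm]
      · rw [hc y hy, zero_mul, mul_zero]
    · intro y hy
      rw [hc y fun h' => hy (hLU h'), zero_mul]
  have hB0 : ∀ y, y ∉ L → B (x - y) = 0 := fun y hy =>
    image_eq_zero_of_notMem_tsupport (f := fun y => B (x - y)) fun h' => hy (hx (hψs h'))
  have hdB0 : ∀ y, y ∉ L → fderiv ℝ B (x - y) v = 0 := by
    intro y hy
    have : fderiv ℝ (fun y => B (x - y)) y v = 0 :=
      image_eq_zero_of_notMem_tsupport (f := fun y => fderiv ℝ (fun y => B (x - y)) y v)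
        fun h' => hy (hx (hψs (tsupport_fderiv_apply_subset ℝ v h')))
    rw [hψd] at this
    linarith
  rw [mollify_apply, hsupp _ _ hB0]
  unfold mollify
  rw [hfd.fderiv, convolution_eq_swap, ContinuousLinearMap.integral_apply]
  · simp only [ContinuousLinearMap.precompL_apply, ContinuousLinearMap.lsmul_apply, smul_eq_mul]
    rw [hsupp _ _ hdB0]
    simp only [hψd, mul_neg, integral_neg] at htest
    linarith
  · have := HasCompactSupport.convolutionExists_left
      (ContinuousLinearMap.precompL F (ContinuousLinearMap.lsmul ℝ ℝ (E := ℝ))) (hBc.fderiv ℝ)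
      (hBd.continuous_fderiv (by simp)) (hint h.1).locallyIntegrable (μ := volume) x
    exact this.integrable_swap

/-- Simultaneous approximation on a compact subset of `U`: there is one sequence of linear
smoothing operators that approximates all locally integrable functions, in `L¹` and almost
everywhere, and that eventually commutes with weak derivatives. -/
theorem exists_smooth_approximation {U K : Set F} (hU : IsOpen U) (hK : IsCompact K)
    (hKU : K ⊆ U) :
    ∃ R : ℕ → (F → ℝ) → F → ℝ,
      (∀ f, LocallyIntegrableOn f U → (∀ k, ContDiff ℝ ∞ (R k f)) ∧
        Tendsto (fun k => ∫ x in K, |R k f x - f x|) atTop (𝓝 0) ∧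
        ∀ᵐ x ∂volume.restrict K, Tendsto (fun k => R k f x) atTop (𝓝 (f x))) ∧
      ∀ v f g, HasWeakDeriv U v f g → ∀ᶠ k in atTop, ∀ x ∈ K, fderiv ℝ (R k f) x v = R k g x := by
  obtain ⟨L, hL, hKL, hLU⟩ := exists_compact_between hK hU hKU
  obtain ⟨δ, hδ, hδL⟩ := hK.exists_cthickening_subset_open isOpen_interior hKL
  refine ⟨fun k f => mollify k (L.indicator f), fun f hf => ?_, fun v f g h => ?_⟩
  · have hint : Integrable (L.indicator f) :=
      (integrable_indicator_iff hL.measurableSet).2 (hf.integrableOn_compact_subset hLU hL)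
    have heq : ∀ x ∈ K, L.indicator f x = f x := fun x hx =>
      indicator_of_mem (interior_subset (hKL hx)) _
    refine ⟨fun k => contDiff_mollify k hint.locallyIntegrable, ?_, ?_⟩
    · refine squeeze_zero (fun k => integral_nonneg fun _ => abs_nonneg _) (fun k => ?_)
        (tendsto_integral_abs_mollify_sub hint)
      calc ∫ x in K, |mollify k (L.indicator f) x - f x|
          = ∫ x in K, |mollify k (L.indicator f) x - L.indicator f x| :=
            setIntegral_congr_fun hK.measurableSet fun x hx => by simp only [heq x hx]
        _ ≤ _ := setIntegral_le_integral ((integrable_mollify k hint).sub hint).abs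
            (Eventually.of_forall fun _ => abs_nonneg _)
    · rw [ae_restrict_iff' hK.measurableSet]
      filter_upwards [ae_tendsto_mollify hint.locallyIntegrable] with x hx hxK
      rwa [heq x hxK] at hx
  · have hev := (tendsto_mollifierBump_rOut (F := F)).eventually (gt_mem_nhds hδ)
    filter_upwards [hev] with k hk x hx
    refine h.fderiv_mollify_indicator hL hLU fun y hy => interior_subset (hδL ?_)
    exact Metric.mem_cthickening_of_dist_le _ x _ _ hx ((Metric.mem_closedBall.1 hy).trans hk.le)

/-- The chain rule for a `C¹` function `Φ` with bounded derivative, applied to finitely many weakly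
differentiable functions. The test function is only required to be `C¹`. -/
theorem integral_comp_mul_fderiv {U : Set F} (hU : IsOpen U) {ι : Type*} [Fintype ι] {v : F}
    {f g : ι → F → ℝ} (h : ∀ j, HasWeakDeriv U v (f j) (g j)) {Φ : (ι → ℝ) → ℝ}
    (hΦ : ContDiff ℝ 1 Φ) {C : ℝ} (hC : ∀ y, ‖fderiv ℝ Φ y‖ ≤ C) {ψ : F → ℝ}
    (hψ : ContDiff ℝ 1 ψ) (hc : HasCompactSupport ψ) (hs : tsupport ψ ⊆ U) :
    ∫ x in U, Φ (fun j => f j x) * fderiv ℝ ψ x v =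
      - ∫ x in U, fderiv ℝ Φ (fun j => f j x) (fun j => g j x) * ψ x := by
  set K := tsupport ψ with hKdef
  have hK : IsCompact K := hc
  obtain ⟨R, hR, hRd⟩ := exists_smooth_approximation hU hK hs
  choose hRf_smooth hRf_tend hRf_ae using fun j => hR (f j) (h j).1
  choose hRg_smooth hRg_tend hRg_ae using fun j => hR (g j) (h j).2.1
  have hC0 : 0 ≤ C := (norm_nonneg _).trans (hC 0)
  have hLip : ∀ y z, |Φ y - Φ z| ≤ C * ‖y - z‖ := fun y z => by
    simpa using Convex.norm_image_sub_le_of_norm_fderiv_le (𝕜 := ℝ)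
      (fun x _ => (hΦ.differentiable (by simp)) x) (fun x _ => hC x) convex_univ
      (mem_univ z) (mem_univ y)
  have hdΦ : Continuous (fderiv ℝ Φ) := hΦ.continuous_fderiv (by simp)
  have hdψ : Continuous (fun x => fderiv ℝ ψ x v) :=
    (hψ.continuous_fderiv (by simp)).clm_apply continuous_const
  obtain ⟨M, hM⟩ := hc.exists_bound_of_continuous hψ.continuous
  obtain ⟨M', hM'⟩ := (hc.fderiv_apply ℝ v).exists_bound_of_continuous hdψ
  have hM0 : 0 ≤ M := (norm_nonneg _).trans (hM 0)
  have hM'0 : 0 ≤ M' := (norm_nonneg _).trans (hM' 0)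
  have hψK : ∀ x, x ∉ K → ψ x = 0 := fun x hx => image_eq_zero_of_notMem_tsupport hx
  have hdψK : ∀ x, x ∉ K → fderiv ℝ ψ x v = 0 := fun x hx =>
    image_eq_zero_of_notMem_tsupport (f := fun x => fderiv ℝ ψ x v)
      fun h' => hx (tsupport_fderiv_apply_subset ℝ v h')
  have hUK : ∀ {q : F → ℝ}, (∀ x, x ∉ K → q x = 0) → ∫ x in U, q x = ∫ x in K, q x := fun hq =>
    setIntegral_eq_of_subset_of_forall_sdiff_eq_zero hU.measurableSet hs fun x hx => hq x hx.2
  rw [hUK fun x hx => by rw [hdψK x hx, mul_zero], hUK fun x hx => by rw [hψK x hx, mul_zero]]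
  have hfi : ∀ j, IntegrableOn (f j) K := fun j => (h j).1.integrableOn_compact_subset hs hK
  have hgi : ∀ j, IntegrableOn (g j) K := fun j => (h j).2.1.integrableOn_compact_subset hs hK
  have hRfi : ∀ k j, IntegrableOn (R k (f j)) K := fun k j =>
    (hRf_smooth j k).continuous.continuousOn.integrableOn_compact hK
  have hRgi : ∀ k j, IntegrableOn (R k (g j)) K := fun k j =>
    (hRg_smooth j k).continuous.continuousOn.integrableOn_compact hK
  have hpi : ∀ {f : ι → F → ℝ}, (∀ j, IntegrableOn (f j) K) →
      IntegrableOn (fun x => fun j => f j x) K := fun hf => Integrable.of_eval hf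
  have hAi : ∀ {f : ι → F → ℝ}, (∀ j, IntegrableOn (f j) K) →
      IntegrableOn (fun x => Φ (fun j => f j x) * fderiv ℝ ψ x v) K := by
    intro f hf
    refine Integrable.mul_bdd (c := M') ?_ hdψ.aestronglyMeasurable (Eventually.of_forall hM')
    refine Integrable.mono' (g := fun x => |Φ 0| + C * ‖fun j => f j x‖)
      ((integrableOn_const hK.measure_lt_top.ne).add ((hpi hf).norm.const_mul C))
      (hΦ.continuous.comp_aestronglyMeasurable (hpi hf).aestronglyMeasurable)
      (Eventually.of_forall fun x => ?_)
    have := hLip (fun j => f j x) 0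
    rw [sub_zero] at this
    rw [Real.norm_eq_abs]
    linarith [abs_sub_abs_le_abs_sub (Φ fun j => f j x) (Φ 0)]
  have hBm : ∀ {f g : ι → F → ℝ}, (∀ j, IntegrableOn (f j) K) → (∀ j, IntegrableOn (g j) K) →
      IntegrableOn (fun x => fderiv ℝ Φ (fun j => f j x) (fun j => g j x)) K := by
    intro f g hf hg
    refine Integrable.mono' (g := fun x => C * ‖fun j => g j x‖) ((hpi hg).norm.const_mul C) ?_
      (Eventually.of_forall fun x => ?_)
    · exact isBoundedBilinearMap_apply.continuous.comp_aestronglyMeasurable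
        ((hdΦ.comp_aestronglyMeasurable (hpi hf).aestronglyMeasurable).prodMk
          (hpi hg).aestronglyMeasurable)
    · exact ((fderiv ℝ Φ _).le_opNorm _).trans
        (mul_le_mul_of_nonneg_right (hC _) (norm_nonneg _))
  have hBi : ∀ {f g : ι → F → ℝ}, (∀ j, IntegrableOn (f j) K) → (∀ j, IntegrableOn (g j) K) →
      IntegrableOn (fun x => fderiv ℝ Φ (fun j => f j x) (fun j => g j x) * ψ x) K :=
    fun hf hg => (hBm hf hg).mul_bdd (c := M) hψ.continuous.aestronglyMeasurable
      (Eventually.of_forall hM)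
  have hsum : ∀ y : ι → ℝ, ‖y‖ ≤ ∑ j, |y j| := fun y =>
    (pi_norm_le_iff_of_nonneg (Finset.sum_nonneg fun _ _ => abs_nonneg _)).2 fun j =>
      Finset.single_le_sum (f := fun j => |y j|) (fun _ _ => abs_nonneg _) (Finset.mem_univ j)
  have hDf : ∀ k j, IntegrableOn (fun x => |R k (f j) x - f j x|) K := fun k j =>
    ((hRfi k j).sub (hfi j)).abs
  have hDg : ∀ k j, IntegrableOn (fun x => |R k (g j) x - g j x|) K := fun k j =>
    ((hRgi k j).sub (hgi j)).abs
  have htend0 : ∀ {f : ι → F → ℝ} (c : ℝ),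
      (∀ j, Tendsto (fun k => ∫ x in K, |R k (f j) x - f j x|) atTop (𝓝 0)) →
      Tendsto (fun k => c * ∑ j, ∫ x in K, |R k (f j) x - f j x|) atTop (𝓝 0) := by
    intro f c hf
    simpa using (tendsto_finsetSum (s := Finset.univ) fun j _ => hf j).const_mul c
  -- The approximations are smooth on a neighbourhood of the support of `ψ`, so that the classical
  -- chain rule and integration by parts apply to them.
  have hclass : ∀ᶠ k in atTop, ∫ x in K, Φ (fun j => R k (f j) x) * fderiv ℝ ψ x v =
      - ∫ x in K, fderiv ℝ Φ (fun j => R k (f j) x) (fun j => R k (g j) x) * ψ x := by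
    have hev : ∀ᶠ k in atTop, ∀ j, ∀ x ∈ K, fderiv ℝ (R k (f j)) x v = R k (g j) x :=
      eventually_all.2 fun j => hRd v _ _ (h j)
    filter_upwards [hev] with k hk
    have hfk : ContDiff ℝ 1 (fun x => fun j => R k (f j) x) :=
      contDiff_pi.2 fun j => (hRf_smooth j k).of_le (by norm_cast)
    have hΦk : ContDiff ℝ 1 (fun x => Φ fun j => R k (f j) x) := hΦ.comp hfk
    have hd : ∀ x ∈ K, fderiv ℝ (fun x => Φ fun j => R k (f j) x) x v =
        fderiv ℝ Φ (fun j => R k (f j) x) (fun j => R k (g j) x) := by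
      intro x hx
      have h1 : HasFDerivAt (fun x => fun j => R k (f j) x)
          (ContinuousLinearMap.pi fun j => fderiv ℝ (R k (f j)) x) x :=
        hasFDerivAt_pi.2 fun j => ((hRf_smooth j k).differentiable (by simp) x).hasFDerivAt
      have h2 := ((hΦ.differentiable (by simp) (fun j => R k (f j) x)).hasFDerivAt).comp x h1
      rw [show (fun x => Φ fun j => R k (f j) x) = Φ ∘ (fun x => fun j => R k (f j) x) from rfl,
        h2.fderiv]
      simp only [ContinuousLinearMap.comp_apply]
      congr 1
      ext j
      exact hk j x hx
    have hci : ∀ {q : F → ℝ}, Continuous q → (∀ x, x ∉ K → q x = 0) → Integrable q :=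
      fun hq h0 => hq.integrable_of_hasCompactSupport (HasCompactSupport.intro hK h0)
    have hdk : Continuous fun x => fderiv ℝ (fun x => Φ fun j => R k (f j) x) x v :=
      (hΦk.continuous_fderiv (by simp)).clm_apply continuous_const
    have := integral_mul_fderiv_eq_neg_fderiv_mul_of_integrable (μ := volume) (v := v)
      (f := fun x => Φ fun j => R k (f j) x) (g := ψ)
      (hci (hdk.mul hψ.continuous) fun x hx => by rw [hψK x hx, mul_zero])
      (hci (hΦk.continuous.mul hdψ) fun x hx => by rw [hdψK x hx, mul_zero])
      (hci (hΦk.continuous.mul hψ.continuous) fun x hx => by rw [hψK x hx, mul_zero])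
      (fun x _ => hΦk.differentiable (by simp) x) (fun x _ => hψ.differentiable (by simp) x)
    rw [setIntegral_eq_integral_of_forall_compl_eq_zero fun x hx => by rw [hdψK x hx, mul_zero],
      this, ← setIntegral_eq_integral_of_forall_compl_eq_zero (s := K)
        fun x hx => by rw [hψK x hx, mul_zero]]
    congr 1
    exact setIntegral_congr_fun hK.measurableSet fun x hx => by simp only [hd x hx]
  have hA : Tendsto (fun k => ∫ x in K, Φ (fun j => R k (f j) x) * fderiv ℝ ψ x v) atTop
      (𝓝 (∫ x in K, Φ (fun j => f j x) * fderiv ℝ ψ x v)) := by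
    rw [tendsto_iff_norm_sub_tendsto_zero]
    refine squeeze_zero (fun _ => norm_nonneg _) (fun k => ?_) (htend0 (C * M') hRf_tend)
    rw [← integral_sub (hAi (hRfi k)) (hAi hfi), ← integral_finsetSum _ fun j _ => hDf k j,
      ← integral_const_mul]
    refine norm_integral_le_of_norm_le ((integrable_finsetSum _ fun j _ =>
      hDf k j).const_mul _) (Eventually.of_forall fun x => ?_)
    rw [← sub_mul, norm_mul, mul_right_comm]
    refine mul_le_mul ((hLip _ _).trans (mul_le_mul_of_nonneg_left (hsum _) hC0)) (hM' x)
      (norm_nonneg _) (mul_nonneg hC0 (Finset.sum_nonneg fun _ _ => abs_nonneg _))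
  have hB : Tendsto (fun k => ∫ x in K,
      fderiv ℝ Φ (fun j => R k (f j) x) (fun j => R k (g j) x) * ψ x) atTop
      (𝓝 (∫ x in K, fderiv ℝ Φ (fun j => f j x) (fun j => g j x) * ψ x)) := by
    have h1 : Tendsto (fun k => ∫ x in K,
        fderiv ℝ Φ (fun j => R k (f j) x) (fun j => g j x) * ψ x) atTop
        (𝓝 (∫ x in K, fderiv ℝ Φ (fun j => f j x) (fun j => g j x) * ψ x)) := by
      refine tendsto_integral_of_dominated_convergence (fun x => C * ‖fun j => g j x‖ * M)
        (fun k => (hBi (hRfi k) hgi).aestronglyMeasurable)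
        (((hpi hgi).norm.const_mul C).mul_const M)
        (fun k => Eventually.of_forall fun x => ?_) ?_
      · rw [norm_mul]
        exact mul_le_mul (((fderiv ℝ Φ _).le_opNorm _).trans
          (mul_le_mul_of_nonneg_right (hC _) (norm_nonneg _))) (hM x) (norm_nonneg _)
          (mul_nonneg hC0 (norm_nonneg _))
      · filter_upwards [ae_all_iff.2 hRf_ae] with x hx
        have h3 : Tendsto (fun k => fun j => R k (f j) x) atTop (𝓝 fun j => f j x) :=
          tendsto_pi_nhds.2 hx
        exact (((hdΦ.clm_apply continuous_const).tendsto _).comp h3).mul_const _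
    have h2 : Tendsto (fun k => (∫ x in K,
          fderiv ℝ Φ (fun j => R k (f j) x) (fun j => R k (g j) x) * ψ x) -
        ∫ x in K, fderiv ℝ Φ (fun j => R k (f j) x) (fun j => g j x) * ψ x) atTop (𝓝 0) := by
      refine squeeze_zero_norm (fun k => ?_) (htend0 (C * M) hRg_tend)
      rw [← integral_sub (hBi (hRfi k) (hRgi k)) (hBi (hRfi k) hgi), ← integral_finsetSum _
        fun j _ => hDg k j, ← integral_const_mul]
      refine norm_integral_le_of_norm_le ((integrable_finsetSum _ fun j _ =>
        hDg k j).const_mul _) (Eventually.of_forall fun x => ?_)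
      rw [← sub_mul, ← map_sub, norm_mul, mul_right_comm]
      refine mul_le_mul (((fderiv ℝ Φ _).le_opNorm _).trans
        (mul_le_mul (hC _) (hsum _) (norm_nonneg _) hC0)) (hM x)
        (norm_nonneg _) (mul_nonneg hC0 (Finset.sum_nonneg fun _ _ => abs_nonneg _))
    simpa using h2.add h1
  exact tendsto_nhds_unique (hA.congr' hclass) hB.neg

end WeakDerivativeCalculus

/-! ### Primitives of integrable functions of one variable -/

section Primitives

lemma intervalIntegral_eq_setIntegral_Ioo {T : ℝ} (hT : 0 ≤ T) (g : ℝ → ℝ) :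
    ∫ t in (0 : ℝ)..T, g t = ∫ t in Ioo 0 T, g t := by
  rw [intervalIntegral.integral_of_le hT, integral_Ioc_eq_integral_Ioo]

lemma integral_mul_primitive {T : ℝ} (hT : 0 ≤ T) {g b : ℝ → ℝ} (hg : IntegrableOn g (Ioo 0 T))
    (hb : Continuous b) :
    ∫ t in Ioo 0 T, g t * ∫ s in (0 : ℝ)..t, b s =
      - ∫ s in Ioo 0 T, (∫ v in T..s, g v) * b s := by
  have hgi : IntervalIntegrable g volume 0 T :=
    (intervalIntegrable_iff_integrableOn_Ioo_of_le hT).2 hg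
  have hP := hgi.absolutelyContinuousOnInterval_intervalIntegral (c := T) right_mem_uIcc
  have hb0 : IntervalIntegrable b volume 0 T := hb.intervalIntegrable 0 T
  have hB := hb0.absolutelyContinuousOnInterval_intervalIntegral (c := 0) left_mem_uIcc
  have key := hP.integral_mul_deriv_eq_deriv_mul hB
  have e1 : ∀ s, deriv (fun t => ∫ s in (0 : ℝ)..t, b s) s = b s := fun s =>
    hb.deriv_integral _ _ _
  have e2 : ∫ x in (0 : ℝ)..T, deriv (fun s => ∫ v in T..s, g v) x * ∫ s in (0 : ℝ)..x, b s =
      ∫ x in (0 : ℝ)..T, g x * ∫ s in (0 : ℝ)..x, b s := by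
    refine intervalIntegral.integral_congr_ae ?_
    filter_upwards [hgi.ae_hasDerivAt_integral] with x hx hxI
    rw [(hx (uIoc_subset_uIcc hxI) T right_mem_uIcc).deriv]
  simp only [e1, e2, intervalIntegral.integral_same, zero_mul, mul_zero, sub_zero, zero_sub] at key
  rw [← intervalIntegral_eq_setIntegral_Ioo hT, ← intervalIntegral_eq_setIntegral_Ioo hT, key,
    neg_neg]

/-- The fundamental theorem of calculus for `θ F²`, where `F` is an absolutely continuous function
with derivative `g`. -/
lemma integral_deriv_mul_sq_primitive {T : ℝ} (hT : 0 ≤ T) {g θ θ' : ℝ → ℝ}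
    (hg : IntegrableOn g (Ioo 0 T)) (hθ : ∀ t ∈ Icc 0 T, HasDerivAt θ (θ' t) t)
    (hθ' : ContinuousOn θ' (Icc 0 T)) (c : ℝ) :
    ∫ t in Ioo 0 T, (2 * (c + ∫ v in T..t, g v) * g t * θ t + (c + ∫ v in T..t, g v) ^ 2 * θ' t) =
      θ T * c ^ 2 - θ 0 * (c - ∫ v in Ioo 0 T, g v) ^ 2 := by
  have hgi : IntervalIntegrable g volume 0 T :=
    (intervalIntegrable_iff_integrableOn_Ioo_of_le hT).2 hg
  have hP := hgi.absolutelyContinuousOnInterval_intervalIntegral (c := T) right_mem_uIcc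
  have hc : AbsolutelyContinuousOnInterval (fun _ : ℝ => c) 0 T :=
    (contDiff_const.contDiffOn (n := 1)).absolutelyContinuousOnInterval
  have hF := hc.fun_add hP
  have hθac : AbsolutelyContinuousOnInterval θ 0 T := by
    obtain ⟨C, hC⟩ := isCompact_Icc.exists_bound_of_continuousOn hθ'
    have hC0 : 0 ≤ C := (norm_nonneg _).trans (hC 0 (left_mem_Icc.2 hT))
    refine LipschitzOnWith.absolutelyContinuousOnInterval (K := ⟨C, hC0⟩) ?_
    rw [uIcc_of_le hT]
    exact (convex_Icc 0 T).lipschitzOnWith_of_nnnorm_hasDerivWithin_le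
      (fun t ht => (hθ t ht).hasDerivWithinAt) (fun t ht => hC t ht)
  have key := ((hF.fun_mul hF).fun_mul hθac).integral_deriv_eq_sub
  have e : ∫ x in (0 : ℝ)..T,
        deriv (fun t => (c + ∫ v in T..t, g v) * (c + ∫ v in T..t, g v) * θ t) x =
      ∫ t in (0 : ℝ)..T,
        (2 * (c + ∫ v in T..t, g v) * g t * θ t + (c + ∫ v in T..t, g v) ^ 2 * θ' t) := by
    refine intervalIntegral.integral_congr_ae ?_
    filter_upwards [hgi.ae_hasDerivAt_integral] with x hx hxI
    have hxI' := uIoc_subset_uIcc hxI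
    have h1 := (hx hxI' T right_mem_uIcc).const_add c
    rw [uIcc_of_le hT] at hxI'
    rw [((h1.fun_mul h1).fun_mul (hθ x hxI')).deriv]
    ring
  rw [← intervalIntegral_eq_setIntegral_Ioo hT, ← intervalIntegral_eq_setIntegral_Ioo hT, ← e, key,
    intervalIntegral.integral_same, intervalIntegral.integral_symm 0 T]
  ring

/-- The Cauchy-Schwarz inequality for `g` and `1`, from the variance of `g`. -/
lemma sq_setIntegral_le {s : Set ℝ} (hfin : volume s ≠ ⊤) {g : ℝ → ℝ}
    (hg : MemLp g 2 (volume.restrict s)) :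
    (∫ t in s, g t) ^ 2 ≤ volume.real s * ∫ t in s, g t ^ 2 := by
  have : IsFiniteMeasure (volume.restrict s) := ⟨by simpa using hfin.lt_top⟩
  have hi : IntegrableOn g s := hg.integrable (by norm_num)
  have hsq : IntegrableOn (fun t => g t ^ 2) s := hg.integrable_sq
  rcases eq_or_lt_of_le (measureReal_nonneg (μ := volume) (s := s)) with h0 | h0
  · have : volume s = 0 := by
      rw [measureReal_def, eq_comm, ENNReal.toReal_eq_zero_iff] at h0
      exact h0.resolve_right hfin
    rw [setIntegral_measure_zero _ this, ← h0]
    simp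
  · set V := volume.real s
    set m := (∫ t in s, g t) / V
    have h1 : 0 ≤ ∫ t in s, (g t - m) ^ 2 := integral_nonneg fun _ => sq_nonneg _
    have h2 : ∫ t in s, (g t - m) ^ 2 =
        (∫ t in s, g t ^ 2) - 2 * m * (∫ t in s, g t) + V * m ^ 2 := by
      have e : ∀ t, (g t - m) ^ 2 = g t ^ 2 - 2 * m * g t + m ^ 2 := fun t => by ring
      simp only [e]
      have e1 : IntegrableOn (fun t => g t ^ 2 - 2 * m * g t) s := hsq.sub (hi.const_mul _)
      rw [integral_add e1 (integrableOn_const hfin),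
        integral_sub hsq (hi.const_mul _), integral_const_mul, setIntegral_const, smul_eq_mul]
    have h3 : m * V = ∫ t in s, g t := div_mul_cancel₀ _ h0.ne'
    rw [h2, ← h3] at h1
    rw [← h3]
    nlinarith

end Primitives

/-! ### Functions on the cylinder that are absolutely continuous in time -/

section Cylinder

variable {n : ℕ} {Ω : Set (EuclideanSpace ℝ (Fin n))} {T : ℝ}

lemma isOpen_spaceTime (hΩ : IsOpen Ω) : IsOpen (spaceTime Ω T) := hΩ.prod isOpen_Ioo

lemma restrict_spaceTime (A : Set (EuclideanSpace ℝ (Fin n))) (B : Set ℝ) :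
    (volume : Measure (EuclideanSpace ℝ (Fin n) × ℝ)).restrict (A ×ˢ B) =
      (volume.restrict A).prod (volume.restrict B) := by
  rw [Measure.prod_restrict, Measure.volume_eq_prod]

/-- The primitive in time of a smooth function is smooth, being a convolution with the indicator
function of the half line that depends smoothly on a parameter. -/
lemma contDiff_time_primitive {ψ : EuclideanSpace ℝ (Fin n) × ℝ → ℝ} (hψ : ContDiff ℝ ∞ ψ)
    (hc : HasCompactSupport ψ) (hpos : ∀ x t, t ≤ 0 → ψ (x, t) = 0) :
    ContDiff ℝ ∞ (fun z : EuclideanSpace ℝ (Fin n) × ℝ => ∫ s in (0 : ℝ)..z.2, ψ (z.1, s)) := by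
  have hk : IsCompact (Prod.snd '' tsupport ψ) := hc.isCompact.image continuous_snd
  have hloc : LocallyIntegrable ((Ioi (0 : ℝ)).indicator fun _ => (1 : ℝ)) :=
    (locallyIntegrable_const (1 : ℝ)).indicator measurableSet_Ioi
  have key := contDiffOn_convolution_right_with_param (𝕜 := ℝ) (μ := volume) (n := ⊤)
    (ContinuousLinearMap.lsmul ℝ ℝ) (s := univ) (g := fun x t => ψ (x, t)) isOpen_univ hk
    (fun x t _ ht => image_eq_zero_of_notMem_tsupport fun h' => ht ⟨(x, t), h', rfl⟩) hloc
    hψ.contDiffOn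
  rw [univ_prod_univ, contDiffOn_univ] at key
  convert key using 2 with z
  have hi : ∀ x, Integrable fun s => ψ (x, s) := fun x => by
    have hcont : Continuous fun s => ψ (x, s) := hψ.continuous.comp (by fun_prop)
    exact hcont.integrable_of_hasCompactSupport (HasCompactSupport.intro hk fun t ht =>
      image_eq_zero_of_notMem_tsupport (f := ψ) (x := (x, t)) fun h' => ht ⟨(x, t), h', rfl⟩)
  rw [convolution_eq_swap]
  have h1 : ∀ s, (ContinuousLinearMap.lsmul ℝ ℝ)
      ((Ioi (0 : ℝ)).indicator (fun _ => (1 : ℝ)) (z.2 - s)) (ψ (z.1, s)) =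
        (Iio z.2).indicator (fun s => ψ (z.1, s)) s := by
    intro s
    by_cases hs : s < z.2 <;> simp [indicator, hs]
  simp only [h1]
  rw [integral_indicator measurableSet_Iio, ← integral_Iic_eq_integral_Iio]
  have h2 := intervalIntegral.integral_Iic_sub_Iic (μ := volume) (a := 0) (b := z.2)
    (hi z.1).integrableOn (hi z.1).integrableOn
  have h3 : ∫ s in Iic (0 : ℝ), ψ (z.1, s) = 0 :=
    setIntegral_eq_zero_of_forall_eq_zero fun s hs => hpos _ _ hs
  rw [← h2, h3, sub_zero]

/-- A smooth step in time: it is `0` near `0` and `1` near `T`. -/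
def timeStep (T t : ℝ) : ℝ := Real.smoothTransition (3 * t / T - 1)

lemma contDiff_timeStep : ContDiff ℝ ∞ (timeStep T) :=
  Real.smoothTransition.contDiff.comp (by fun_prop)

lemma timeStep_eq_zero (hT : 0 < T) {t : ℝ} (ht : t ≤ T / 3) : timeStep T t = 0 := by
  refine Real.smoothTransition.zero_of_nonpos ?_
  rw [sub_nonpos, div_le_one hT]
  linarith

lemma timeStep_eq_one (hT : 0 < T) {t : ℝ} (ht : 2 * T / 3 ≤ t) : timeStep T t = 1 := by
  refine Real.smoothTransition.one_of_one_le ?_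
  rw [le_sub_iff_add_le, le_div_iff₀ hT]
  linarith

/-- Every test function `ψ` on the cylinder is, up to a multiple of a fixed function of time, the
time derivative of another test function. -/
lemma exists_test_function_time_primitive (hT : 0 < T)
    {ψ : EuclideanSpace ℝ (Fin n) × ℝ → ℝ} (hψ : ContDiff ℝ ∞ ψ) (hc : HasCompactSupport ψ)
    (hs : tsupport ψ ⊆ spaceTime Ω T) :
    ∃ Ψ : EuclideanSpace ℝ (Fin n) × ℝ → ℝ, ContDiff ℝ ∞ Ψ ∧ HasCompactSupport Ψ ∧
      tsupport Ψ ⊆ spaceTime Ω T ∧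
      (∀ z, Ψ z = (∫ s in (0 : ℝ)..z.2, ψ (z.1, s)) -
        (∫ s in (0 : ℝ)..T, ψ (z.1, s)) * timeStep T z.2) ∧
      ∀ z, fderiv ℝ Ψ z (0, 1) =
        ψ z - (∫ s in (0 : ℝ)..T, ψ (z.1, s)) * deriv (timeStep T) z.2 := by
  have hzero : ∀ x t, t ∉ Ioo 0 T → ψ (x, t) = 0 := fun x t ht =>
    image_eq_zero_of_notMem_tsupport fun h' => ht (hs h').2
  have hP := contDiff_time_primitive hψ hc fun x t ht => hzero x t fun h' => h'.1.not_ge ht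
  have hm : ContDiff ℝ ∞ (fun z : EuclideanSpace ℝ (Fin n) × ℝ => ∫ s in (0 : ℝ)..T, ψ (z.1, s)) :=
    hP.comp (contDiff_fst.prodMk contDiff_const)
  have hX : ContDiff ℝ ∞ (fun z : EuclideanSpace ℝ (Fin n) × ℝ => timeStep T z.2) :=
    contDiff_timeStep.comp contDiff_snd
  have hΨ := hP.sub (hm.mul hX)
  obtain ⟨t₀, t₁, ht₀, ht₁, htt⟩ :
      ∃ t₀ t₁, 0 < t₀ ∧ t₁ < T ∧ ∀ z ∈ tsupport ψ, z.2 ∈ Icc t₀ t₁ := by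
    have hk : IsCompact (Prod.snd '' tsupport ψ) := hc.isCompact.image continuous_snd
    have hsub : Prod.snd '' tsupport ψ ⊆ Ioo 0 T := by
      rintro _ ⟨z, hz, rfl⟩
      exact (hs hz).2
    rcases (Prod.snd '' tsupport ψ).eq_empty_or_nonempty with he | hne
    · refine ⟨T / 2, T / 2, by linarith, by linarith, fun z hz => ?_⟩
      exact absurd (mem_image_of_mem Prod.snd hz) (by simp [he])
    · obtain ⟨a, ha⟩ := hk.exists_isLeast hne
      obtain ⟨b, hb⟩ := hk.exists_isGreatest hne
      exact ⟨a, b, (hsub ha.1).1, (hsub hb.1).2, fun z hz =>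
        ⟨ha.2 (mem_image_of_mem _ hz), hb.2 (mem_image_of_mem _ hz)⟩⟩
  set S : Set (EuclideanSpace ℝ (Fin n) × ℝ) :=
    (Prod.fst '' tsupport ψ) ×ˢ Icc (min t₀ (T / 3)) (max t₁ (2 * T / 3)) with hS
  have hScomp : IsCompact S := (hc.isCompact.image continuous_fst).prod isCompact_Icc
  have hSsub : S ⊆ spaceTime Ω T := by
    rintro ⟨x, t⟩ ⟨⟨z, hz, hzx⟩, ht⟩
    refine ⟨?_, lt_of_lt_of_le (lt_min ht₀ (by linarith)) ht.1,
      lt_of_le_of_lt ht.2 (max_lt ht₁ (by linarith))⟩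
    simp only at hzx
    exact hzx ▸ (hs hz).1
  have hsupp : ∀ z, z ∉ S → (∫ s in (0 : ℝ)..z.2, ψ (z.1, s)) -
        (∫ s in (0 : ℝ)..T, ψ (z.1, s)) * timeStep T z.2 = 0 := by
    rintro ⟨x, t⟩ hz
    by_cases hx : x ∈ Prod.fst '' tsupport ψ
    · have ht : t < min t₀ (T / 3) ∨ max t₁ (2 * T / 3) < t := by
        by_contra! hcon
        exact hz ⟨hx, hcon⟩
      rcases ht with ht | ht
      · have h1 : ∫ s in (0 : ℝ)..t, ψ (x, s) = 0 := by
          refine intervalIntegral.integral_zero_ae (Eventually.of_forall fun s hs => ?_)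
          refine image_eq_zero_of_notMem_tsupport fun h' => ?_
          have h2 := (htt _ h').1
          have h3 : s ≤ max 0 t := hs.2
          have h4 : max 0 t < t₀ := max_lt ht₀ (ht.trans_le (min_le_left _ _))
          linarith
        rw [h1, timeStep_eq_zero hT (ht.le.trans (min_le_right _ _))]
        simp
      · have h1 : ∫ s in (0 : ℝ)..t, ψ (x, s) = ∫ s in (0 : ℝ)..T, ψ (x, s) := by
          have hi : ∀ a b, IntervalIntegrable (fun s => ψ (x, s)) volume a b := fun a b =>
            (hψ.continuous.comp
              (by fun_prop : Continuous fun s : ℝ => (x, s))).intervalIntegrable a b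
          rw [← sub_eq_zero, intervalIntegral.integral_interval_sub_left (hi _ _) (hi _ _)]
          refine intervalIntegral.integral_zero_ae (Eventually.of_forall fun s hs => ?_)
          refine image_eq_zero_of_notMem_tsupport fun h' => ?_
          have h2 := (htt _ h').2
          have h3 : min T t < s := hs.1
          have h4 : t₁ < min T t := lt_min ht₁ ((le_max_left _ _).trans_lt ht)
          linarith
        simp only [h1, timeStep_eq_one hT ((le_max_right _ _).trans ht.le)]
        simp
    · have h0 : ∀ s, ψ (x, s) = 0 := fun s =>
        image_eq_zero_of_notMem_tsupport fun h' => hx ⟨(x, s), h', rfl⟩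
      simp [h0]
  refine ⟨_, hΨ, HasCompactSupport.intro hScomp hsupp, ?_, fun _ => rfl, fun z => ?_⟩
  · exact (closure_minimal (Function.support_subset_iff'.2 hsupp) hScomp.isClosed).trans hSsub
  · have hd := (hΨ.differentiable (by simp) z).hasFDerivAt
    have hline : HasDerivAt (fun t : ℝ => (z.1, t)) ((0 : EuclideanSpace ℝ (Fin n)), (1 : ℝ)) z.2 :=
      (hasDerivAt_const _ _).prodMk (hasDerivAt_id _)
    have h1 := hd.comp_hasDerivAt z.2 hline
    have h2 : HasDerivAt (fun t : ℝ => ∫ s in (0 : ℝ)..t, ψ (z.1, s)) (ψ (z.1, z.2)) z.2 := by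
      have hcont : Continuous fun s => ψ (z.1, s) := hψ.continuous.comp (by fun_prop)
      exact intervalIntegral.integral_hasDerivAt_right (hcont.intervalIntegrable _ _)
        (hcont.stronglyMeasurableAtFilter _ _) hcont.continuousAt
    have h3 := ((contDiff_timeStep (T := T)).differentiable (by simp) z.2).hasDerivAt.const_mul
      (∫ s in (0 : ℝ)..T, ψ (z.1, s))
    exact h1.unique (h2.sub h3)

end Cylinder

section Cylinder

variable {n : ℕ} {Ω : Set (EuclideanSpace ℝ (Fin n))} {T : ℝ}

lemma intervalIntegral_terminal_eq {g : ℝ → ℝ} {s : ℝ} (hs : s ∈ Ioo 0 T) :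
    ∫ v in T..s, g v = - ∫ v in Ioo 0 T, (Ioi s).indicator g v := by
  rw [intervalIntegral.integral_symm, intervalIntegral.integral_of_le hs.2.le,
    integral_Ioc_eq_integral_Ioo, setIntegral_indicator measurableSet_Ioi]
  congr 3
  ext t
  simp only [mem_Ioo, mem_inter_iff, mem_Ioi]
  exact ⟨fun h => ⟨⟨hs.1.trans h.1, h.2⟩, h.1⟩, fun h => ⟨h.2, h.1.2⟩⟩

lemma ae_mem_spaceTime (hΩ : IsOpen Ω) :
    ∀ᵐ z ∂(volume.restrict (spaceTime Ω T)), z ∈ spaceTime Ω T :=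
  ae_restrict_mem (isOpen_spaceTime hΩ).measurableSet

lemma aestronglyMeasurable_time_primitive (hΩ : IsOpen Ω)
    {g : EuclideanSpace ℝ (Fin n) × ℝ → ℝ} (hg : IntegrableOn g (spaceTime Ω T)) :
    AEStronglyMeasurable (fun z => ∫ v in T..z.2, g (z.1, v))
      (volume.restrict (spaceTime Ω T)) := by
  have hgm := hg.aestronglyMeasurable
  have h1 : AEStronglyMeasurable (fun p : (EuclideanSpace ℝ (Fin n) × ℝ) × ℝ => g (p.1.1, p.2))
      ((volume.restrict (spaceTime Ω T)).prod (volume.restrict (Ioo 0 T))) := by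
    rw [spaceTime, restrict_spaceTime] at hgm ⊢
    refine hgm.comp_quasiMeasurePreserving
      (f := fun p : (EuclideanSpace ℝ (Fin n) × ℝ) × ℝ => (p.1.1, p.2)) ?_
    refine ⟨by fun_prop, ?_⟩
    have : Measure.map (fun p : (EuclideanSpace ℝ (Fin n) × ℝ) × ℝ => (p.1.1, p.2))
        (((volume.restrict Ω).prod (volume.restrict (Ioo 0 T))).prod (volume.restrict (Ioo 0 T))) =
        (Measure.map Prod.fst ((volume.restrict Ω).prod (volume.restrict (Ioo 0 T)))).prod
          (Measure.map id (volume.restrict (Ioo 0 T))) :=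
      (Measure.map_prod_map _ _ measurable_fst measurable_id).symm
    rw [this, Measure.map_id]
    exact Measure.AbsolutelyContinuous.prod Measure.quasiMeasurePreserving_fst.absolutelyContinuous
      Measure.AbsolutelyContinuous.rfl
  have h2 : AEStronglyMeasurable (fun p : (EuclideanSpace ℝ (Fin n) × ℝ) × ℝ =>
      (Ioi p.1.2).indicator (fun v => g (p.1.1, v)) p.2)
      ((volume.restrict (spaceTime Ω T)).prod (volume.restrict (Ioo 0 T))) := by
    have hm : MeasurableSet {p : (EuclideanSpace ℝ (Fin n) × ℝ) × ℝ | p.1.2 < p.2} :=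
      measurableSet_lt (by fun_prop) (by fun_prop)
    exact h1.indicator hm
  refine h2.integral_prod_right'.neg.congr ?_
  filter_upwards [ae_mem_spaceTime hΩ] with z hz
  exact (intervalIntegral_terminal_eq hz.2).symm

lemma abs_intervalIntegral_terminal_le {g : ℝ → ℝ} (hg : IntegrableOn g (Ioo 0 T)) {s : ℝ}
    (hs : s ∈ Ioo 0 T) : |∫ v in T..s, g v| ≤ ∫ v in Ioo 0 T, |g v| := by
  rw [intervalIntegral_terminal_eq hs, abs_neg]
  refine abs_integral_le_integral_abs.trans
    (integral_mono (hg.indicator measurableSet_Ioi).abs hg.abs fun v => ?_)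
  by_cases h : v ∈ Ioi s
  · simp [indicator_of_mem h]
  · simp [indicator_of_notMem h]

lemma ae_integrableOn_slice {g : EuclideanSpace ℝ (Fin n) × ℝ → ℝ}
    (hg : IntegrableOn g (spaceTime Ω T)) :
    ∀ᵐ x ∂(volume.restrict Ω), IntegrableOn (fun t => g (x, t)) (Ioo 0 T) := by
  rw [IntegrableOn, spaceTime, restrict_spaceTime] at hg
  exact hg.prod_right_ae

lemma ae_spaceTime_of_ae {p : EuclideanSpace ℝ (Fin n) → Prop}
    (hp : ∀ᵐ x ∂(volume.restrict Ω), p x) :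
    ∀ᵐ z ∂(volume.restrict (spaceTime Ω T)), p z.1 := by
  rw [spaceTime, restrict_spaceTime]
  exact Measure.quasiMeasurePreserving_fst.ae hp

lemma integrableOn_time_primitive (hΩ : IsOpen Ω)
    {g : EuclideanSpace ℝ (Fin n) × ℝ → ℝ} (hg : IntegrableOn g (spaceTime Ω T)) :
    IntegrableOn (fun z => ∫ v in T..z.2, g (z.1, v)) (spaceTime Ω T) := by
  have hq : IntegrableOn (fun z : EuclideanSpace ℝ (Fin n) × ℝ => ∫ v in Ioo 0 T, |g (z.1, v)|)
      (spaceTime Ω T) := by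
    have hg' := hg
    rw [IntegrableOn, spaceTime, restrict_spaceTime] at hg' ⊢
    exact hg'.integral_norm_prod_left.comp_fst _
  refine Integrable.mono' hq (aestronglyMeasurable_time_primitive hΩ hg) ?_
  filter_upwards [ae_mem_spaceTime hΩ, ae_spaceTime_of_ae (ae_integrableOn_slice hg)] with z hz hi
  exact abs_intervalIntegral_terminal_le hi hz.2

lemma setIntegral_spaceTime {f : EuclideanSpace ℝ (Fin n) × ℝ → ℝ}
    (hf : IntegrableOn f (spaceTime Ω T)) :
    ∫ z in spaceTime Ω T, f z = ∫ x in Ω, ∫ t in Ioo 0 T, f (x, t) := by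
  rw [IntegrableOn, spaceTime, restrict_spaceTime] at hf
  rw [spaceTime, restrict_spaceTime, integral_prod _ hf]

lemma IntegrableOn.mul_of_continuousOn_time (hΩ : IsOpen Ω)
    {f : EuclideanSpace ℝ (Fin n) × ℝ → ℝ} (hf : IntegrableOn f (spaceTime Ω T)) {θ : ℝ → ℝ}
    (hθ : ContinuousOn θ (Icc 0 T)) : IntegrableOn (fun z => f z * θ z.2) (spaceTime Ω T) := by
  obtain ⟨C, hC⟩ := isCompact_Icc.exists_bound_of_continuousOn hθ
  refine Integrable.mul_bdd (c := C) hf ?_ ?_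
  · refine ContinuousOn.aestronglyMeasurable ?_ (isOpen_spaceTime hΩ).measurableSet
    exact hθ.comp continuousOn_snd fun z hz => Ioo_subset_Icc_self hz.2
  · filter_upwards [ae_mem_spaceTime hΩ] with z hz
    exact hC _ (Ioo_subset_Icc_self hz.2)

/-- A function with an integrable weak time derivative `g` is, on almost every vertical line,
a primitive of `g`. The constant `c x` is its value at the terminal time `T`. -/
theorem HasWeakDeriv.exists_eq_add_time_primitive (hΩ : IsOpen Ω) (hT : 0 < T)
    {f g : EuclideanSpace ℝ (Fin n) × ℝ → ℝ} (h : HasWeakDeriv (spaceTime Ω T) (0, 1) f g)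
    (hf : IntegrableOn f (spaceTime Ω T)) (hg : IntegrableOn g (spaceTime Ω T)) :
    ∃ c : EuclideanSpace ℝ (Fin n) → ℝ, IntegrableOn c Ω ∧
      ∀ᵐ z ∂(volume.restrict (spaceTime Ω T)), f z = c z.1 + ∫ v in T..z.2, g (z.1, v) := by
  have hXc : Continuous (timeStep T) := contDiff_timeStep.continuous
  have hχc : Continuous (deriv (timeStep T)) := contDiff_timeStep.continuous_deriv (by simp)
  have hfχ : IntegrableOn (fun z => f z * deriv (timeStep T) z.2) (spaceTime Ω T) :=
    IntegrableOn.mul_of_continuousOn_time hΩ hf hχc.continuousOn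
  have hgX : IntegrableOn (fun z => g z * timeStep T z.2) (spaceTime Ω T) :=
    IntegrableOn.mul_of_continuousOn_time hΩ hg hXc.continuousOn
  have hk := hfχ.add hgX
  set k : EuclideanSpace ℝ (Fin n) × ℝ → ℝ :=
    (fun z => f z * deriv (timeStep T) z.2) + (fun z => g z * timeStep T z.2) with hkdef
  -- `k` is the time derivative of `f X` for the step `X`, which is `0` at time `0` and `1` at
  -- time `T`, so that the integral of `k` over `(0, T)` is the value of `f` at time `T`.
  set c : EuclideanSpace ℝ (Fin n) → ℝ := fun x => ∫ t in Ioo 0 T, k (x, t) with hc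
  have hci : IntegrableOn c Ω := by
    rw [IntegrableOn, spaceTime, restrict_spaceTime] at hk
    exact hk.integral_prod_left
  have hci' : IntegrableOn (fun z : EuclideanSpace ℝ (Fin n) × ℝ => c z.1) (spaceTime Ω T) := by
    rw [IntegrableOn, spaceTime, restrict_spaceTime]
    exact Integrable.comp_fst hci _
  have hAi := integrableOn_time_primitive hΩ hg
  set A : EuclideanSpace ℝ (Fin n) × ℝ → ℝ := fun z => ∫ v in T..z.2, g (z.1, v) with hA
  refine ⟨c, hci, ?_⟩
  have hQ := isOpen_spaceTime (T := T) hΩ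
  have hdi : IntegrableOn (fun z => f z - (c z.1 + A z)) (spaceTime Ω T) := hf.sub (hci'.add hAi)
  have key := hQ.ae_eq_zero_of_integral_contDiff_smul_eq_zero
    (hdi.locallyIntegrableOn) fun ψ hψ hψc hψs => ?_
  · rw [ae_restrict_iff' hQ.measurableSet]
    filter_upwards [key] with z hz hzQ
    exact sub_eq_zero.1 (hz hzQ)
  obtain ⟨Ψ, hΨ, hΨc, hΨs, hΨe, hΨd⟩ := exists_test_function_time_primitive hT hψ hψc hψs
  have htest := h.2.2 Ψ hΨ hΨc hΨs
  set m : EuclideanSpace ℝ (Fin n) → ℝ := fun x => ∫ s in (0 : ℝ)..T, ψ (x, s) with hm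
  obtain ⟨M, hM⟩ := hψc.exists_bound_of_continuous hψ.continuous
  have hmeas : Continuous m := by
    refine intervalIntegral.continuous_parametric_intervalIntegral_of_continuous' ?_ _ _
    exact hψ.continuous
  have hmb : ∀ x, ‖m x‖ ≤ M * |T - 0| := fun x =>
    intervalIntegral.norm_integral_le_of_norm_le_const fun s _ => hM _
  have hmulψ : ∀ {q : EuclideanSpace ℝ (Fin n) × ℝ → ℝ}, IntegrableOn q (spaceTime Ω T) →
      IntegrableOn (fun z => q z * ψ z) (spaceTime Ω T) := fun hq =>
    Integrable.mul_bdd (c := M) hq hψ.continuous.aestronglyMeasurable (Eventually.of_forall hM)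
  have hmulm : ∀ {q : EuclideanSpace ℝ (Fin n) × ℝ → ℝ}, IntegrableOn q (spaceTime Ω T) →
      IntegrableOn (fun z => q z * m z.1) (spaceTime Ω T) := fun hq =>
    Integrable.mul_bdd (c := M * |T - 0|) hq
      (hmeas.comp continuous_fst).aestronglyMeasurable (Eventually.of_forall fun z => hmb z.1)
  obtain ⟨MΨ, hMΨ⟩ := hΨc.exists_bound_of_continuous hΨ.continuous
  have hgΨ : IntegrableOn (fun z => g z * Ψ z) (spaceTime Ω T) :=
    Integrable.mul_bdd (c := MΨ) hg hΨ.continuous.aestronglyMeasurable (Eventually.of_forall hMΨ)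
  have hgXm : IntegrableOn (fun z => g z * timeStep T z.2 * m z.1) (spaceTime Ω T) := hmulm hgX
  have hfχm : IntegrableOn (fun z => f z * deriv (timeStep T) z.2 * m z.1) (spaceTime Ω T) :=
    hmulm hfχ
  have hP : IntegrableOn (fun z : EuclideanSpace ℝ (Fin n) × ℝ =>
      g z * ∫ s in (0 : ℝ)..z.2, ψ (z.1, s)) (spaceTime Ω T) := by
    refine (hgΨ.add hgXm).congr (Eventually.of_forall fun z => ?_)
    simp only [Pi.add_apply, hΨe]
    ring
  have e1 : ∫ z in spaceTime Ω T, f z * fderiv ℝ Ψ z (0, 1) =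
      (∫ z in spaceTime Ω T, f z * ψ z) -
        ∫ z in spaceTime Ω T, f z * deriv (timeStep T) z.2 * m z.1 := by
    rw [← integral_sub (hmulψ hf) hfχm]
    congr 1
    ext z
    rw [hΨd]
    ring
  have e2 : ∫ z in spaceTime Ω T, g z * Ψ z =
      (∫ z in spaceTime Ω T, g z * ∫ s in (0 : ℝ)..z.2, ψ (z.1, s)) -
        ∫ z in spaceTime Ω T, g z * timeStep T z.2 * m z.1 := by
    rw [← integral_sub hP hgXm]
    congr 1
    ext z
    rw [hΨe]
    ring
  have e3 : (∫ z in spaceTime Ω T, f z * deriv (timeStep T) z.2 * m z.1) +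
      (∫ z in spaceTime Ω T, g z * timeStep T z.2 * m z.1) =
      ∫ z in spaceTime Ω T, c z.1 * ψ z := by
    rw [← integral_add hfχm hgXm]
    have : ∀ z, f z * deriv (timeStep T) z.2 * m z.1 + g z * timeStep T z.2 * m z.1 =
        k z * m z.1 := fun z => by simp only [hkdef, Pi.add_apply]; ring
    simp only [this]
    rw [setIntegral_spaceTime (hmulm hk), setIntegral_spaceTime (hmulψ hci')]
    congr 1
    ext x
    simp only
    rw [integral_mul_const, integral_const_mul, hm]
    simp only [intervalIntegral_eq_setIntegral_Ioo hT.le]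
    rfl
  have e4 : ∫ z in spaceTime Ω T, g z * (∫ s in (0 : ℝ)..z.2, ψ (z.1, s)) =
      - ∫ z in spaceTime Ω T, A z * ψ z := by
    rw [setIntegral_spaceTime hP, setIntegral_spaceTime (hmulψ hAi), ← integral_neg]
    refine integral_congr_ae ?_
    filter_upwards [ae_integrableOn_slice hg] with x hx
    exact integral_mul_primitive hT.le hx (hψ.continuous.comp (by fun_prop))
  have hset : ∫ z, ψ z • (f z - (c z.1 + A z)) =
      ∫ z in spaceTime Ω T, ψ z • (f z - (c z.1 + A z)) :=
    (setIntegral_eq_integral_of_forall_compl_eq_zero fun z hz => by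
      rw [image_eq_zero_of_notMem_tsupport fun h' => hz (hψs h'), zero_smul]).symm
  have e5 : ∫ z in spaceTime Ω T, ψ z • (f z - (c z.1 + A z)) =
      (∫ z in spaceTime Ω T, f z * ψ z) - ((∫ z in spaceTime Ω T, c z.1 * ψ z) +
        ∫ z in spaceTime Ω T, A z * ψ z) := by
    have hsum : IntegrableOn (fun z => c z.1 * ψ z + A z * ψ z) (spaceTime Ω T) :=
      (hmulψ hci').add (hmulψ hAi)
    rw [← integral_add (hmulψ hci') (hmulψ hAi), ← integral_sub (hmulψ hf) hsum]
    congr 1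
    ext z
    simp only [smul_eq_mul]
    ring
  rw [hset, e5]
  linarith

end Cylinder

/-! ### Traces on the bottom and the top of the cylinder -/

section Traces

variable {n : ℕ} {Ω : Set (EuclideanSpace ℝ (Fin n))} {T : ℝ}

lemma integrableOn_of_memLp (hfin : volume Ω ≠ ⊤) {f : EuclideanSpace ℝ (Fin n) × ℝ → ℝ}
    (hf : MemLp f 2 (volume.restrict (spaceTime Ω T))) : IntegrableOn f (spaceTime Ω T) := by
  have : IsFiniteMeasure (volume.restrict (spaceTime Ω T)) := by
    have : IsFiniteMeasure (volume.restrict Ω) := ⟨by simpa using hfin.lt_top⟩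
    rw [spaceTime, restrict_spaceTime]
    infer_instance
  exact hf.integrable (by norm_num)

lemma ae_memLp_slice (hfin : volume Ω ≠ ⊤) {g : EuclideanSpace ℝ (Fin n) × ℝ → ℝ}
    (hg : MemLp g 2 (volume.restrict (spaceTime Ω T))) :
    ∀ᵐ x ∂(volume.restrict Ω), MemLp (fun t => g (x, t)) 2 (volume.restrict (Ioo 0 T)) := by
  filter_upwards [ae_integrableOn_slice (integrableOn_of_memLp hfin hg),
    ae_integrableOn_slice (g := fun z => g z ^ 2) hg.integrable_sq] with x hx hx2
  exact (memLp_two_iff_integrable_sq hx.aestronglyMeasurable).2 hx2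

lemma sq_integral_Ioo_le {g : ℝ → ℝ} (hg : MemLp g 2 (volume.restrict (Ioo 0 T))) {a b : ℝ}
    (ha : 0 ≤ a) (hab : a ≤ b) (hb : b ≤ T) :
    (∫ v in Ioo a b, g v) ^ 2 ≤ (b - a) * ∫ v in Ioo 0 T, g v ^ 2 := by
  have hsub : Ioo a b ⊆ Ioo 0 T := Ioo_subset_Ioo ha hb
  have h1 := sq_setIntegral_le (s := Ioo a b) (by simp)
    (hg.mono_measure (Measure.restrict_mono_set _ hsub))
  rw [Real.volume_real_Ioo_of_le hab] at h1
  refine h1.trans (mul_le_mul_of_nonneg_left ?_ (by linarith))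
  exact setIntegral_mono_set hg.integrable_sq (Eventually.of_forall fun _ => sq_nonneg _)
    hsub.eventuallyLE

lemma sq_primitive_terminal_le {g : ℝ → ℝ} (hg : MemLp g 2 (volume.restrict (Ioo 0 T))) {s : ℝ}
    (hs : s ∈ Ioo 0 T) : (∫ v in T..s, g v) ^ 2 ≤ (T - s) * ∫ v in Ioo 0 T, g v ^ 2 := by
  rw [intervalIntegral.integral_symm, intervalIntegral.integral_of_le hs.2.le,
    integral_Ioc_eq_integral_Ioo, neg_sq]
  exact sq_integral_Ioo_le hg hs.1.le hs.2.le le_rfl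

lemma sq_primitive_initial_le {g : ℝ → ℝ} (hg : MemLp g 2 (volume.restrict (Ioo 0 T))) {s : ℝ}
    (hs : s ∈ Ioo 0 T) :
    ((∫ v in T..s, g v) + ∫ v in Ioo 0 T, g v) ^ 2 ≤ s * ∫ v in Ioo 0 T, g v ^ 2 := by
  have hT : 0 ≤ T := hs.1.le.trans hs.2.le
  have hi : IntegrableOn g (Ioo 0 T) := hg.integrable (by norm_num)
  have hi' : ∀ a ∈ Icc 0 T, ∀ b ∈ Icc 0 T, IntervalIntegrable g volume a b := fun a ha b hb =>
    ((intervalIntegrable_iff_integrableOn_Ioo_of_le hT).2 hi).mono_set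
      (by rw [uIcc_of_le hT]; exact uIcc_subset_Icc ha hb)
  have h0 : (0 : ℝ) ∈ Icc 0 T := left_mem_Icc.2 hT
  have h1 : T ∈ Icc 0 T := right_mem_Icc.2 hT
  have h2 := Ioo_subset_Icc_self hs
  rw [← intervalIntegral_eq_setIntegral_Ioo hT, add_comm,
    intervalIntegral.integral_add_adjacent_intervals (hi' _ h0 _ h1) (hi' _ h1 _ h2),
    intervalIntegral.integral_of_le hs.1.le, integral_Ioc_eq_integral_Ioo]
  simpa using sq_integral_Ioo_le hg le_rfl hs.1.le hs.2.le

lemma integrableOn_integral_sq {g : EuclideanSpace ℝ (Fin n) × ℝ → ℝ}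
    (hg : MemLp g 2 (volume.restrict (spaceTime Ω T))) :
    IntegrableOn (fun x => ∫ v in Ioo 0 T, g (x, v) ^ 2) Ω := by
  have h := hg.integrable_sq
  rw [spaceTime, restrict_spaceTime] at h
  exact h.integral_prod_left

lemma memLp_of_memLp_comp_fst (hT : 0 < T) {c : EuclideanSpace ℝ (Fin n) → ℝ}
    (hcm : AEStronglyMeasurable c (volume.restrict Ω))
    (hc : MemLp (fun z : EuclideanSpace ℝ (Fin n) × ℝ => c z.1) 2
      (volume.restrict (spaceTime Ω T))) :
    MemLp c 2 (volume.restrict Ω) := by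
  have h := hc.integrable_sq
  rw [spaceTime, restrict_spaceTime] at h
  refine (memLp_two_iff_integrable_sq hcm).2
    ((Integrable.comp_fst_iff (f := fun x => c x ^ 2) ?_).1 h)
  rw [Ne, Measure.restrict_eq_zero, Real.volume_Ioo]
  simpa using hT

/-- The square integrable version of `HasWeakDeriv.exists_eq_add_time_primitive`. -/
theorem HasWeakDeriv.exists_memLp_eq_add_time_primitive (hΩ : IsOpen Ω) (hfin : volume Ω ≠ ⊤)
    (hT : 0 < T) {f g : EuclideanSpace ℝ (Fin n) × ℝ → ℝ}
    (h : HasWeakDeriv (spaceTime Ω T) (0, 1) f g)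
    (hf : MemLp f 2 (volume.restrict (spaceTime Ω T)))
    (hg : MemLp g 2 (volume.restrict (spaceTime Ω T))) :
    ∃ c : EuclideanSpace ℝ (Fin n) → ℝ, MemLp c 2 (volume.restrict Ω) ∧
      ∀ᵐ z ∂(volume.restrict (spaceTime Ω T)), f z = c z.1 + ∫ v in T..z.2, g (z.1, v) := by
  have hgi := integrableOn_of_memLp hfin hg
  obtain ⟨c, hc, hfc⟩ := h.exists_eq_add_time_primitive hΩ hT (integrableOn_of_memLp hfin hf) hgi
  refine ⟨c, memLp_of_memLp_comp_fst hT hc.aestronglyMeasurable ?_, hfc⟩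
  have hA : MemLp (fun z : EuclideanSpace ℝ (Fin n) × ℝ => ∫ v in T..z.2, g (z.1, v)) 2
      (volume.restrict (spaceTime Ω T)) := by
    have hm := aestronglyMeasurable_time_primitive hΩ hgi
    refine (memLp_two_iff_integrable_sq hm).2 ?_
    have hq : IntegrableOn (fun z : EuclideanSpace ℝ (Fin n) × ℝ =>
        T * ∫ v in Ioo 0 T, g (z.1, v) ^ 2) (spaceTime Ω T) := by
      rw [IntegrableOn, spaceTime, restrict_spaceTime]
      exact ((integrableOn_integral_sq hg).comp_fst _).const_mul T
    refine Integrable.mono' hq (hm.pow 2) ?_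
    filter_upwards [ae_mem_spaceTime hΩ, ae_spaceTime_of_ae (ae_memLp_slice hfin hg)] with z hz hi
    rw [Real.norm_eq_abs, abs_of_nonneg (sq_nonneg _)]
    refine (sq_primitive_terminal_le hi hz.2).trans (mul_le_mul_of_nonneg_right ?_
      (integral_nonneg fun _ => sq_nonneg _))
    linarith [hz.2.1]
  refine (hf.sub hA).ae_eq ?_
  filter_upwards [hfc] with z hz
  simp [hz]

/-- A family `J ε` of subsets of `(0, T)` of length `ε`; the cases of interest are the time
intervals of length `ε` at the two ends of `(0, T)`. -/
structure IsTimeLayer (T : ℝ) (J : ℝ → Set ℝ) : Prop where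
  measurableSet : ∀ ε, MeasurableSet (J ε)
  volume_real : ∀ᶠ ε in 𝓝[>] 0, volume.real (J ε) = ε
  subset : ∀ᶠ ε in 𝓝[>] 0, J ε ⊆ Ioo 0 T

lemma isTimeLayer_initial (hT : 0 < T) : IsTimeLayer T fun ε => Ioo 0 ε where
  measurableSet _ := measurableSet_Ioo
  volume_real := by
    filter_upwards [self_mem_nhdsWithin] with ε hε
    simpa using (le_of_lt hε : (0 : ℝ) ≤ ε)
  subset := by
    filter_upwards [nhdsWithin_le_nhds (gt_mem_nhds hT)] with ε hε
    exact Ioo_subset_Ioo_right hε.le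

lemma isTimeLayer_terminal (hT : 0 < T) : IsTimeLayer T fun ε => Ioo (T - ε) T where
  measurableSet _ := measurableSet_Ioo
  volume_real := by
    filter_upwards [self_mem_nhdsWithin] with ε hε
    have : (0 : ℝ) ≤ ε := le_of_lt hε
    rw [Real.volume_real_Ioo_of_le (by linarith)]
    ring
  subset := by
    filter_upwards [nhdsWithin_le_nhds (gt_mem_nhds hT)] with ε hε
    exact Ioo_subset_Ioo_left (by linarith)

/-- The common form of `HasInitialTrace` and `HasTerminalTrace`: `w` is the limit in `L²(Ω)` of the
averages of `u` over the layers `J ε`. -/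
def HasLayerTrace (Ω : Set (EuclideanSpace ℝ (Fin n))) (J : ℝ → Set ℝ)
    (u : EuclideanSpace ℝ (Fin n) × ℝ → ℝ) (w : EuclideanSpace ℝ (Fin n) → ℝ) : Prop :=
  MemLp w 2 (volume.restrict Ω) ∧
    Tendsto (fun ε : ℝ => ε⁻¹ * ∫ z in Ω ×ˢ J ε, (u z - w z.1) ^ 2) (𝓝[>] 0) (𝓝 0)

variable {J : ℝ → Set ℝ}

lemma IsTimeLayer.ae_of_ae {ε : ℝ} (hε : J ε ⊆ Ioo 0 T)
    {p : EuclideanSpace ℝ (Fin n) × ℝ → Prop}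
    (hp : ∀ᵐ z ∂(volume.restrict (spaceTime Ω T)), p z) :
    ∀ᵐ z ∂(volume.restrict (Ω ×ˢ J ε)), p z :=
  ae_mono (Measure.restrict_mono_set _ (prod_mono_right hε)) hp

lemma integral_layer_comp_fst {ε : ℝ} (hε : volume.real (J ε) = ε)
    (q : EuclideanSpace ℝ (Fin n) → ℝ) :
    ∫ z in Ω ×ˢ J ε, q z.1 = ε * ∫ x in Ω, q x := by
  rw [restrict_spaceTime, integral_fun_fst, measureReal_restrict_apply_univ, hε, smul_eq_mul]

lemma integrableOn_layer_comp_fst {ε : ℝ} (hε : J ε ⊆ Ioo 0 T)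
    {q : EuclideanSpace ℝ (Fin n) → ℝ} (hq : IntegrableOn q Ω) :
    IntegrableOn (fun z : EuclideanSpace ℝ (Fin n) × ℝ => q z.1) (Ω ×ˢ J ε) := by
  have : IsFiniteMeasure (volume.restrict (J ε)) :=
    ⟨by simpa using (measure_mono hε).trans_lt (by simp : volume (Ioo 0 T) < ⊤)⟩
  rw [IntegrableOn, restrict_spaceTime]
  exact Integrable.comp_fst hq _

lemma memLp_layer_comp_fst {ε : ℝ} (hε : J ε ⊆ Ioo 0 T)
    {w : EuclideanSpace ℝ (Fin n) → ℝ} (hw : MemLp w 2 (volume.restrict Ω)) :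
    MemLp (fun z : EuclideanSpace ℝ (Fin n) × ℝ => w z.1) 2 (volume.restrict (Ω ×ˢ J ε)) := by
  have : IsFiniteMeasure (volume.restrict (J ε)) :=
    ⟨by simpa using (measure_mono hε).trans_lt (by simp : volume (Ioo 0 T) < ⊤)⟩
  rw [restrict_spaceTime]
  exact hw.comp_fst _

lemma IsTimeLayer.hasLayerTrace_of_sq_le (hJ : IsTimeLayer T J)
    {u : EuclideanSpace ℝ (Fin n) × ℝ → ℝ} {w q : EuclideanSpace ℝ (Fin n) → ℝ}
    (hw : MemLp w 2 (volume.restrict Ω)) (hq : IntegrableOn q Ω)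
    (hle : ∀ᶠ ε in 𝓝[>] 0, ∀ᵐ z ∂(volume.restrict (Ω ×ˢ J ε)), (u z - w z.1) ^ 2 ≤ ε * q z.1) :
    HasLayerTrace Ω J u w := by
  refine ⟨hw, ?_⟩
  have hlim : Tendsto (fun ε : ℝ => ε * ∫ x in Ω, q x) (𝓝[>] 0) (𝓝 0) := by
    have : Tendsto (fun ε : ℝ => ε * ∫ x in Ω, q x) (𝓝 0) (𝓝 (0 * ∫ x in Ω, q x)) :=
      tendsto_id.mul_const _
    rw [zero_mul] at this
    exact this.mono_left nhdsWithin_le_nhds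
  refine squeeze_zero' ?_ ?_ hlim
  · filter_upwards [self_mem_nhdsWithin] with ε hε
    exact mul_nonneg (inv_nonneg.2 (le_of_lt hε)) (integral_nonneg fun _ => sq_nonneg _)
  · filter_upwards [self_mem_nhdsWithin, hJ.volume_real, hJ.subset, hle] with ε hε hv hs hb
    have hε0 : (0 : ℝ) < ε := hε
    have h1 : ∫ z in Ω ×ˢ J ε, (u z - w z.1) ^ 2 ≤ ∫ z in Ω ×ˢ J ε, ε * q z.1 :=
      integral_mono_of_nonneg (Eventually.of_forall fun _ => sq_nonneg _)
        ((integrableOn_layer_comp_fst hs hq).const_mul ε) hb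
    rw [integral_const_mul, integral_layer_comp_fst hv] at h1
    calc ε⁻¹ * ∫ z in Ω ×ˢ J ε, (u z - w z.1) ^ 2 ≤ ε⁻¹ * (ε * (ε * ∫ x in Ω, q x)) :=
          mul_le_mul_of_nonneg_left h1 (inv_nonneg.2 hε0.le)
      _ = ε * ∫ x in Ω, q x := by field_simp

lemma ae_mem_layer (hΩ : IsOpen Ω) (hJ : IsTimeLayer T J) (ε : ℝ) :
    ∀ᵐ z ∂(volume.restrict (Ω ×ˢ J ε)), z.2 ∈ J ε := by
  filter_upwards [ae_restrict_mem (hΩ.measurableSet.prod (hJ.measurableSet ε))] with z hz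
  exact hz.2

lemma hasTerminalTrace_of_eq_add_time_primitive (hΩ : IsOpen Ω) (hfin : volume Ω ≠ ⊤)
    (hT : 0 < T) {f g : EuclideanSpace ℝ (Fin n) × ℝ → ℝ} {c : EuclideanSpace ℝ (Fin n) → ℝ}
    (hg : MemLp g 2 (volume.restrict (spaceTime Ω T))) (hc : MemLp c 2 (volume.restrict Ω))
    (h : ∀ᵐ z ∂(volume.restrict (spaceTime Ω T)), f z = c z.1 + ∫ v in T..z.2, g (z.1, v)) :
    HasTerminalTrace Ω T f c := by
  refine (isTimeLayer_terminal hT).hasLayerTrace_of_sq_le hc (integrableOn_integral_sq hg) ?_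
  filter_upwards [(isTimeLayer_terminal hT).subset] with ε hs
  filter_upwards [IsTimeLayer.ae_of_ae hs h,
    IsTimeLayer.ae_of_ae hs (ae_spaceTime_of_ae (ae_memLp_slice hfin hg)),
    ae_mem_layer hΩ (isTimeLayer_terminal hT) ε] with z hz hi hzJ
  rw [hz, add_sub_cancel_left]
  exact (sq_primitive_terminal_le hi (hs hzJ)).trans (mul_le_mul_of_nonneg_right
    (by linarith [hzJ.1]) (integral_nonneg fun _ => sq_nonneg _))

lemma hasInitialTrace_of_eq_add_time_primitive (hΩ : IsOpen Ω) (hfin : volume Ω ≠ ⊤)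
    (hT : 0 < T) {f g : EuclideanSpace ℝ (Fin n) × ℝ → ℝ} {c : EuclideanSpace ℝ (Fin n) → ℝ}
    (hg : MemLp g 2 (volume.restrict (spaceTime Ω T))) (hc : MemLp c 2 (volume.restrict Ω))
    (h : ∀ᵐ z ∂(volume.restrict (spaceTime Ω T)), f z = c z.1 + ∫ v in T..z.2, g (z.1, v)) :
    HasInitialTrace Ω f fun x => c x - ∫ v in Ioo 0 T, g (x, v) := by
  have hG : MemLp (fun x => ∫ v in Ioo 0 T, g (x, v)) 2 (volume.restrict Ω) := by
    have hi := integrableOn_of_memLp hfin hg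
    rw [IntegrableOn, spaceTime, restrict_spaceTime] at hi
    have hm := hi.integral_prod_left.aestronglyMeasurable
    refine (memLp_two_iff_integrable_sq hm).2 ?_
    refine Integrable.mono' ((integrableOn_integral_sq hg).const_mul T) (hm.pow 2) ?_
    filter_upwards [ae_memLp_slice hfin hg] with x hx
    rw [Real.norm_eq_abs, abs_of_nonneg (sq_nonneg _)]
    simpa using sq_integral_Ioo_le hx le_rfl hT.le le_rfl
  refine (isTimeLayer_initial hT).hasLayerTrace_of_sq_le (hc.sub hG)
    (integrableOn_integral_sq hg) ?_
  filter_upwards [(isTimeLayer_initial hT).subset] with ε hs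
  filter_upwards [IsTimeLayer.ae_of_ae hs h,
    IsTimeLayer.ae_of_ae hs (ae_spaceTime_of_ae (ae_memLp_slice hfin hg)),
    ae_mem_layer hΩ (isTimeLayer_initial hT) ε] with z hz hi hzJ
  rw [hz]
  rw [show ∀ a b d : ℝ, a + b - (a - d) = b + d by intros; ring]
  exact (sq_primitive_initial_le hi (hs hzJ)).trans (mul_le_mul_of_nonneg_right
    hzJ.2.le (integral_nonneg fun _ => sq_nonneg _))

lemma HasLayerTrace.integrableOn_sq_sub {ε : ℝ} (hs : J ε ⊆ Ioo 0 T)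
    {u : EuclideanSpace ℝ (Fin n) × ℝ → ℝ} (hu : MemLp u 2 (volume.restrict (spaceTime Ω T)))
    {w : EuclideanSpace ℝ (Fin n) → ℝ} (h : HasLayerTrace Ω J u w) :
    IntegrableOn (fun z => (u z - w z.1) ^ 2) (Ω ×ˢ J ε) :=
  ((hu.mono_measure (Measure.restrict_mono_set _ (prod_mono_right hs))).sub
    (memLp_layer_comp_fst hs h.1)).integrable_sq

lemma HasLayerTrace.ae_unique (hJ : IsTimeLayer T J)
    {u : EuclideanSpace ℝ (Fin n) × ℝ → ℝ} (hu : MemLp u 2 (volume.restrict (spaceTime Ω T)))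
    {w w' : EuclideanSpace ℝ (Fin n) → ℝ} (h : HasLayerTrace Ω J u w)
    (h' : HasLayerTrace Ω J u w') : w =ᵐ[volume.restrict Ω] w' := by
  have hsq : IntegrableOn (fun x => (w x - w' x) ^ 2) Ω := (h.1.sub h'.1).integrable_sq
  have hle : ∫ x in Ω, (w x - w' x) ^ 2 ≤ 0 := by
    have hlim := (h.2.const_mul 2).add (h'.2.const_mul 2)
    simp only [mul_zero, add_zero] at hlim
    refine ge_of_tendsto hlim ?_
    filter_upwards [self_mem_nhdsWithin, hJ.volume_real, hJ.subset] with ε hε hv hs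
    have hε0 : (0 : ℝ) < ε := hε
    have i1 := h.integrableOn_sq_sub hs hu
    have i2 := h'.integrableOn_sq_sub hs hu
    have h1 : ∫ z in Ω ×ˢ J ε, (w z.1 - w' z.1) ^ 2 ≤
        ∫ z in Ω ×ˢ J ε, (2 * (u z - w z.1) ^ 2 + 2 * (u z - w' z.1) ^ 2) :=
      integral_mono (integrableOn_layer_comp_fst hs hsq)
        ((i1.const_mul 2).add (i2.const_mul 2)) fun z => by
          simp only
          nlinarith [sq_nonneg ((u z - w z.1) + (u z - w' z.1))]
    rw [integral_layer_comp_fst hv (fun x => (w x - w' x) ^ 2),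
      integral_add (i1.const_mul 2) (i2.const_mul 2), integral_const_mul, integral_const_mul] at h1
    calc ∫ x in Ω, (w x - w' x) ^ 2 = ε⁻¹ * (ε * ∫ x in Ω, (w x - w' x) ^ 2) := by field_simp
      _ ≤ _ := mul_le_mul_of_nonneg_left h1 (inv_nonneg.2 hε0.le)
      _ = _ := by ring
  have h0 : ∫ x in Ω, (w x - w' x) ^ 2 = 0 :=
    le_antisymm hle (integral_nonneg fun _ => sq_nonneg _)
  have := (integral_eq_zero_iff_of_nonneg (fun _ => sq_nonneg _) hsq).1 h0
  filter_upwards [this] with x hx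
  simpa [sub_eq_zero] using hx

/-- Averages over layers against a bounded function of `x` converge to the integral of the trace. -/
lemma HasLayerTrace.tendsto_integral_mul (hfin : volume Ω ≠ ⊤)
    (hJ : IsTimeLayer T J)
    {u : EuclideanSpace ℝ (Fin n) × ℝ → ℝ} (hu : MemLp u 2 (volume.restrict (spaceTime Ω T)))
    {w : EuclideanSpace ℝ (Fin n) → ℝ} (h : HasLayerTrace Ω J u w)
    {b : EuclideanSpace ℝ (Fin n) → ℝ} (hb : Continuous b) {M : ℝ} (hM : ∀ x, ‖b x‖ ≤ M) :
    Tendsto (fun ε => ε⁻¹ * ∫ z in Ω ×ˢ J ε, u z * b z.1) (𝓝[>] 0) (𝓝 (∫ x in Ω, w x * b x)) := by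
  have : IsFiniteMeasure (volume.restrict Ω) := ⟨by simpa using hfin.lt_top⟩
  have hbi : IntegrableOn (fun x => b x ^ 2) Ω :=
    (MemLp.of_bound hb.aestronglyMeasurable M (Eventually.of_forall hM) :
      MemLp b 2 (volume.restrict Ω)).integrable_sq
  set B := ∫ x in Ω, b x ^ 2
  have hB : 0 ≤ B := integral_nonneg fun _ => sq_nonneg _
  have hwb : IntegrableOn (fun x => w x * b x) Ω :=
    Integrable.mul_bdd (c := M) (h.1.integrable (by norm_num)) hb.aestronglyMeasurable
      (Eventually.of_forall hM)
  -- Young's inequality on each layer, with a parameter `η`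
  have hyoung : ∀ η : ℝ, 0 < η → ∀ᶠ ε in 𝓝[>] 0,
      |(ε⁻¹ * ∫ z in Ω ×ˢ J ε, u z * b z.1) - ∫ x in Ω, w x * b x| ≤
        (ε⁻¹ * ∫ z in Ω ×ˢ J ε, (u z - w z.1) ^ 2) * (2 * η)⁻¹ + η / 2 * B := by
    intro η hη
    filter_upwards [self_mem_nhdsWithin, hJ.volume_real, hJ.subset] with ε hε hv hs
    have hε0 : (0 : ℝ) < ε := hε
    have i1 := h.integrableOn_sq_sub hs hu
    have i2 := integrableOn_layer_comp_fst hs hbi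
    have i3 : IntegrableOn (fun z : EuclideanSpace ℝ (Fin n) × ℝ => u z * b z.1) (Ω ×ˢ J ε) :=
      Integrable.mul_bdd (c := M)
        ((integrableOn_of_memLp hfin hu).mono_set (prod_mono_right hs))
        (hb.comp continuous_fst).aestronglyMeasurable (Eventually.of_forall fun z => hM z.1)
    have i4 := integrableOn_layer_comp_fst hs hwb
    have e1 : (ε⁻¹ * ∫ z in Ω ×ˢ J ε, u z * b z.1) - ∫ x in Ω, w x * b x =
        ε⁻¹ * ∫ z in Ω ×ˢ J ε, (u z - w z.1) * b z.1 := by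
      have : ∫ z in Ω ×ˢ J ε, (u z - w z.1) * b z.1 =
          (∫ z in Ω ×ˢ J ε, u z * b z.1) - ε * ∫ x in Ω, w x * b x := by
        rw [← integral_layer_comp_fst hv (fun x => w x * b x), ← integral_sub i3 i4]
        congr 1
        ext z
        ring
      rw [this]
      field_simp
    have e2 : |∫ z in Ω ×ˢ J ε, (u z - w z.1) * b z.1| ≤
        (∫ z in Ω ×ˢ J ε, (u z - w z.1) ^ 2) * (2 * η)⁻¹ + η / 2 * (ε * B) := by
      rw [← integral_layer_comp_fst hv (fun x => b x ^ 2), ← integral_mul_const,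
        ← integral_const_mul, ← integral_add (i1.mul_const _) (i2.const_mul _), ← Real.norm_eq_abs]
      refine norm_integral_le_of_norm_le ((i1.mul_const _).add (i2.const_mul _))
        (Eventually.of_forall fun z => ?_)
      rw [Real.norm_eq_abs, abs_mul]
      have key : 0 ≤ (|u z - w z.1| - η * |b z.1|) ^ 2 * (2 * η)⁻¹ := by positivity
      have : (|u z - w z.1| - η * |b z.1|) ^ 2 * (2 * η)⁻¹ =
          (u z - w z.1) ^ 2 * (2 * η)⁻¹ + η / 2 * b z.1 ^ 2 - |u z - w z.1| * |b z.1| := by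
        rw [sub_sq, sq_abs, mul_pow, sq_abs]
        field_simp
        ring
      linarith
    rw [e1, abs_mul, abs_of_pos (inv_pos.2 hε0)]
    calc _ ≤ ε⁻¹ * ((∫ z in Ω ×ˢ J ε, (u z - w z.1) ^ 2) * (2 * η)⁻¹ + η / 2 * (ε * B)) :=
          mul_le_mul_of_nonneg_left e2 (inv_nonneg.2 hε0.le)
      _ = _ := by field_simp
  rw [Metric.tendsto_nhds]
  intro δ hδ
  set η := δ / (B + 1) with hη
  have hη0 : 0 < η := by positivity
  have hlim := (h.2.mul_const (2 * η)⁻¹)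
  rw [zero_mul] at hlim
  filter_upwards [hyoung η hη0, hlim.eventually (gt_mem_nhds (half_pos hδ))] with ε h1 h2
  rw [Real.dist_eq]
  have h3 : η / 2 * B ≤ δ / 2 := by
    have : η * (B + 1) = δ := div_mul_cancel₀ _ (by positivity)
    nlinarith
  linarith

end Traces

section Traces

variable {n : ℕ} {Ω : Set (EuclideanSpace ℝ (Fin n))} {T : ℝ}

/-- A function on the cylinder that is orthogonal to all test functions of time has mean zero on
almost every time slice. -/
lemma ae_integral_slice_eq_zero (hΩ : IsOpen Ω) {k : EuclideanSpace ℝ (Fin n) × ℝ → ℝ}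
    (hk : IntegrableOn k (spaceTime Ω T))
    (h : ∀ q : ℝ → ℝ, ContDiff ℝ ∞ q → HasCompactSupport q → tsupport q ⊆ Ioo 0 T →
      ∫ z in spaceTime Ω T, k z * q z.2 = 0) :
    ∀ᵐ t ∂(volume.restrict (Ioo 0 T)), ∫ x in Ω, k (x, t) = 0 := by
  have hk' := hk
  rw [IntegrableOn, spaceTime, restrict_spaceTime] at hk'
  have hH : IntegrableOn (fun t => ∫ x in Ω, k (x, t)) (Ioo 0 T) := hk'.integral_prod_right
  rw [ae_restrict_iff' measurableSet_Ioo]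
  refine isOpen_Ioo.ae_eq_zero_of_integral_contDiff_smul_eq_zero hH.locallyIntegrableOn
    fun q hq hqc hqs => ?_
  have hkq : IntegrableOn (fun z => k z * q z.2) (spaceTime Ω T) :=
    IntegrableOn.mul_of_continuousOn_time hΩ hk hq.continuous.continuousOn
  have e := h q hq hqc hqs
  rw [IntegrableOn, spaceTime, restrict_spaceTime] at hkq
  rw [spaceTime, restrict_spaceTime, integral_prod_symm _ hkq] at e
  rw [← setIntegral_eq_integral_of_forall_compl_eq_zero (s := Ioo 0 T)]
  · refine Eq.trans (integral_congr_ae (Eventually.of_forall fun t => ?_)) e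
    simp only
    rw [integral_mul_const, smul_eq_mul, mul_comm]
  · intro t ht
    rw [image_eq_zero_of_notMem_tsupport fun h' => ht (hqs h'), zero_smul]

lemma integral_eq_zero_of_ae_slice {k : EuclideanSpace ℝ (Fin n) × ℝ → ℝ} {I : Set ℝ}
    (hk : IntegrableOn k (Ω ×ˢ I))
    (h : ∀ᵐ t ∂(volume.restrict I), ∫ x in Ω, k (x, t) = 0) : ∫ z in Ω ×ˢ I, k z = 0 := by
  rw [IntegrableOn, restrict_spaceTime] at hk
  rw [restrict_spaceTime, integral_prod_symm _ hk]
  exact integral_eq_zero_of_ae h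

/-- Product test functions of space and time. -/
lemma product_test_function {p : EuclideanSpace ℝ (Fin n) → ℝ} {q : ℝ → ℝ} {m : WithTop ℕ∞}
    (hm : m ≠ 0)
    (hp : ContDiff ℝ m p) (hpc : HasCompactSupport p) (hps : tsupport p ⊆ Ω)
    (hq : ContDiff ℝ m q) (hqc : HasCompactSupport q) (hqs : tsupport q ⊆ Ioo 0 T) :
    ContDiff ℝ m (fun z : EuclideanSpace ℝ (Fin n) × ℝ => p z.1 * q z.2) ∧
      HasCompactSupport (fun z : EuclideanSpace ℝ (Fin n) × ℝ => p z.1 * q z.2) ∧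
      tsupport (fun z : EuclideanSpace ℝ (Fin n) × ℝ => p z.1 * q z.2) ⊆ spaceTime Ω T ∧
      ∀ v z, fderiv ℝ (fun z : EuclideanSpace ℝ (Fin n) × ℝ => p z.1 * q z.2) z (v, 0) =
        fderiv ℝ p z.1 v * q z.2 := by
  have hK : IsCompact (tsupport p ×ˢ tsupport q) := hpc.isCompact.prod hqc.isCompact
  have h0 : ∀ z, z ∉ tsupport p ×ˢ tsupport q → p z.1 * q z.2 = 0 := fun z hz => by
    by_cases h1 : z.1 ∈ tsupport p
    · rw [image_eq_zero_of_notMem_tsupport (f := q) fun h2 => hz ⟨h1, h2⟩, mul_zero]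
    · rw [image_eq_zero_of_notMem_tsupport h1, zero_mul]
  refine ⟨(hp.comp contDiff_fst).mul (hq.comp contDiff_snd), HasCompactSupport.intro hK h0,
    (closure_minimal (Function.support_subset_iff'.2 h0) hK.isClosed).trans
      (prod_mono hps hqs), fun v z => ?_⟩
  have h1 : HasFDerivAt (fun z : EuclideanSpace ℝ (Fin n) × ℝ => p z.1)
      ((fderiv ℝ p z.1).comp (ContinuousLinearMap.fst ℝ _ _)) z :=
    ((hp.differentiable hm z.1).hasFDerivAt).comp z hasFDerivAt_fst
  have h2 : HasFDerivAt (fun z : EuclideanSpace ℝ (Fin n) × ℝ => q z.2)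
      ((fderiv ℝ q z.2).comp (ContinuousLinearMap.snd ℝ _ _)) z :=
    ((hq.differentiable hm z.2).hasFDerivAt).comp z hasFDerivAt_snd
  rw [(h1.fun_mul h2).fderiv]
  simp [mul_comm]

/-- Spatial weak derivatives commute with taking traces on time slices. -/
theorem HasLayerTrace.hasWeakDeriv (hΩ : IsOpen Ω) (hfin : volume Ω ≠ ⊤) {J : ℝ → Set ℝ}
    (hJ : IsTimeLayer T J) {v : EuclideanSpace ℝ (Fin n)}
    {f g : EuclideanSpace ℝ (Fin n) × ℝ → ℝ} (h : HasWeakDeriv (spaceTime Ω T) (v, 0) f g)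
    (hf : MemLp f 2 (volume.restrict (spaceTime Ω T)))
    (hg : MemLp g 2 (volume.restrict (spaceTime Ω T)))
    {w w' : EuclideanSpace ℝ (Fin n) → ℝ} (hw : HasLayerTrace Ω J f w)
    (hw' : HasLayerTrace Ω J g w') : HasWeakDeriv Ω v w w' := by
  have : IsFiniteMeasure (volume.restrict Ω) := ⟨by simpa using hfin.lt_top⟩
  have hloc : ∀ {w : EuclideanSpace ℝ (Fin n) → ℝ}, MemLp w 2 (volume.restrict Ω) →
      LocallyIntegrableOn w Ω := fun hw =>
    IntegrableOn.locallyIntegrableOn (hw.integrable (by norm_num))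
  refine ⟨hloc hw.1, hloc hw'.1, fun p hp hpc hps => ?_⟩
  have hdp : Continuous fun x => fderiv ℝ p x v :=
    (hp.continuous_fderiv (by simp)).clm_apply continuous_const
  obtain ⟨M, hM⟩ := hpc.exists_bound_of_continuous hp.continuous
  obtain ⟨M', hM'⟩ := (hpc.fderiv_apply ℝ v).exists_bound_of_continuous hdp
  have i1 : IntegrableOn (fun z => f z * fderiv ℝ p z.1 v) (spaceTime Ω T) :=
    Integrable.mul_bdd (c := M') (integrableOn_of_memLp hfin hf)
      (hdp.comp continuous_fst).aestronglyMeasurable (Eventually.of_forall fun z => hM' z.1)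
  have i2 : IntegrableOn (fun z => g z * p z.1) (spaceTime Ω T) :=
    Integrable.mul_bdd (c := M) (integrableOn_of_memLp hfin hg)
      (hp.continuous.comp continuous_fst).aestronglyMeasurable
      (Eventually.of_forall fun z => hM z.1)
  have hslice := ae_integral_slice_eq_zero hΩ (i1.add i2) fun q hq hqc hqs => by
    obtain ⟨hd, hc, hs, hder⟩ := product_test_function (by simp) hp hpc hps hq hqc hqs
    have e := h.2.2 _ hd hc hs
    simp only [hder] at e
    have j1 := IntegrableOn.mul_of_continuousOn_time hΩ i1 hq.continuous.continuousOn
    have j2 := IntegrableOn.mul_of_continuousOn_time hΩ i2 hq.continuous.continuousOn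
    simp only [Pi.add_apply, add_mul]
    rw [integral_add j1 j2]
    simp only [mul_assoc]
    rw [e, neg_add_cancel]
  have t1 := hw.tendsto_integral_mul hfin hJ hf hdp hM'
  have t2 := hw'.tendsto_integral_mul hfin hJ hg hp.continuous hM
  have hzero : ∀ᶠ ε in 𝓝[>] (0 : ℝ), (ε⁻¹ * ∫ z in Ω ×ˢ J ε, f z * fderiv ℝ p z.1 v) +
      ε⁻¹ * ∫ z in Ω ×ˢ J ε, g z * p z.1 = 0 := by
    filter_upwards [hJ.subset] with ε hs
    have k1 := i1.mono_set (prod_mono_right hs)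
    have k2 := i2.mono_set (prod_mono_right hs)
    have := integral_eq_zero_of_ae_slice (k1.add k2)
      (ae_mono (Measure.restrict_mono_set _ hs) hslice)
    simp only [Pi.add_apply] at this
    rw [integral_add k1 k2] at this
    rw [← mul_add, this, mul_zero]
  have := tendsto_nhds_unique (tendsto_const_nhds.congr' (hzero.mono fun _ h => h.symm)) (t1.add t2)
  linarith

/-- The energy identity in time: the fundamental theorem of calculus for `f² θ`, with the traces
of `f` at the two ends. -/
theorem HasWeakDeriv.integral_deriv_mul_sq (hΩ : IsOpen Ω) (hfin : volume Ω ≠ ⊤)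
    (hT : 0 < T) {f g : EuclideanSpace ℝ (Fin n) × ℝ → ℝ}
    (h : HasWeakDeriv (spaceTime Ω T) (0, 1) f g)
    (hf : MemLp f 2 (volume.restrict (spaceTime Ω T)))
    (hg : MemLp g 2 (volume.restrict (spaceTime Ω T)))
    {f₀ fT : EuclideanSpace ℝ (Fin n) → ℝ} (h₀ : HasInitialTrace Ω f f₀)
    (hfT : HasTerminalTrace Ω T f fT) {θ θ' : ℝ → ℝ}
    (hθ : ∀ t ∈ Icc 0 T, HasDerivAt θ (θ' t) t) (hθ' : ContinuousOn θ' (Icc 0 T)) :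
    2 * (∫ z in spaceTime Ω T, f z * g z * θ z.2) + ∫ z in spaceTime Ω T, f z ^ 2 * θ' z.2 =
      θ T * (∫ x in Ω, fT x ^ 2) - θ 0 * ∫ x in Ω, f₀ x ^ 2 := by
  obtain ⟨c, hc, hfc⟩ := h.exists_memLp_eq_add_time_primitive hΩ hfin hT hf hg
  have hcT := hasTerminalTrace_of_eq_add_time_primitive hΩ hfin hT hg hc hfc
  have hc0 := hasInitialTrace_of_eq_add_time_primitive hΩ hfin hT hg hc hfc
  have eT : ∫ x in Ω, fT x ^ 2 = ∫ x in Ω, c x ^ 2 := by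
    refine integral_congr_ae ?_
    filter_upwards [HasLayerTrace.ae_unique (isTimeLayer_terminal hT) hf hfT hcT] with x hx
    simp only [hx]
  have e0 : ∫ x in Ω, f₀ x ^ 2 = ∫ x in Ω, (c x - ∫ v in Ioo 0 T, g (x, v)) ^ 2 := by
    refine integral_congr_ae ?_
    filter_upwards [HasLayerTrace.ae_unique (isTimeLayer_initial hT) hf h₀ hc0] with x hx
    simp only [hx]
  have hθc : ContinuousOn θ (Icc 0 T) := fun t ht => (hθ t ht).continuousAt.continuousWithinAt
  have i1 : IntegrableOn (fun z => f z * g z * θ z.2) (spaceTime Ω T) :=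
    IntegrableOn.mul_of_continuousOn_time hΩ (hf.integrable_mul hg) hθc
  have i2 : IntegrableOn (fun z => f z ^ 2 * θ' z.2) (spaceTime Ω T) :=
    IntegrableOn.mul_of_continuousOn_time hΩ hf.integrable_sq hθ'
  have i3 : IntegrableOn (fun z => 2 * (f z * g z * θ z.2) + f z ^ 2 * θ' z.2) (spaceTime Ω T) :=
    (i1.const_mul 2).add i2
  rw [eT, e0, ← integral_const_mul, ← integral_add (i1.const_mul 2) i2, setIntegral_spaceTime i3,
    ← integral_const_mul, ← integral_const_mul,
    ← integral_sub (hc.integrable_sq.const_mul _) (hc0.1.integrable_sq.const_mul _)]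
  refine integral_congr_ae ?_
  have hfc' := hfc
  rw [spaceTime, restrict_spaceTime] at hfc'
  filter_upwards [Measure.ae_ae_of_ae_prod hfc', ae_memLp_slice hfin hg] with x hx hgx
  rw [← integral_deriv_mul_sq_primitive hT.le (hgx.integrable (by norm_num)) hθ hθ' (c x)]
  refine integral_congr_ae ?_
  filter_upwards [hx] with t ht
  simp only [ht]
  ring

end Traces

/-! ### Cutoff functions around sets of vanishing Hausdorff measure -/

section Cutoff

/-- A compact set of vanishing `m`-dimensional Hausdorff measure is covered by finitely many balls
whose radii `r` have a small sum `∑ r ^ m`. -/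
lemma exists_finite_ball_cover {X : Type*} [MetricSpace X] [Nonempty X] [MeasurableSpace X]
    [BorelSpace X] {S : Set X} (hS : IsCompact S) {m : ℕ}
    (h0 : Measure.hausdorffMeasure (m : ℝ) S = 0)
    {δ : ℝ} (hδ : 0 < δ) :
    ∃ (s : Finset ℕ) (x : ℕ → X) (r : ℕ → ℝ), (∀ i ∈ s, 0 < r i ∧ r i ≤ 1) ∧
      S ⊆ (⋃ i ∈ s, Metric.ball (x i) (r i)) ∧ ∑ i ∈ s, r i ^ m ≤ δ := by
  have hδ2 : ENNReal.ofReal (δ / 2) ≠ 0 := by simpa using hδ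
  rw [Measure.hausdorffMeasure_apply] at h0
  have h1 := ENNReal.iSup_eq_zero.1 h0 (ENNReal.ofReal (1 / 2))
  rw [iSup_pos (by simp)] at h1
  have h2 := h1.trans_lt (pos_iff_ne_zero.2 hδ2)
  simp only [iInf_lt_iff] at h2
  obtain ⟨t, htS, htd, hsum⟩ := h2
  obtain ⟨δ', hδ'pos, hδ'sum⟩ := ENNReal.exists_pos_sum_of_countable' hδ2 ℕ
  have hball : ∀ i, (t i).Nonempty → ∃ (x : X) (r : ℝ), (0 < r ∧ r ≤ 1) ∧ t i ⊆ Metric.ball x r ∧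
      ENNReal.ofReal (r ^ m) ≤ Metric.ediam (t i) ^ (m : ℝ) + δ' i := by
    rintro i ⟨x, hx⟩
    set D := (Metric.ediam (t i)).toReal with hD
    have hfin : Metric.ediam (t i) ≠ ⊤ := ((htd i).trans_lt ENNReal.ofReal_lt_top).ne
    have hDe : Metric.ediam (t i) = ENNReal.ofReal D := (ENNReal.ofReal_toReal hfin).symm
    have hD0 : 0 ≤ D := ENNReal.toReal_nonneg
    have hD1 : D ≤ 1 / 2 := by
      have := htd i
      rwa [hDe, ENNReal.ofReal_le_ofReal_iff (by norm_num)] at this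
    have hδ'fin : δ' i ≠ ⊤ := (lt_of_le_of_lt (ENNReal.le_tsum i)
      (hδ'sum.trans ENNReal.ofReal_lt_top)).ne
    have hpos : 0 < (δ' i).toReal := ENNReal.toReal_pos (hδ'pos i).ne' hδ'fin
    -- A radius strictly above the diameter, since the diameter may be zero.
    have hcont : Tendsto (fun r : ℝ => r ^ m) (𝓝[>] D) (𝓝 (D ^ m)) :=
      ((continuous_pow m).tendsto D).mono_left nhdsWithin_le_nhds
    have hev1 : ∀ᶠ r in 𝓝[>] D, D < r := self_mem_nhdsWithin
    have hev2 : ∀ᶠ r in 𝓝[>] D, r < 1 :=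
      nhdsWithin_le_nhds (gt_mem_nhds (show D < 1 by linarith))
    obtain ⟨r, hr1, hr2, hr3⟩ := ((hcont.eventually
      (gt_mem_nhds (lt_add_of_pos_right (D ^ m) hpos))).and (hev1.and hev2)).exists
    refine ⟨x, r, ⟨hD0.trans_lt hr2, hr3.le⟩, fun y hy => ?_, ?_⟩
    · rw [Metric.mem_ball, dist_edist]
      refine lt_of_le_of_lt (ENNReal.toReal_mono hfin (Metric.edist_le_ediam_of_mem hy hx)) hr2
    · rw [ENNReal.rpow_natCast, hDe, ← ENNReal.ofReal_pow hD0, ← ENNReal.ofReal_toReal hδ'fin,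
        ← ENNReal.ofReal_add (by positivity) hpos.le]
      exact ENNReal.ofReal_le_ofReal hr1.le
  have : ∀ i, ∃ (x : X) (r : ℝ), (t i).Nonempty → (0 < r ∧ r ≤ 1) ∧ t i ⊆ Metric.ball x r ∧
      ENNReal.ofReal (r ^ m) ≤ Metric.ediam (t i) ^ (m : ℝ) + δ' i := by
    intro i
    by_cases hi : (t i).Nonempty
    · obtain ⟨x, r, h⟩ := hball i hi
      exact ⟨x, r, fun _ => h⟩
    · exact ⟨Classical.arbitrary X, 0, fun h => absurd h hi⟩
  choose x r hxr using this
  have hcover : S ⊆ ⋃ i ∈ {i | (t i).Nonempty}, Metric.ball (x i) (r i) := by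
    intro y hy
    obtain ⟨i, hi⟩ := mem_iUnion.1 (htS hy)
    exact mem_biUnion (show i ∈ {i | (t i).Nonempty} from ⟨y, hi⟩) ((hxr i ⟨y, hi⟩).2.1 hi)
  obtain ⟨b, hbt, hbf, hbS⟩ := hS.elim_finite_subcover_image (fun i _ => Metric.isOpen_ball) hcover
  refine ⟨hbf.toFinset, x, r, fun i hi => (hxr i (hbt (hbf.mem_toFinset.1 hi))).1,
    by simpa using hbS, ?_⟩
  have hnn : ∀ i ∈ hbf.toFinset, 0 ≤ r i ^ m := fun i hi =>
    pow_nonneg (hxr i (hbt (hbf.mem_toFinset.1 hi))).1.1.le m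
  rw [← ENNReal.ofReal_le_ofReal_iff hδ.le, ENNReal.ofReal_sum_of_nonneg hnn]
  calc ∑ i ∈ hbf.toFinset, ENNReal.ofReal (r i ^ m)
      ≤ ∑ i ∈ hbf.toFinset, ((⨆ _ : (t i).Nonempty, Metric.ediam (t i) ^ (m : ℝ)) + δ' i) := by
        refine Finset.sum_le_sum fun i hi => ?_
        have hne : (t i).Nonempty := hbt (hbf.mem_toFinset.1 hi)
        rw [iSup_pos hne]
        exact (hxr i hne).2.2
    _ ≤ ∑' i, ((⨆ _ : (t i).Nonempty, Metric.ediam (t i) ^ (m : ℝ)) + δ' i) :=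
        ENNReal.sum_le_tsum _
    _ ≤ ENNReal.ofReal (δ / 2) + ENNReal.ofReal (δ / 2) := by
        rw [ENNReal.tsum_add]
        exact add_le_add hsum.le hδ'sum.le
    _ = ENNReal.ofReal δ := by
        rw [← ENNReal.ofReal_add (by positivity) (by positivity), add_halves]

variable {E : Type*} [NormedAddCommGroup E] [InnerProductSpace ℝ E] [FiniteDimensional ℝ E]

/-- The fixed bump function from which the cutoffs around balls are obtained by scaling. -/
def unitBump (E : Type*) [NormedAddCommGroup E] : ContDiffBump (0 : E) where
  rIn := 1
  rOut := 2
  rIn_pos := one_pos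
  rIn_lt_rOut := one_lt_two

/-- The bump function that is `1` on the ball of radius `r` around `c` and `0` outside the ball of
radius `2 r`. -/
def scaledBump (c : E) (r : ℝ) (x : E) : ℝ := unitBump E (r⁻¹ • (x - c))

lemma contDiff_scaledBump (c : E) (r : ℝ) : ContDiff ℝ ∞ (scaledBump c r) :=
  (unitBump E).contDiff.comp (contDiff_const.smul (contDiff_id.sub contDiff_const))

lemma scaledBump_nonneg (c : E) (r : ℝ) (x : E) : 0 ≤ scaledBump c r x := (unitBump E).nonneg

lemma scaledBump_le_one (c : E) (r : ℝ) (x : E) : scaledBump c r x ≤ 1 := (unitBump E).le_one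

lemma scaledBump_eq_one {c x : E} {r : ℝ} (hr : 0 < r) (hx : x ∈ Metric.ball c r) :
    scaledBump c r x = 1 := by
  refine (unitBump E).one_of_mem_closedBall ?_
  rw [mem_closedBall_zero_iff, norm_smul, norm_inv, Real.norm_of_nonneg hr.le,
    inv_mul_le_iff₀ hr, ← dist_eq_norm]
  simpa [unitBump] using (Metric.mem_ball.1 hx).le

lemma scaledBump_eq_zero {c x : E} {r : ℝ} (hr : 0 < r) (hx : x ∉ Metric.closedBall c (2 * r)) :
    scaledBump c r x = 0 := by
  refine (unitBump E).zero_of_le_dist ?_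
  rw [Metric.mem_closedBall, not_le, dist_eq_norm] at hx
  rw [dist_zero_right, norm_smul, norm_inv, Real.norm_of_nonneg hr.le, le_inv_mul_iff₀ hr]
  simp only [unitBump]
  linarith

lemma exists_norm_fderiv_scaledBump_le (E : Type*) [NormedAddCommGroup E] [InnerProductSpace ℝ E]
    [FiniteDimensional ℝ E] : ∃ C, 0 ≤ C ∧ ∀ (c : E) (r : ℝ), 0 < r → ∀ x,
      ‖fderiv ℝ (scaledBump c r) x‖ ≤
        (Metric.closedBall c (2 * r)).indicator (fun _ => C * r⁻¹) x := by
  have hd : ContDiff ℝ ∞ (unitBump E) := (unitBump E).contDiff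
  obtain ⟨C, hC⟩ := ((unitBump E).hasCompactSupport.fderiv ℝ).exists_bound_of_continuous
    (hd.continuous_fderiv (by simp))
  have hC0 : 0 ≤ C := (norm_nonneg _).trans (hC 0)
  refine ⟨C, hC0, fun c r hr x => ?_⟩
  by_cases hx : x ∈ Metric.closedBall c (2 * r)
  · rw [indicator_of_mem hx]
    have h1 : HasFDerivAt (fun x : E => r⁻¹ • (x - c)) (r⁻¹ • ContinuousLinearMap.id ℝ E) x :=
      ((hasFDerivAt_id x).sub_const c).const_smul r⁻¹
    have h2 := ((hd.differentiable (by simp) (r⁻¹ • (x - c))).hasFDerivAt).comp x h1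
    have h3 : fderiv ℝ (scaledBump c r) x = _ := h2.fderiv
    rw [h3, ContinuousLinearMap.comp_smul, ContinuousLinearMap.comp_id, norm_smul, norm_inv,
      Real.norm_of_nonneg hr.le, mul_comm]
    exact mul_le_mul_of_nonneg_right (hC _) (inv_nonneg.2 hr.le)
  · rw [indicator_of_notMem hx]
    have : scaledBump c r =ᶠ[𝓝 x] fun _ => 0 := by
      filter_upwards [Metric.isClosed_closedBall.isOpen_compl.mem_nhds hx] with y hy
      exact scaledBump_eq_zero hr hy
    rw [this.fderiv_eq]
    simp

/-- The product of the functions `1 - b` over finitely many scaled bump functions `b`. -/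
def bumpComplement (s : Finset ℕ) (c : ℕ → E) (r : ℕ → ℝ) (x : E) : ℝ :=
  ∏ i ∈ s, (1 - scaledBump (c i) (r i) x)

lemma contDiff_bumpComplement (s : Finset ℕ) (c : ℕ → E) (r : ℕ → ℝ) :
    ContDiff ℝ ∞ (bumpComplement s c r) :=
  contDiff_prod fun _ _ => contDiff_const.sub (contDiff_scaledBump _ _)

lemma bumpComplement_nonneg (s : Finset ℕ) (c : ℕ → E) (r : ℕ → ℝ) (x : E) :
    0 ≤ bumpComplement s c r x :=
  Finset.prod_nonneg fun _ _ => sub_nonneg.2 (scaledBump_le_one _ _ _)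

lemma bumpComplement_le_one (s : Finset ℕ) (c : ℕ → E) (r : ℕ → ℝ) (x : E) :
    bumpComplement s c r x ≤ 1 :=
  Finset.prod_le_one (fun _ _ => sub_nonneg.2 (scaledBump_le_one _ _ _))
    fun _ _ => by linarith [scaledBump_nonneg (c ‹_›) (r ‹_›) x]

lemma norm_fderiv_bumpComplement_le (s : Finset ℕ) (c : ℕ → E) (r : ℕ → ℝ) (x : E) :
    ‖fderiv ℝ (bumpComplement s c r) x‖ ≤ ∑ i ∈ s, ‖fderiv ℝ (scaledBump (c i) (r i)) x‖ := by
  classical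
  induction s using Finset.induction_on with
  | empty => simp [show bumpComplement ∅ c r = fun _ => 1 from rfl]
  | insert i s hi ih =>
    have h1 : HasFDerivAt (fun x => 1 - scaledBump (c i) (r i) x)
        (-fderiv ℝ (scaledBump (c i) (r i)) x) x :=
      ((contDiff_scaledBump _ _).differentiable (by simp) x).hasFDerivAt.const_sub 1
    have h2 := ((contDiff_bumpComplement s c r).differentiable (by simp) x).hasFDerivAt
    have h3 : bumpComplement (insert i s) c r =
        fun x => (1 - scaledBump (c i) (r i) x) * bumpComplement s c r x := by
      ext x
      simp [bumpComplement, Finset.prod_insert hi]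
    rw [h3, (h1.fun_mul h2).fderiv, Finset.sum_insert hi, add_comm]
    refine (norm_add_le _ _).trans (add_le_add ?_ ?_)
    · rw [norm_smul, norm_neg, Real.norm_of_nonneg (bumpComplement_nonneg _ _ _ _)]
      exact mul_le_of_le_one_left (norm_nonneg _) (bumpComplement_le_one _ _ _ _)
    · rw [norm_smul, Real.norm_of_nonneg (sub_nonneg.2 (scaledBump_le_one _ _ _))]
      exact (mul_le_of_le_one_left (norm_nonneg _)
        (by linarith [scaledBump_nonneg (c i) (r i) x])).trans ih

variable [MeasurableSpace E] [BorelSpace E]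

/-- A compact set of vanishing Hausdorff measure of codimension one has vanishing capacity with
respect to `W^{1,1}`: it can be cut off by smooth functions with gradients of small `L¹` norm. -/
theorem exists_cutoff {S : Set E} (hS : IsCompact S) {m : ℕ} (hm : Module.finrank ℝ E = m + 1)
    (h0 : Measure.hausdorffMeasure (m : ℝ) S = 0) {ε : ℝ} (hε : 0 < ε) :
    ∃ η : E → ℝ, ContDiff ℝ ∞ η ∧ (∀ x, 0 ≤ η x) ∧ (∀ x, η x ≤ 1) ∧ Disjoint (tsupport η) S ∧
      (∫ x, ‖fderiv ℝ η x‖) ≤ ε ∧ Integrable (fun x => ‖fderiv ℝ η x‖) ∧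
      ∃ A, MeasurableSet A ∧ volume.real A ≤ ε ∧ volume A ≠ ⊤ ∧ ∀ x, x ∉ A → η x = 1 := by
  obtain ⟨C, hC0, hC⟩ := exists_norm_fderiv_scaledBump_le E
  set V₁ : ℝ := (volume : Measure E).real (Metric.ball 0 1) with hV₁
  have hV0 : 0 ≤ V₁ := measureReal_nonneg
  set κ : ℝ := 2 ^ (m + 1) * V₁ * (C + 1) + 1 with hκ
  have hκ0 : 0 < κ := by positivity
  obtain ⟨s, c, r, hr, hcov, hsum⟩ := exists_finite_ball_cover hS h0 (div_pos hε hκ0)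
  have hvol : ∀ i ∈ s, (volume : Measure E).real (Metric.closedBall (c i) (2 * r i)) =
      2 ^ (m + 1) * V₁ * (r i ^ m * r i) := fun i hi => by
    rw [Measure.addHaar_real_closedBall _ _ (by linarith [(hr i hi).1]), hm, mul_pow, ← hV₁,
      pow_succ (r i)]
    ring
  have hcl : ∀ i, (volume : Measure E) (Metric.closedBall (c i) (2 * r i)) ≠ ⊤ := fun i =>
    measure_closedBall_lt_top.ne
  have hind : ∀ i, Integrable
      ((Metric.closedBall (c i) (2 * r i)).indicator fun _ : E => C * (r i)⁻¹) := fun i =>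
    (integrable_indicator_iff measurableSet_closedBall).2 (integrableOn_const (hcl i))
  have hsumle : 2 ^ (m + 1) * V₁ * (C + 1) * ∑ i ∈ s, r i ^ m ≤ ε := by
    have h1 : κ * ∑ i ∈ s, r i ^ m ≤ ε := by
      rw [mul_comm]
      exact (le_div_iff₀ hκ0).1 hsum
    have h2 : 0 ≤ ∑ i ∈ s, r i ^ m := Finset.sum_nonneg fun i hi => pow_nonneg (hr i hi).1.le m
    rw [hκ] at h1
    linarith
  have hsumr : 0 ≤ ∑ i ∈ s, r i ^ m := Finset.sum_nonneg fun i hi => pow_nonneg (hr i hi).1.le m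
  have hgrad : ∀ x, ‖fderiv ℝ (bumpComplement s c r) x‖ ≤
      ∑ i ∈ s, (Metric.closedBall (c i) (2 * r i)).indicator (fun _ : E => C * (r i)⁻¹) x :=
    fun x => (norm_fderiv_bumpComplement_le s c r x).trans
      (Finset.sum_le_sum fun i hi => hC (c i) (r i) (hr i hi).1 x)
  have hcd := contDiff_bumpComplement s c r
  have hint : Integrable (fun x => ‖fderiv ℝ (bumpComplement s c r) x‖) :=
    Integrable.mono' (integrable_finsetSum s fun i _ => hind i)
      (hcd.continuous_fderiv (by simp)).norm.aestronglyMeasurable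
      (Eventually.of_forall fun x => by
        rw [norm_norm]
        exact hgrad x)
  refine ⟨bumpComplement s c r, hcd, bumpComplement_nonneg s c r, bumpComplement_le_one s c r, ?_,
    ?_, hint, ⋃ i ∈ s, Metric.closedBall (c i) (2 * r i),
    Finset.measurableSet_biUnion _ fun i _ => measurableSet_closedBall, ?_, ?_, ?_⟩
  · have hopen : IsOpen (⋃ i ∈ s, Metric.ball (c i) (r i)) :=
      isOpen_biUnion fun _ _ => Metric.isOpen_ball
    have hsub : tsupport (bumpComplement s c r) ⊆ (⋃ i ∈ s, Metric.ball (c i) (r i))ᶜ := by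
      refine closure_minimal (fun x hx hx' => hx ?_) hopen.isClosed_compl
      simp only [mem_iUnion] at hx'
      obtain ⟨i, hi, hxi⟩ := hx'
      exact Finset.prod_eq_zero hi (by rw [scaledBump_eq_one (hr i hi).1 hxi, sub_self])
    exact disjoint_left.2 fun x hx hxS => hsub hx (hcov hxS)
  · calc ∫ x, ‖fderiv ℝ (bumpComplement s c r) x‖
        ≤ ∫ x, ∑ i ∈ s,
            (Metric.closedBall (c i) (2 * r i)).indicator (fun _ : E => C * (r i)⁻¹) x :=
          integral_mono hint (integrable_finsetSum s fun i _ => hind i) hgrad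
      _ = ∑ i ∈ s, 2 ^ (m + 1) * V₁ * C * r i ^ m := by
          rw [integral_finsetSum _ fun i _ => hind i]
          refine Finset.sum_congr rfl fun i hi => ?_
          rw [integral_indicator measurableSet_closedBall, setIntegral_const, hvol i hi,
            smul_eq_mul]
          have := (hr i hi).1.ne'
          field_simp
      _ = 2 ^ (m + 1) * V₁ * C * ∑ i ∈ s, r i ^ m := by rw [Finset.mul_sum]
      _ ≤ ε := by
          refine le_trans ?_ hsumle
          have : 0 ≤ 2 ^ (m + 1) * V₁ * ∑ i ∈ s, r i ^ m := by positivity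
          linarith
  · calc volume.real (⋃ i ∈ s, Metric.closedBall (c i) (2 * r i))
        ≤ ∑ i ∈ s, volume.real (Metric.closedBall (c i) (2 * r i)) :=
          measureReal_biUnion_finset_le _ _
      _ ≤ ∑ i ∈ s, 2 ^ (m + 1) * V₁ * r i ^ m := by
          refine Finset.sum_le_sum fun i hi => ?_
          rw [hvol i hi]
          refine mul_le_mul_of_nonneg_left ?_ (by positivity)
          exact mul_le_of_le_one_right (pow_nonneg (hr i hi).1.le m) (hr i hi).2
      _ = 2 ^ (m + 1) * V₁ * ∑ i ∈ s, r i ^ m := by rw [Finset.mul_sum]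
      _ ≤ ε := by
          refine le_trans ?_ hsumle
          have : 0 ≤ 2 ^ (m + 1) * V₁ * C * ∑ i ∈ s, r i ^ m := by positivity
          linarith
  · exact ((measure_biUnion_finset_le _ _).trans_lt
      (ENNReal.sum_lt_top.2 fun i _ => (hcl i).lt_top)).ne
  · intro x hx
    refine Finset.prod_eq_one fun i hi => ?_
    rw [scaledBump_eq_zero (hr i hi).1 fun h => hx (mem_biUnion hi h), sub_zero]

end Cutoff

/-! ### The divergence theorem for fields with vanishing normal trace -/

section Divergence

variable {n : ℕ} {Ω : Set (EuclideanSpace ℝ (Fin n))} {T : ℝ}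

/-- The value `G · ℓ = ∑ Gᵢ ℓ(eᵢ)` of a covector `ℓ` on the field `G`. -/
def fieldPairing (G : Fin n → EuclideanSpace ℝ (Fin n) × ℝ → ℝ) (z : EuclideanSpace ℝ (Fin n) × ℝ)
    (l : EuclideanSpace ℝ (Fin n) →L[ℝ] ℝ) : ℝ :=
  ∑ i, G i z * l (EuclideanSpace.single i 1)

/-- The trace of `G · n` on the smooth part of the lateral boundary vanishes, in the sense in which
`NormalDerivVanishes` expresses this for `G = ∇u`. -/
def NormalTraceVanishes (Ω : Set (EuclideanSpace ℝ (Fin n))) (T : ℝ)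
    (G : Fin n → EuclideanSpace ℝ (Fin n) × ℝ → ℝ) : Prop :=
  ∀ p ∈ smoothBoundary Ω, ∃ V ρ, IsDefiningFunction Ω p V ρ ∧
    Tendsto (fun ε : ℝ => ε⁻¹ * ∫ z in (Ω ∩ V ∩ {x | -ε < ρ x}) ×ˢ Ioo 0 T,
      |fieldPairing G z (fderiv ℝ ρ z.1)|) (𝓝[>] 0) (𝓝 0)

/-- `D` is the weak spatial divergence of the bounded measurable field `G` on the cylinder. -/
structure HasWeakDivergence (Ω : Set (EuclideanSpace ℝ (Fin n))) (T : ℝ)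
    (G : Fin n → EuclideanSpace ℝ (Fin n) × ℝ → ℝ) (D : EuclideanSpace ℝ (Fin n) × ℝ → ℝ) :
    Prop where
  aestronglyMeasurable : ∀ i, AEStronglyMeasurable (G i) (volume.restrict (spaceTime Ω T))
  exists_bound : ∃ M, ∀ i z, |G i z| ≤ M
  integrableOn : IntegrableOn D (spaceTime Ω T)
  integral_eq : ∀ ψ : EuclideanSpace ℝ (Fin n) × ℝ → ℝ, ContDiff ℝ 1 ψ → HasCompactSupport ψ →
    tsupport ψ ⊆ spaceTime Ω T →
    ∫ z in spaceTime Ω T, ∑ i, G i z * fderiv ℝ ψ z (EuclideanSpace.single i 1, 0) =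
      - ∫ z in spaceTime Ω T, D z * ψ z

variable {G : Fin n → EuclideanSpace ℝ (Fin n) × ℝ → ℝ} {D : EuclideanSpace ℝ (Fin n) × ℝ → ℝ}

lemma abs_fieldPairing_le {M : ℝ} (hM : ∀ i z, |G i z| ≤ M) (z : EuclideanSpace ℝ (Fin n) × ℝ)
    (l : EuclideanSpace ℝ (Fin n) →L[ℝ] ℝ) : |fieldPairing G z l| ≤ n * M * ‖l‖ := by
  refine (Finset.abs_sum_le_sum_abs _ _).trans ?_
  have : ∀ i ∈ Finset.univ, |G i z * l (EuclideanSpace.single i 1)| ≤ M * ‖l‖ := fun i _ => by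
    rw [abs_mul]
    refine mul_le_mul (hM i z) ?_ (abs_nonneg _) ((abs_nonneg _).trans (hM i z))
    have := l.le_opNorm (EuclideanSpace.single i (1 : ℝ))
    rwa [PiLp.norm_single, norm_one, mul_one] at this
  refine (Finset.sum_le_sum this).trans_eq ?_
  simp [mul_assoc]

lemma fieldPairing_add_smul (z : EuclideanSpace ℝ (Fin n) × ℝ)
    (l l' : EuclideanSpace ℝ (Fin n) →L[ℝ] ℝ) (a b : ℝ) :
    fieldPairing G z (a • l + b • l') = a * fieldPairing G z l + b * fieldPairing G z l' := by
  simp only [fieldPairing, Finset.mul_sum, ← Finset.sum_add_distrib]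
  refine Finset.sum_congr rfl fun i _ => ?_
  simp
  ring

lemma integrableOn_fieldPairing (hb : Bornology.IsBounded Ω) (hΩ : IsOpen Ω)
    (hG : ∀ i, IntegrableOn (G i) (spaceTime Ω T))
    {l : EuclideanSpace ℝ (Fin n) → EuclideanSpace ℝ (Fin n) →L[ℝ] ℝ} (hl : Continuous l) :
    IntegrableOn (fun z => fieldPairing G z (l z.1)) (spaceTime Ω T) := by
  refine integrable_finsetSum _ fun i _ => ?_
  have hli : Continuous fun x => l x (EuclideanSpace.single i 1) := by fun_prop
  obtain ⟨C, hC⟩ := hb.isCompact_closure.exists_bound_of_continuousOn hli.continuousOn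
  refine Integrable.mul_bdd (c := C) (hG i) (hli.comp continuous_fst).aestronglyMeasurable ?_
  filter_upwards [ae_mem_spaceTime hΩ] with z hz
  exact hC _ (subset_closure hz.1)

lemma HasWeakDivergence.integrableOn_fieldPairing (hG : HasWeakDivergence Ω T G D)
    (hΩ : IsOpen Ω) (hb : Bornology.IsBounded Ω)
    {l : EuclideanSpace ℝ (Fin n) → EuclideanSpace ℝ (Fin n) →L[ℝ] ℝ} (hl : Continuous l) :
    IntegrableOn (fun z => fieldPairing G z (l z.1)) (spaceTime Ω T) := by
  obtain ⟨M, hM⟩ := hG.exists_bound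
  have : IsFiniteMeasure (volume.restrict (spaceTime Ω T)) := by
    have : IsFiniteMeasure (volume.restrict Ω) := ⟨by simpa using hb.measure_lt_top⟩
    rw [spaceTime, restrict_spaceTime]
    infer_instance
  exact _root_.integrableOn_fieldPairing hb hΩ (fun i => Integrable.of_bound
    (hG.aestronglyMeasurable i) M (Eventually.of_forall fun z => hM i z)) hl

/-- A smooth step that vanishes up to `1/2` and equals `1` from `1` on. It vanishes near `0` so that
its composition with `-ρ/ε` has support away from the boundary. -/
def halfStep (s : ℝ) : ℝ := Real.smoothTransition (2 * s - 1)

lemma contDiff_halfStep : ContDiff ℝ ∞ halfStep :=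
  Real.smoothTransition.contDiff.comp (by fun_prop)

lemma halfStep_eq_zero {s : ℝ} (hs : s ≤ 1 / 2) : halfStep s = 0 :=
  Real.smoothTransition.zero_of_nonpos (by linarith)

lemma halfStep_eq_one {s : ℝ} (hs : 1 ≤ s) : halfStep s = 1 :=
  Real.smoothTransition.one_of_one_le (by linarith)

lemma abs_halfStep_le_one (s : ℝ) : |halfStep s| ≤ 1 := by
  rw [halfStep, abs_of_nonneg (Real.smoothTransition.nonneg _)]
  exact Real.smoothTransition.le_one _

lemma deriv_halfStep_eq_zero {s : ℝ} (hs : s ≤ 1 / 2 ∨ 1 ≤ s) : deriv halfStep s = 0 := by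
  rcases hs with hs | hs
  · refine IsLocalMin.deriv_eq_zero (Eventually.of_forall fun t => ?_)
    rw [halfStep_eq_zero hs]
    exact Real.smoothTransition.nonneg _
  · refine IsLocalMax.deriv_eq_zero (Eventually.of_forall fun t => ?_)
    rw [halfStep_eq_one hs]
    exact Real.smoothTransition.le_one _

lemma exists_abs_deriv_halfStep_le : ∃ C, 0 ≤ C ∧ ∀ s, |deriv halfStep s| ≤ C := by
  obtain ⟨C, hC⟩ := HasCompactSupport.exists_bound_of_continuous (f := deriv halfStep)
    (HasCompactSupport.intro (isCompact_Icc (a := (1 / 2 : ℝ)) (b := 1)) fun s hs =>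
      deriv_halfStep_eq_zero <| by
        by_contra! h
        exact hs ⟨h.1.le, h.2.le⟩)
    (contDiff_halfStep.continuous_deriv (by simp))
  exact ⟨C, (norm_nonneg _).trans (hC 0), hC⟩

/-- The divergence theorem near a smooth boundary point, localized by `ζ`. The test functions
`ζ · h(-ρ/ε)` are admissible and tend to `ζ` in `Ω`; the contribution of the gradient of
`h(-ρ/ε)` is the normal trace over the layer `-ε < ρ < 0`, which vanishes in the limit. -/
lemma HasWeakDivergence.integral_eq_zero_of_tsupport_subset_chart
    (hG : HasWeakDivergence Ω T G D) (hΩ : IsOpen Ω) (hb : Bornology.IsBounded Ω)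
    {p : EuclideanSpace ℝ (Fin n)} {V : Set (EuclideanSpace ℝ (Fin n))}
    {ρ : EuclideanSpace ℝ (Fin n) → ℝ} (hρ : IsDefiningFunction Ω p V ρ)
    (hflux : Tendsto (fun ε : ℝ => ε⁻¹ * ∫ z in (Ω ∩ V ∩ {x | -ε < ρ x}) ×ˢ Ioo 0 T,
      |fieldPairing G z (fderiv ℝ ρ z.1)|) (𝓝[>] 0) (𝓝 0))
    {χ : ℝ → ℝ} (hχ : ContDiff ℝ ∞ χ) (hχc : HasCompactSupport χ) (hχs : tsupport χ ⊆ Ioo 0 T)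
    {ζ : EuclideanSpace ℝ (Fin n) → ℝ} (hζ : ContDiff ℝ ∞ ζ) (hζc : HasCompactSupport ζ)
    (hζs : tsupport ζ ⊆ V) :
    ∫ z in spaceTime Ω T, (D z * ζ z.1 + fieldPairing G z (fderiv ℝ ζ z.1)) * χ z.2 = 0 := by
  obtain ⟨Mζ, hMζ⟩ := hζc.exists_bound_of_continuous hζ.continuous
  obtain ⟨Mχ, hMχ⟩ := hχc.exists_bound_of_continuous hχ.continuous
  obtain ⟨C, hC0, hC⟩ := exists_abs_deriv_halfStep_le
  have hMζ0 : 0 ≤ Mζ := (norm_nonneg _).trans (hMζ 0)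
  have hMχ0 : 0 ≤ Mχ := (norm_nonneg _).trans (hMχ 0)
  have hmem : ∀ x ∈ Ω, x ∈ V → ρ x < 0 := fun x hx hxV => by
    have : x ∈ {x ∈ V | ρ x < 0} := hρ.inter_eq ▸ ⟨hx, hxV⟩
    exact this.2
  have hmem' : ∀ x ∈ V, ρ x < 0 → x ∈ Ω := fun x hx hxρ => by
    have : x ∈ Ω ∩ V := hρ.inter_eq ▸ ⟨hx, hxρ⟩
    exact this.1
  have hρd : Continuous (fderiv ℝ ρ) := hρ.contDiff.continuous_fderiv (by simp)
  have hP := hG.integrableOn_fieldPairing (T := T) hΩ hb (hζ.continuous_fderiv (by simp))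
  have hR := hG.integrableOn_fieldPairing (T := T) hΩ hb hρd
  have hDζ : IntegrableOn (fun z => D z * ζ z.1) (spaceTime Ω T) :=
    Integrable.mul_bdd (c := Mζ) hG.integrableOn
      (hζ.continuous.comp continuous_fst).aestronglyMeasurable
      (Eventually.of_forall fun z => hMζ z.1)
  have hmain : IntegrableOn (fun z => (D z * ζ z.1 + fieldPairing G z (fderiv ℝ ζ z.1)) * χ z.2)
      (spaceTime Ω T) :=
    Integrable.mul_bdd (c := Mχ) (hDζ.add hP)
      (hχ.continuous.comp continuous_snd).aestronglyMeasurable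
      (Eventually.of_forall fun z => hMχ z.2)
  have hstep_cont : ∀ ε : ℝ, Continuous fun z : EuclideanSpace ℝ (Fin n) × ℝ =>
      halfStep (-ρ z.1 / ε) := fun ε =>
    contDiff_halfStep.continuous.comp
      ((hρ.contDiff.continuous.comp continuous_fst).neg.div_const ε)
  have hstep'_cont : ∀ ε : ℝ, Continuous fun z : EuclideanSpace ℝ (Fin n) × ℝ =>
      deriv halfStep (-ρ z.1 / ε) := fun ε =>
    (contDiff_halfStep.continuous_deriv (by simp)).comp
      ((hρ.contDiff.continuous.comp continuous_fst).neg.div_const ε)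
  have hI1 : ∀ ε : ℝ, IntegrableOn (fun z => halfStep (-ρ z.1 / ε) *
      ((D z * ζ z.1 + fieldPairing G z (fderiv ℝ ζ z.1)) * χ z.2)) (spaceTime Ω T) := fun ε =>
    Integrable.bdd_mul (c := 1) hmain (hstep_cont ε).aestronglyMeasurable
      (Eventually.of_forall fun z => abs_halfStep_le_one _)
  have hI2 : ∀ ε : ℝ, IntegrableOn (fun z => (ζ z.1 * deriv halfStep (-ρ z.1 / ε) * χ z.2) *
      fieldPairing G z (fderiv ℝ ρ z.1)) (spaceTime Ω T) := fun ε =>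
    Integrable.bdd_mul (c := Mζ * C * Mχ) hR
      (((hζ.continuous.comp continuous_fst).mul (hstep'_cont ε)).mul
        (hχ.continuous.comp continuous_snd)).aestronglyMeasurable
      (Eventually.of_forall fun z => by
        rw [norm_mul, norm_mul]
        exact mul_le_mul (mul_le_mul (hMζ _) (hC _) (norm_nonneg _) hMζ0) (hMχ _)
          (norm_nonneg _) (mul_nonneg hMζ0 hC0))
  -- The weak divergence is tested with `ζ(x) h(-ρ(x)/ε) χ(t)`, which is only `C¹`, like `ρ`.
  have hid : ∀ ε : ℝ, 0 < ε → ∫ z in spaceTime Ω T, halfStep (-ρ z.1 / ε) *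
      ((D z * ζ z.1 + fieldPairing G z (fderiv ℝ ζ z.1)) * χ z.2) =
      ε⁻¹ * ∫ z in spaceTime Ω T, (ζ z.1 * deriv halfStep (-ρ z.1 / ε) * χ z.2) *
        fieldPairing G z (fderiv ℝ ρ z.1) := by
    intro ε hε
    set K : Set (EuclideanSpace ℝ (Fin n)) := tsupport ζ ∩ {x | ρ x ≤ -(ε / 2)} with hK
    have hKc : IsCompact K :=
      hζc.isCompact.inter_right (isClosed_le hρ.contDiff.continuous continuous_const)
    have hKΩ : K ⊆ Ω := fun x hx => hmem' x (hζs hx.1) (by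
      have : ρ x ≤ -(ε / 2) := hx.2
      linarith)
    have h0 : ∀ x, x ∉ K → ζ x * halfStep (-ρ x / ε) = 0 := fun x hx => by
      by_cases hxζ : x ∈ tsupport ζ
      · have hxρ : -(ε / 2) < ρ x := not_le.1 fun h => hx ⟨hxζ, h⟩
        rw [halfStep_eq_zero, mul_zero]
        rw [div_le_iff₀ hε]
        linarith
      · rw [image_eq_zero_of_notMem_tsupport hxζ, zero_mul]
    have hψ : ContDiff ℝ 1 (fun x => ζ x * halfStep (-ρ x / ε)) :=
      (hζ.of_le (by norm_cast)).mul
        ((contDiff_halfStep.of_le (by norm_cast)).comp (hρ.contDiff.neg.div_const ε))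
    obtain ⟨hd, hc, hs, hder⟩ := product_test_function one_ne_zero hψ
      (HasCompactSupport.intro hKc h0)
      ((closure_minimal (Function.support_subset_iff'.2 h0) hKc.isClosed).trans hKΩ)
      (hχ.of_le (by norm_cast)) hχc hχs
    have key := hG.integral_eq _ hd hc hs
    have hfd : ∀ x, fderiv ℝ (fun x => ζ x * halfStep (-ρ x / ε)) x =
        halfStep (-ρ x / ε) • fderiv ℝ ζ x +
          (-(ε⁻¹ * (ζ x * deriv halfStep (-ρ x / ε)))) • fderiv ℝ ρ x := by
      intro x
      have h1 := (hζ.differentiable (by simp) x).hasFDerivAt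
      have h2 : HasFDerivAt (fun x => -ρ x / ε) (-(ε⁻¹ • fderiv ℝ ρ x)) x := by
        have := ((hρ.contDiff.differentiable (by simp) x).hasFDerivAt.const_smul ε⁻¹).neg
        refine this.congr_of_eventuallyEq (Eventually.of_forall fun y => ?_)
        simp [div_eq_inv_mul]
      have h3 := (contDiff_halfStep.differentiable (by simp) (-ρ x / ε)).hasDerivAt
      have h4 : HasFDerivAt (fun x => halfStep (-ρ x / ε))
          (deriv halfStep (-ρ x / ε) • -(ε⁻¹ • fderiv ℝ ρ x)) x :=
        HasDerivAt.comp_hasFDerivAt (h₂ := halfStep) x h3 h2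
      rw [(h1.fun_mul h4).fderiv]
      ext y
      simp
      ring
    simp only [hder, hfd] at key
    have e1 : ∀ z : EuclideanSpace ℝ (Fin n) × ℝ, ∑ i, G i z *
        ((halfStep (-ρ z.1 / ε) • fderiv ℝ ζ z.1 +
          (-(ε⁻¹ * (ζ z.1 * deriv halfStep (-ρ z.1 / ε)))) • fderiv ℝ ρ z.1)
            (EuclideanSpace.single i 1) * χ z.2) =
        (halfStep (-ρ z.1 / ε) * ((D z * ζ z.1 + fieldPairing G z (fderiv ℝ ζ z.1)) * χ z.2) -
          ε⁻¹ * ((ζ z.1 * deriv halfStep (-ρ z.1 / ε) * χ z.2) *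
            fieldPairing G z (fderiv ℝ ρ z.1))) -
          D z * (ζ z.1 * halfStep (-ρ z.1 / ε) * χ z.2) := by
      intro z
      have := fieldPairing_add_smul (G := G) z (fderiv ℝ ζ z.1) (fderiv ℝ ρ z.1)
        (halfStep (-ρ z.1 / ε)) (-(ε⁻¹ * (ζ z.1 * deriv halfStep (-ρ z.1 / ε))))
      rw [show (∑ i, G i z * ((halfStep (-ρ z.1 / ε) • fderiv ℝ ζ z.1 +
          (-(ε⁻¹ * (ζ z.1 * deriv halfStep (-ρ z.1 / ε)))) • fderiv ℝ ρ z.1)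
            (EuclideanSpace.single i 1) * χ z.2)) = fieldPairing G z (halfStep (-ρ z.1 / ε) •
              fderiv ℝ ζ z.1 + (-(ε⁻¹ * (ζ z.1 * deriv halfStep (-ρ z.1 / ε)))) •
                fderiv ℝ ρ z.1) * χ z.2 by
          rw [fieldPairing, Finset.sum_mul]
          exact Finset.sum_congr rfl fun i _ => by ring, this]
      ring
    simp only [e1] at key
    have hI3 : IntegrableOn (fun z => D z * (ζ z.1 * halfStep (-ρ z.1 / ε) * χ z.2))
        (spaceTime Ω T) := by
      obtain ⟨M, hM⟩ := hc.exists_bound_of_continuous hd.continuous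
      exact Integrable.mul_bdd (c := M) hG.integrableOn hd.continuous.aestronglyMeasurable
        (Eventually.of_forall hM)
    have hI12 : IntegrableOn (fun z => halfStep (-ρ z.1 / ε) *
        ((D z * ζ z.1 + fieldPairing G z (fderiv ℝ ζ z.1)) * χ z.2) -
        ε⁻¹ * ((ζ z.1 * deriv halfStep (-ρ z.1 / ε) * χ z.2) *
            fieldPairing G z (fderiv ℝ ρ z.1))) (spaceTime Ω T) :=
      (hI1 ε).sub ((hI2 ε).const_mul _)
    rw [integral_sub hI12 hI3, integral_sub (hI1 ε) ((hI2 ε).const_mul _), integral_const_mul]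
      at key
    linarith
  have hlim1 : Tendsto (fun ε : ℝ => ∫ z in spaceTime Ω T, halfStep (-ρ z.1 / ε) *
      ((D z * ζ z.1 + fieldPairing G z (fderiv ℝ ζ z.1)) * χ z.2)) (𝓝[>] 0)
      (𝓝 (∫ z in spaceTime Ω T, (D z * ζ z.1 + fieldPairing G z (fderiv ℝ ζ z.1)) * χ z.2)) := by
    refine tendsto_integral_filter_of_dominated_convergence
      (fun z => ‖(D z * ζ z.1 + fieldPairing G z (fderiv ℝ ζ z.1)) * χ z.2‖)
      (Eventually.of_forall fun ε => (hI1 ε).aestronglyMeasurable)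
      (Eventually.of_forall fun ε => Eventually.of_forall fun z => ?_) hmain.norm ?_
    · rw [norm_mul]
      exact mul_le_of_le_one_left (norm_nonneg _) (abs_halfStep_le_one _)
    · filter_upwards [ae_mem_spaceTime hΩ] with z hz
      by_cases hzζ : z.1 ∈ tsupport ζ
      · have hneg := hmem z.1 hz.1 (hζs hzζ)
        refine tendsto_const_nhds.congr' ?_
        filter_upwards [self_mem_nhdsWithin, nhdsWithin_le_nhds
          (gt_mem_nhds (show (0 : ℝ) < -ρ z.1 by linarith))] with ε hε hε'
        rw [halfStep_eq_one, one_mul]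
        rw [le_div_iff₀ hε]
        linarith
      · have h1 : fderiv ℝ ζ z.1 = 0 :=
          image_eq_zero_of_notMem_tsupport fun h => hzζ (tsupport_fderiv_subset ℝ h)
        rw [image_eq_zero_of_notMem_tsupport hzζ, h1]
        simp [fieldPairing]
  have hlim2 : Tendsto (fun ε : ℝ => ε⁻¹ * ∫ z in spaceTime Ω T,
      (ζ z.1 * deriv halfStep (-ρ z.1 / ε) * χ z.2) * fieldPairing G z (fderiv ℝ ρ z.1))
      (𝓝[>] 0) (𝓝 0) := by
    have hl := hflux.const_mul (Mζ * C * Mχ)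
    rw [mul_zero] at hl
    refine squeeze_zero_norm' ?_ hl
    filter_upwards [self_mem_nhdsWithin] with ε hε
    have hε0 : (0 : ℝ) < ε := hε
    set S : Set (EuclideanSpace ℝ (Fin n) × ℝ) := (Ω ∩ V ∩ {x | -ε < ρ x}) ×ˢ Ioo 0 T with hS
    have hSm : MeasurableSet S :=
      (((hΩ.inter hρ.isOpen).inter
        (isOpen_lt continuous_const hρ.contDiff.continuous)).measurableSet).prod measurableSet_Ioo
    have hSQ : S ⊆ spaceTime Ω T := prod_mono_left fun x hx => hx.1.1
    have hle : ‖∫ z in spaceTime Ω T, (ζ z.1 * deriv halfStep (-ρ z.1 / ε) * χ z.2) *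
        fieldPairing G z (fderiv ℝ ρ z.1)‖ ≤
        (Mζ * C * Mχ) * ∫ z in S, |fieldPairing G z (fderiv ℝ ρ z.1)| := by
      have hSint : IntegrableOn (S.indicator fun z => |fieldPairing G z (fderiv ℝ ρ z.1)|)
          (spaceTime Ω T) := hR.abs.indicator hSm
      rw [← inter_eq_self_of_subset_right hSQ, ← setIntegral_indicator hSm, ← integral_const_mul]
      refine norm_integral_le_of_norm_le (hSint.const_mul _) ?_
      filter_upwards [ae_mem_spaceTime hΩ] with z hz
      rw [norm_mul]
      by_cases hzS : z ∈ S
      · rw [indicator_of_mem hzS]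
        refine mul_le_mul_of_nonneg_right ?_ (abs_nonneg _)
        rw [norm_mul, norm_mul]
        exact mul_le_mul (mul_le_mul (hMζ _) (hC _) (norm_nonneg _) hMζ0) (hMχ _)
          (norm_nonneg _) (mul_nonneg hMζ0 hC0)
      · rw [indicator_of_notMem hzS, mul_zero]
        by_cases hzζ : z.1 ∈ tsupport ζ
        · have hzρ : ρ z.1 ≤ -ε := not_lt.1 fun h => hzS ⟨⟨⟨hz.1, hζs hzζ⟩, h⟩, hz.2⟩
          rw [deriv_halfStep_eq_zero (Or.inr _)]
          · simp
          · rw [le_div_iff₀ hε0]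
            linarith
        · rw [image_eq_zero_of_notMem_tsupport hzζ]
          simp
    rw [norm_mul, Real.norm_of_nonneg (inv_nonneg.2 hε0.le)]
    calc _ ≤ ε⁻¹ * ((Mζ * C * Mχ) * ∫ z in S, |fieldPairing G z (fderiv ℝ ρ z.1)|) :=
          mul_le_mul_of_nonneg_left hle (inv_nonneg.2 hε0.le)
      _ = _ := by ring
  have heq : (fun ε : ℝ => ∫ z in spaceTime Ω T, halfStep (-ρ z.1 / ε) *
      ((D z * ζ z.1 + fieldPairing G z (fderiv ℝ ζ z.1)) * χ z.2)) =ᶠ[𝓝[>] 0]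
      fun ε : ℝ => ε⁻¹ * ∫ z in spaceTime Ω T,
      (ζ z.1 * deriv halfStep (-ρ z.1 / ε) * χ z.2) * fieldPairing G z (fderiv ℝ ρ z.1) := by
    filter_upwards [self_mem_nhdsWithin] with ε hε
    exact hid ε hε
  exact tendsto_nhds_unique (hlim1.congr' heq) hlim2

end Divergence

section Divergence

variable {n : ℕ} {Ω : Set (EuclideanSpace ℝ (Fin n))} {T : ℝ}
variable {G : Fin n → EuclideanSpace ℝ (Fin n) × ℝ → ℝ} {D : EuclideanSpace ℝ (Fin n) × ℝ → ℝ}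

lemma isCompact_frontier_sdiff_smoothBoundary (hb : Bornology.IsBounded Ω) :
    IsCompact (frontier Ω \ smoothBoundary Ω) := by
  set W : Set (EuclideanSpace ℝ (Fin n)) :=
    ⋃₀ {V | ∃ p ρ, IsDefiningFunction Ω p V ρ} with hW
  have hWo : IsOpen W := isOpen_sUnion fun V ⟨_, _, h⟩ => h.isOpen
  have : frontier Ω \ smoothBoundary Ω = frontier Ω \ W := by
    ext x
    refine and_congr_right fun hx => not_congr ⟨?_, ?_⟩
    · rintro ⟨V, ρ, h⟩
      exact ⟨V, ⟨x, ρ, h⟩, h.mem⟩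
    · rintro ⟨V, ⟨p, ρ, h⟩, hxV⟩
      exact ⟨V, ρ, hx, h.isOpen, hxV, h.contDiff, h.fderiv_ne_zero, h.inter_eq⟩
  rw [this]
  exact (hb.isCompact_closure.of_isClosed_subset isClosed_frontier frontier_subset_closure).diff hWo

/-- The divergence theorem, localized by a function `ζ` whose support avoids the singular part of
the boundary. -/
lemma HasWeakDivergence.integral_eq_zero_of_disjoint_singular
    (hG : HasWeakDivergence Ω T G D) (hΩ : IsOpen Ω) (hb : Bornology.IsBounded Ω)
    (hflux : NormalTraceVanishes Ω T G)
    {χ : ℝ → ℝ} (hχ : ContDiff ℝ ∞ χ) (hχc : HasCompactSupport χ) (hχs : tsupport χ ⊆ Ioo 0 T)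
    {ζ : EuclideanSpace ℝ (Fin n) → ℝ} (hζ : ContDiff ℝ ∞ ζ) (hζc : HasCompactSupport ζ)
    (hζs : Disjoint (tsupport ζ) (frontier Ω \ smoothBoundary Ω)) :
    ∫ z in spaceTime Ω T, (D z * ζ z.1 + fieldPairing G z (fderiv ℝ ζ z.1)) * χ z.2 = 0 := by
  set L : (EuclideanSpace ℝ (Fin n) → ℝ) → ℝ := fun ζ =>
    ∫ z in spaceTime Ω T, (D z * ζ z.1 + fieldPairing G z (fderiv ℝ ζ z.1)) * χ z.2 with hL
  have hint : ∀ ζ : EuclideanSpace ℝ (Fin n) → ℝ, ContDiff ℝ ∞ ζ → HasCompactSupport ζ →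
      IntegrableOn (fun z => (D z * ζ z.1 + fieldPairing G z (fderiv ℝ ζ z.1)) * χ z.2)
        (spaceTime Ω T) := by
    intro ζ hζ hζc
    obtain ⟨Mζ, hMζ⟩ := hζc.exists_bound_of_continuous hζ.continuous
    have hDζ : IntegrableOn (fun z => D z * ζ z.1) (spaceTime Ω T) :=
      Integrable.mul_bdd (c := Mζ) hG.integrableOn
        (hζ.continuous.comp continuous_fst).aestronglyMeasurable
        (Eventually.of_forall fun z => hMζ z.1)
    exact IntegrableOn.mul_of_continuousOn_time hΩ
      (hDζ.add (hG.integrableOn_fieldPairing hΩ hb (hζ.continuous_fderiv (by simp))))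
      hχ.continuous.continuousOn
  -- Every point of the support has a neighbourhood in which the claim holds; a partition of unity
  -- then gives the claim for `ζ`.
  have hlocal : ∀ x : tsupport ζ, ∃ U : Set (EuclideanSpace ℝ (Fin n)), IsOpen U ∧ x.1 ∈ U ∧
      ∀ ζ' : EuclideanSpace ℝ (Fin n) → ℝ, ContDiff ℝ ∞ ζ' → HasCompactSupport ζ' →
        tsupport ζ' ⊆ U → L ζ' = 0 := by
    rintro ⟨x, hx⟩
    by_cases hxΩ : x ∈ Ω
    · refine ⟨Ω, hΩ, hxΩ, fun ζ' h1 h2 h3 => ?_⟩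
      obtain ⟨hd, hc, hs, hder⟩ := product_test_function (T := T) one_ne_zero
        (h1.of_le (by norm_cast)) h2 h3 (hχ.of_le (by norm_cast)) hχc hχs
      have key := hG.integral_eq _ hd hc hs
      simp only [hder] at key
      obtain ⟨M, hM⟩ := hc.exists_bound_of_continuous hd.continuous
      have i1 : IntegrableOn (fun z => D z * (ζ' z.1 * χ z.2)) (spaceTime Ω T) :=
        Integrable.mul_bdd (c := M) hG.integrableOn hd.continuous.aestronglyMeasurable
          (Eventually.of_forall hM)
      have e : ∀ z : EuclideanSpace ℝ (Fin n) × ℝ,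
          ∑ i, G i z * (fderiv ℝ ζ' z.1 (EuclideanSpace.single i 1) * χ z.2) =
          (D z * ζ' z.1 + fieldPairing G z (fderiv ℝ ζ' z.1)) * χ z.2 - D z * (ζ' z.1 * χ z.2) := by
        intro z
        simp only [fieldPairing, add_mul, Finset.sum_mul, mul_assoc, add_sub_cancel_left]
      simp only [e] at key
      rw [integral_sub (hint ζ' h1 h2) i1] at key
      simp only [hL]
      linarith
    by_cases hxc : x ∈ closure Ω
    · have hxf : x ∈ frontier Ω := ⟨hxc, by rwa [hΩ.interior_eq]⟩
      have hxs : x ∈ smoothBoundary Ω := by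
        by_contra h
        exact disjoint_left.1 hζs hx ⟨hxf, h⟩
      obtain ⟨V, ρ, hρ, hlim⟩ := hflux x hxs
      exact ⟨V, hρ.isOpen, hρ.mem, fun ζ' h1 h2 h3 =>
        hG.integral_eq_zero_of_tsupport_subset_chart hΩ hb hρ hlim hχ hχc hχs h1 h2 h3⟩
    · refine ⟨(closure Ω)ᶜ, isClosed_closure.isOpen_compl, hxc, fun ζ' h1 h2 h3 => ?_⟩
      refine setIntegral_eq_zero_of_forall_eq_zero fun z hz => ?_
      have hz' : z.1 ∉ tsupport ζ' := fun h => h3 h (subset_closure hz.1)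
      have hd0 : fderiv ℝ ζ' z.1 = 0 :=
        image_eq_zero_of_notMem_tsupport fun h => hz' (tsupport_fderiv_subset ℝ h)
      rw [image_eq_zero_of_notMem_tsupport hz', hd0]
      simp [fieldPairing]
  choose U hUo hUx hU0 using hlocal
  obtain ⟨t, ht⟩ := hζc.isCompact.elim_finite_subcover U hUo fun x hx =>
    mem_iUnion.2 ⟨⟨x, hx⟩, hUx ⟨x, hx⟩⟩
  obtain ⟨f, hf⟩ := SmoothPartitionOfUnity.exists_isSubordinate
    (modelWithCornersSelf ℝ (EuclideanSpace ℝ (Fin n))) (isClosed_tsupport ζ)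
    (fun i : t => U i.1) (fun i => hUo i.1) (fun x hx => by
      obtain ⟨i, hi, hxi⟩ := mem_iUnion₂.1 (ht hx)
      exact mem_iUnion.2 ⟨⟨i, hi⟩, hxi⟩)
  have hfs : ∀ i, ContDiff ℝ ∞ (f i) := fun i => (f i).contMDiff.contDiff
  have hfζ : ∀ i, ContDiff ℝ ∞ (fun x => f i x * ζ x) := fun i => (hfs i).mul hζ
  have hfζc : ∀ i, HasCompactSupport (fun x => f i x * ζ x) := fun i => hζc.mul_left
  have hsum : ζ = fun x => ∑ i, f i x * ζ x := by
    ext x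
    by_cases hx : x ∈ tsupport ζ
    · have := f.sum_eq_one hx
      rw [finsum_eq_sum_of_fintype] at this
      rw [← Finset.sum_mul, this, one_mul]
    · simp [image_eq_zero_of_notMem_tsupport hx]
  have hfd : ∀ x, fderiv ℝ ζ x = ∑ i, fderiv ℝ (fun x => f i x * ζ x) x := by
    intro x
    conv_lhs => rw [hsum]
    exact fderiv_fun_sum fun i _ => (hfζ i).differentiable (by simp) x
  calc L ζ = ∑ i, L (fun x => f i x * ζ x) := by
        simp only [hL]
        rw [← integral_finsetSum _ fun i _ => hint _ (hfζ i) (hfζc i)]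
        congr 1
        ext z
        rw [← Finset.sum_mul, Finset.sum_add_distrib, hfd, ← Finset.mul_sum]
        congr 2
        · conv_lhs => rw [hsum]
        · simp only [fieldPairing, sum_apply, Finset.mul_sum]
          exact Finset.sum_comm
    _ = 0 := Finset.sum_eq_zero fun i _ =>
        hU0 i.1 _ (hfζ i) (hfζc i) ((tsupport_mul_subset_left).trans (hf i))

/-- The divergence theorem on a piecewise smooth domain: the integral of the divergence of
a bounded field with vanishing normal trace is zero. The singular part of the boundary does not
contribute, as it is negligible for bounded fields. -/
theorem HasWeakDivergence.integral_mul_time_eq_zero (hG : HasWeakDivergence Ω T G D)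
    (hΩ : IsPiecewiseSmoothDomain Ω) (hn : n ≠ 0) (hflux : NormalTraceVanishes Ω T G)
    {χ : ℝ → ℝ} (hχ : ContDiff ℝ ∞ χ) (hχc : HasCompactSupport χ) (hχs : tsupport χ ⊆ Ioo 0 T) :
    ∫ z in spaceTime Ω T, D z * χ z.2 = 0 := by
  obtain ⟨m, rfl⟩ := Nat.exists_eq_succ_of_ne_zero hn
  have hb := hΩ.isBounded
  have hΩo := hΩ.isOpen
  have hfin : volume Ω ≠ ⊤ := hb.measure_lt_top.ne
  have hS := isCompact_frontier_sdiff_smoothBoundary hb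
  have hnull : Measure.hausdorffMeasure (m : ℝ) (frontier Ω \ smoothBoundary Ω) = 0 := by
    have := hΩ.singular_null
    have hm : ((m.succ : ℕ) : ℝ) - 1 = m := by push_cast; ring
    rwa [hm] at this
  have hcut := fun k : ℕ => exists_cutoff hS (m := m) (by simp) hnull
    (show (0 : ℝ) < 1 / ((k : ℝ) + 1) by positivity)
  choose η hηd hη0 hη1 hηS hηI hηi A hAm hA hAf hηA using hcut
  obtain ⟨M, hM⟩ := hG.exists_bound
  obtain ⟨Mχ, hMχ⟩ := hχc.exists_bound_of_continuous hχ.continuous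
  have hMχ0 : 0 ≤ Mχ := (norm_nonneg _).trans (hMχ 0)
  obtain ⟨R, hR0, hR⟩ := hb.subset_closedBall_lt 0 0
  set B : ContDiffBump (0 : EuclideanSpace ℝ (Fin (m + 1))) := ⟨R, R + 1, hR0, by linarith⟩ with hB
  have hB1 : ∀ x ∈ Ω, B =ᶠ[𝓝 x] 1 := by
    intro x hx
    filter_upwards [hΩo.mem_nhds hx] with y hy
    exact B.one_of_mem_closedBall (hR hy)
  have hDχ : IntegrableOn (fun z => D z * χ z.2) (spaceTime Ω T) :=
    IntegrableOn.mul_of_continuousOn_time hΩo hG.integrableOn hχ.continuous.continuousOn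
  set s : ℕ → Set (EuclideanSpace ℝ (Fin (m + 1)) × ℝ) := fun k => Prod.fst ⁻¹' A k with hs
  have hsm : ∀ k, MeasurableSet (s k) := fun k => measurable_fst (hAm k)
  have hμs : Tendsto (fun k => (volume.restrict (spaceTime Ω T)) (s k)) atTop (𝓝 0) := by
    have hle : ∀ k, (volume.restrict (spaceTime Ω T)) (s k) ≤
        ENNReal.ofReal (1 / ((k : ℝ) + 1)) * volume (Ioo 0 T) := by
      intro k
      have hsk : s k = A k ×ˢ univ := prod_univ.symm
      rw [spaceTime, restrict_spaceTime, hsk, Measure.prod_prod,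
        Measure.restrict_apply_univ]
      refine mul_le_mul_left ?_ _
      refine (Measure.restrict_apply_le _ _).trans ?_
      rw [← ENNReal.ofReal_toReal (hAf k)]
      exact ENNReal.ofReal_le_ofReal (hA k)
    have hlim : Tendsto (fun k : ℕ => ENNReal.ofReal (1 / ((k : ℝ) + 1)) * volume (Ioo 0 T)) atTop
        (𝓝 (ENNReal.ofReal 0 * volume (Ioo 0 T))) :=
      ENNReal.Tendsto.mul_const (ENNReal.tendsto_ofReal tendsto_one_div_add_atTop_nhds_zero_nat)
        (Or.inr (by simp))
    rw [ENNReal.ofReal_zero, zero_mul] at hlim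
    exact tendsto_of_tendsto_of_tendsto_of_le_of_le tendsto_const_nhds hlim (fun _ => bot_le) hle
  have hDs : Tendsto (fun k => ∫ z in s k, |D z| ∂(volume.restrict (spaceTime Ω T))) atTop (𝓝 0) :=
    hG.integrableOn.abs.tendsto_setIntegral_nhds_zero hμs
  -- Testing with `η k`, the error is `D (1 - η k)`, supported over the small set `A k`, and
  -- `G · ∇(η k)`, which is small in `L¹` since `G` is bounded. The bump function `B`, equal to `1`
  -- on `Ω`, makes the test function compactly supported.
  have hbound : ∀ k, ‖∫ z in spaceTime Ω T, D z * χ z.2‖ ≤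
      Mχ * (∫ z in s k, |D z| ∂(volume.restrict (spaceTime Ω T))) +
        Mχ * ((m + 1 : ℕ) * |M|) * (volume.real (Ioo 0 T) * (1 / ((k : ℝ) + 1))) := by
    intro k
    have hζ : ContDiff ℝ ∞ (fun x => η k x * B x) := (hηd k).mul B.contDiff
    have hζc : HasCompactSupport (fun x => η k x * B x) := B.hasCompactSupport.mul_left
    have h0 := hG.integral_eq_zero_of_disjoint_singular hΩo hb hflux hχ hχc hχs hζ hζc
      ((hηS k).mono_left tsupport_mul_subset_left)
    have hgi : IntegrableOn (fun z : EuclideanSpace ℝ (Fin (m + 1)) × ℝ => ‖fderiv ℝ (η k) z.1‖)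
        (spaceTime Ω T) := by
      rw [IntegrableOn, spaceTime, restrict_spaceTime]
      exact Integrable.comp_fst (hηi k).integrableOn _
    have hsi : Integrable ((s k).indicator fun z => |D z|) (volume.restrict (spaceTime Ω T)) :=
      hG.integrableOn.abs.indicator (hsm k)
    have hgle : ∫ z in spaceTime Ω T, ‖fderiv ℝ (η k) z.1‖ ≤
        volume.real (Ioo 0 T) * (1 / ((k : ℝ) + 1)) := by
      rw [spaceTime, restrict_spaceTime, integral_fun_fst (fun x => ‖fderiv ℝ (η k) x‖),
        measureReal_restrict_apply_univ, smul_eq_mul]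
      refine mul_le_mul_of_nonneg_left ?_ measureReal_nonneg
      exact (setIntegral_le_integral (hηi k) (Eventually.of_forall fun _ => norm_nonneg _)).trans
        (hηI k)
    have hζi : IntegrableOn (fun z => (D z * (η k z.1 * B z.1) +
        fieldPairing G z (fderiv ℝ (fun x => η k x * B x) z.1)) * χ z.2) (spaceTime Ω T) := by
      obtain ⟨Mζ, hMζ⟩ := hζc.exists_bound_of_continuous hζ.continuous
      have hDζ : IntegrableOn (fun z => D z * (η k z.1 * B z.1)) (spaceTime Ω T) :=
        Integrable.mul_bdd (c := Mζ) hG.integrableOn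
          (hζ.continuous.comp continuous_fst).aestronglyMeasurable
          (Eventually.of_forall fun z => hMζ z.1)
      exact IntegrableOn.mul_of_continuousOn_time hΩo
        (hDζ.add (hG.integrableOn_fieldPairing hΩo hb (hζ.continuous_fderiv (by simp))))
        hχ.continuous.continuousOn
    calc ‖∫ z in spaceTime Ω T, D z * χ z.2‖
        = ‖∫ z in spaceTime Ω T, (D z * χ z.2 - (D z * (η k z.1 * B z.1) +
            fieldPairing G z (fderiv ℝ (fun x => η k x * B x) z.1)) * χ z.2)‖ := by
          rw [integral_sub hDχ hζi, h0, sub_zero]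
      _ ≤ ∫ z in spaceTime Ω T, (Mχ * (s k).indicator (fun z => |D z|) z +
            Mχ * ((m + 1 : ℕ) * |M|) * ‖fderiv ℝ (η k) z.1‖) := by
          refine norm_integral_le_of_norm_le ((hsi.const_mul _).add (hgi.const_mul _)) ?_
          filter_upwards [ae_mem_spaceTime hΩo] with z hz
          have hBz := hB1 z.1 hz.1
          have e1 : fderiv ℝ (fun x => η k x * B x) z.1 = fderiv ℝ (η k) z.1 := by
            refine Filter.EventuallyEq.fderiv_eq ?_
            filter_upwards [hBz] with y hy
            rw [hy, Pi.one_apply, mul_one]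
          rw [e1, hBz.eq_of_nhds, Pi.one_apply, mul_one, ← sub_mul, norm_mul]
          have e2 : ‖D z - (D z * η k z.1 + fieldPairing G z (fderiv ℝ (η k) z.1))‖ ≤
              (s k).indicator (fun z => |D z|) z + (m + 1 : ℕ) * |M| * ‖fderiv ℝ (η k) z.1‖ := by
            rw [← sub_sub, show D z - D z * η k z.1 = D z * (1 - η k z.1) by ring]
            refine (norm_sub_le _ _).trans (add_le_add ?_
              (abs_fieldPairing_le (fun i z => (hM i z).trans (le_abs_self M)) z _))
            by_cases hzA : z ∈ s k
            · rw [indicator_of_mem hzA, norm_mul, Real.norm_of_nonneg (sub_nonneg.2 (hη1 k _))]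
              exact mul_le_of_le_one_right (norm_nonneg _) (by linarith [hη0 k z.1])
            · rw [indicator_of_notMem hzA, hηA k z.1 hzA, sub_self, mul_zero, norm_zero]
          calc _ ≤ ((s k).indicator (fun z => |D z|) z +
                (m + 1 : ℕ) * |M| * ‖fderiv ℝ (η k) z.1‖) * Mχ :=
                mul_le_mul e2 (hMχ _) (norm_nonneg _) ((norm_nonneg _).trans e2)
            _ = _ := by ring
      _ = Mχ * (∫ z in s k, |D z| ∂(volume.restrict (spaceTime Ω T))) +
            Mχ * ((m + 1 : ℕ) * |M|) * ∫ z in spaceTime Ω T, ‖fderiv ℝ (η k) z.1‖ := by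
          rw [integral_add (hsi.const_mul _) (hgi.const_mul _), integral_const_mul,
            integral_const_mul, integral_indicator (hsm k)]
      _ ≤ _ := by
          refine add_le_add le_rfl (mul_le_mul_of_nonneg_left hgle (by positivity))
  have hlim := (hDs.const_mul Mχ).add
    ((tendsto_one_div_add_atTop_nhds_zero_nat (𝕜 := ℝ)).const_mul
      (volume.real (Ioo 0 T)) |>.const_mul (Mχ * ((m + 1 : ℕ) * |M|)))
  simp only [mul_zero, add_zero] at hlim
  have := ge_of_tendsto' hlim hbound
  exact norm_le_zero_iff.1 this

end Divergence

/-! ### Truncated products -/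

section TruncatedProduct

variable {n : ℕ}

/-- The bounded truncation `y₀ yᵢ / (1 + δ |y|²)` of the product `y₀ yᵢ`, as a function of
`y = (y₀, y₁, …, yₙ)`, where `y₀` is the coordinate of index `none`. Its derivative is bounded for
each `δ > 0`, and at most a multiple of `|y|` uniformly in `δ`. -/
def truncProd (δ : ℝ) (i : Fin n) (y : Option (Fin n) → ℝ) : ℝ :=
  y none * y (some i) / (1 + δ * ∑ j, y j ^ 2)

lemma sq_norm_le_sum_sq (y : Option (Fin n) → ℝ) : ‖y‖ ^ 2 ≤ ∑ j, y j ^ 2 := by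
  have h0 : 0 ≤ ∑ j, y j ^ 2 := Finset.sum_nonneg fun _ _ => sq_nonneg _
  have : ‖y‖ ≤ √(∑ j, y j ^ 2) := by
    refine (pi_norm_le_iff_of_nonneg (Real.sqrt_nonneg _)).2 fun j => ?_
    refine Real.abs_le_sqrt ?_
    exact Finset.single_le_sum (f := fun j => y j ^ 2) (fun _ _ => sq_nonneg _) (Finset.mem_univ j)
  calc ‖y‖ ^ 2 ≤ √(∑ j, y j ^ 2) ^ 2 := pow_le_pow_left₀ (norm_nonneg _) this 2
    _ = _ := Real.sq_sqrt h0

lemma one_le_truncProd_denom {δ : ℝ} (hδ : 0 ≤ δ) (y : Option (Fin n) → ℝ) :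
    1 ≤ 1 + δ * ∑ j, y j ^ 2 :=
  le_add_of_nonneg_right (mul_nonneg hδ (Finset.sum_nonneg fun _ _ => sq_nonneg _))

lemma norm_div_truncProd_denom_le {δ : ℝ} (hδ : 0 < δ) (y : Option (Fin n) → ℝ) :
    ‖y‖ / (1 + δ * ∑ j, y j ^ 2) ≤ 1 + 1 / δ := by
  rw [div_le_iff₀ (zero_lt_one.trans_le (one_le_truncProd_denom hδ.le y))]
  have h1 := sq_norm_le_sum_sq y
  have h2 : (1 + 1 / δ) * (1 + δ * ∑ j, y j ^ 2) =
      1 + ∑ j, y j ^ 2 + 1 / δ + δ * ∑ j, y j ^ 2 := by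
    field_simp
    ring
  have h3 : 0 ≤ δ * ∑ j, y j ^ 2 := mul_nonneg hδ.le (Finset.sum_nonneg fun _ _ => sq_nonneg _)
  have h4 : 0 < 1 / δ := by positivity
  nlinarith [sq_nonneg (‖y‖ - 1)]

lemma abs_truncProd_le {δ : ℝ} (hδ : 0 < δ) (i : Fin n) (y : Option (Fin n) → ℝ) :
    |truncProd δ i y| ≤ 1 / δ := by
  have h1 := one_le_truncProd_denom hδ.le y
  rw [truncProd, abs_div, abs_of_pos (zero_lt_one.trans_le h1), abs_mul,
    div_le_iff₀ (zero_lt_one.trans_le h1)]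
  have h2 : |y none| * |y (some i)| ≤ ‖y‖ ^ 2 := by
    rw [sq]
    exact mul_le_mul (norm_le_pi_norm y _) (norm_le_pi_norm y _) (abs_nonneg _) (norm_nonneg _)
  have h3 : 1 / δ * (1 + δ * ∑ j, y j ^ 2) = 1 / δ + ∑ j, y j ^ 2 := by field_simp
  have h4 : 0 < 1 / δ := by positivity
  linarith [sq_norm_le_sum_sq y]

lemma contDiff_truncProd {δ : ℝ} (hδ : 0 ≤ δ) (i : Fin n) : ContDiff ℝ 1 (truncProd δ i) := by
  refine ContDiff.div (by fun_prop) ?_ fun y =>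
    (zero_lt_one.trans_le (one_le_truncProd_denom hδ y)).ne'
  exact contDiff_const.add (contDiff_const.mul (ContDiff.sum fun j _ => by fun_prop))

lemma fderiv_truncProd {δ : ℝ} (hδ : 0 ≤ δ) (i : Fin n) (y h : Option (Fin n) → ℝ) :
    fderiv ℝ (truncProd δ i) y h =
      (h none * y (some i) + y none * h (some i)) / (1 + δ * ∑ j, y j ^ 2) -
        y none * y (some i) * (2 * δ * ∑ j, y j * h j) / (1 + δ * ∑ j, y j ^ 2) ^ 2 := by
  have hd := (zero_lt_one.trans_le (one_le_truncProd_denom hδ y)).ne'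
  have hproj : ∀ j, HasFDerivAt (fun y : Option (Fin n) → ℝ => y j)
      (ContinuousLinearMap.proj (R := ℝ) (φ := fun _ => ℝ) j) y := fun j => hasFDerivAt_apply j y
  have hnum := (hproj none).fun_mul (hproj (some i))
  have hden : HasFDerivAt (fun y : Option (Fin n) → ℝ => 1 + δ * ∑ j, y j ^ 2)
      (δ • ∑ j, (2 * y j) • ContinuousLinearMap.proj (R := ℝ) (φ := fun _ => ℝ) j) y := by
    refine HasFDerivAt.const_add 1 (HasFDerivAt.const_mul (HasFDerivAt.fun_sum fun j _ => ?_) δ)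
    simpa using (hproj j).pow 2
  have hdiv : HasFDerivAt (truncProd δ i) _ y :=
    hnum.fun_mul ((hasDerivAt_inv hd).comp_hasFDerivAt y hden)
  rw [hdiv.fderiv]
  simp only [add_apply, smul_apply, sum_apply,
    ContinuousLinearMap.proj_apply, smul_eq_mul]
  have : ∑ j, 2 * y j * h j = 2 * ∑ j, y j * h j := by
    rw [Finset.mul_sum]
    exact Finset.sum_congr rfl fun j _ => by ring
  rw [this]
  field_simp
  ring

lemma abs_fderiv_truncProd_le {δ : ℝ} (hδ : 0 ≤ δ) (i : Fin n) (y h : Option (Fin n) → ℝ) :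
    |fderiv ℝ (truncProd δ i) y h| ≤
      (2 + 2 * (n + 1)) * (‖y‖ / (1 + δ * ∑ j, y j ^ 2)) * ‖h‖ := by
  have h1 := one_le_truncProd_denom hδ y
  rw [fderiv_truncProd hδ]
  set q := 1 + δ * ∑ j, y j ^ 2 with hq
  have hq0 : 0 < q := zero_lt_one.trans_le h1
  have hy : ∀ j, |y j| ≤ ‖y‖ := norm_le_pi_norm y
  have hh : ∀ j, |h j| ≤ ‖h‖ := norm_le_pi_norm h
  have e1 : |(h none * y (some i) + y none * h (some i)) / q| ≤ 2 * (‖y‖ / q) * ‖h‖ := by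
    rw [abs_div, abs_of_pos hq0, div_le_iff₀ hq0]
    refine (abs_add_le _ _).trans ?_
    rw [abs_mul, abs_mul, show 2 * (‖y‖ / q) * ‖h‖ * q = ‖h‖ * ‖y‖ + ‖y‖ * ‖h‖ by field_simp; ring]
    exact add_le_add (mul_le_mul (hh _) (hy _) (abs_nonneg _) (norm_nonneg _))
      (mul_le_mul (hy _) (hh _) (abs_nonneg _) (norm_nonneg _))
  have e2 : |∑ j, y j * h j| ≤ (n + 1) * (‖y‖ * ‖h‖) := by
    refine (Finset.abs_sum_le_sum_abs _ _).trans ?_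
    have : ∀ j ∈ Finset.univ, |y j * h j| ≤ ‖y‖ * ‖h‖ := fun j _ => by
      rw [abs_mul]
      exact mul_le_mul (hy _) (hh _) (abs_nonneg _) (norm_nonneg _)
    refine (Finset.sum_le_sum this).trans_eq ?_
    simp
  have e3 : |y none * y (some i) * (2 * δ * ∑ j, y j * h j) / q ^ 2| ≤
      2 * (n + 1) * (‖y‖ / q) * ‖h‖ := by
    rw [abs_div, abs_of_pos (pow_pos hq0 2), div_le_iff₀ (pow_pos hq0 2), abs_mul, abs_mul, abs_mul,
      abs_of_nonneg (mul_nonneg zero_le_two hδ),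
      show 2 * ((n : ℝ) + 1) * (‖y‖ / q) * ‖h‖ * q ^ 2 =
        q * (2 * ((n + 1) * (‖y‖ * ‖h‖))) by field_simp]
    have e4 : |y none| * |y (some i)| * δ ≤ q := by
      have : |y none| * |y (some i)| ≤ ‖y‖ ^ 2 := by
        rw [sq]
        exact mul_le_mul (hy _) (hy _) (abs_nonneg _) (norm_nonneg _)
      have := mul_le_mul_of_nonneg_right (this.trans (sq_norm_le_sum_sq y)) hδ
      rw [hq]
      linarith
    calc |y none| * |y (some i)| * (2 * δ * |∑ j, y j * h j|)
        = (|y none| * |y (some i)| * δ) * (2 * |∑ j, y j * h j|) := by ring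
      _ ≤ q * (2 * ((n + 1) * (‖y‖ * ‖h‖))) :=
          mul_le_mul e4 (mul_le_mul_of_nonneg_left e2 zero_le_two) (by positivity) hq0.le
  calc _ ≤ _ := abs_sub _ _
    _ ≤ _ := add_le_add e1 e3
    _ = _ := by ring

lemma norm_fderiv_truncProd_le {δ : ℝ} (hδ : 0 < δ) (i : Fin n) (y : Option (Fin n) → ℝ) :
    ‖fderiv ℝ (truncProd δ i) y‖ ≤ (2 + 2 * (n + 1)) * (1 + 1 / δ) := by
  refine ContinuousLinearMap.opNorm_le_bound _ (by positivity) fun h => ?_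
  refine (abs_fderiv_truncProd_le hδ.le i y h).trans ?_
  exact mul_le_mul_of_nonneg_right (mul_le_mul_of_nonneg_left (norm_div_truncProd_denom_le hδ y)
    (by positivity)) (norm_nonneg _)

lemma tendsto_fderiv_truncProd (i : Fin n) (y h : Option (Fin n) → ℝ) :
    Tendsto (fun k : ℕ => fderiv ℝ (truncProd (1 / ((k : ℝ) + 1)) i) y h) atTop
      (𝓝 (h none * y (some i) + y none * h (some i))) := by
  have hc : ContinuousAt (fun δ : ℝ =>
      (h none * y (some i) + y none * h (some i)) / (1 + δ * ∑ j, y j ^ 2) -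
        y none * y (some i) * (2 * δ * ∑ j, y j * h j) / (1 + δ * ∑ j, y j ^ 2) ^ 2) 0 := by
    refine ContinuousAt.sub (ContinuousAt.div (by fun_prop) (by fun_prop) (by simp))
      (ContinuousAt.div (by fun_prop) (by fun_prop) (by simp))
  have := hc.tendsto.comp (tendsto_one_div_add_atTop_nhds_zero_nat (𝕜 := ℝ))
  simp only [zero_mul, mul_zero, add_zero, div_one, zero_div, sub_zero] at this
  refine this.congr fun k => ?_
  rw [fderiv_truncProd (by positivity)]
  rfl

end TruncatedProduct

section Divergence

variable {n : ℕ} {Ω : Set (EuclideanSpace ℝ (Fin n))} {T : ℝ}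

/-- The divergence theorem for the field `w F`, where `w` and the components of `F` are in `H¹` and
the normal trace of `F` vanishes: the truncations of `w F` are bounded and have vanishing
normal trace. -/
theorem integral_div_mul_time_eq_zero (hΩ : IsPiecewiseSmoothDomain Ω)
    {w : EuclideanSpace ℝ (Fin n) × ℝ → ℝ} {F dw : Fin n → EuclideanSpace ℝ (Fin n) × ℝ → ℝ}
    {dF : Fin n → Fin n → EuclideanSpace ℝ (Fin n) × ℝ → ℝ}
    (hw : ∀ i, HasWeakDeriv (spaceTime Ω T) (EuclideanSpace.single i 1, 0) w (dw i))
    (hF : ∀ i j, HasWeakDeriv (spaceTime Ω T) (EuclideanSpace.single i 1, 0) (F j) (dF i j))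
    (hwL : MemLp w 2 (volume.restrict (spaceTime Ω T)))
    (hFL : ∀ i, MemLp (F i) 2 (volume.restrict (spaceTime Ω T)))
    (hdwL : ∀ i, MemLp (dw i) 2 (volume.restrict (spaceTime Ω T)))
    (hdFL : ∀ i j, MemLp (dF i j) 2 (volume.restrict (spaceTime Ω T)))
    (hflux : NormalTraceVanishes Ω T F)
    {χ : ℝ → ℝ} (hχ : ContDiff ℝ ∞ χ) (hχc : HasCompactSupport χ) (hχs : tsupport χ ⊆ Ioo 0 T) :
    ∫ z in spaceTime Ω T, (∑ i, (dw i z * F i z + w z * dF i i z)) * χ z.2 = 0 := by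
  rcases eq_or_ne n 0 with rfl | hn
  · simp
  have hΩo := hΩ.isOpen
  have hb := hΩ.isBounded
  have hfin : volume Ω ≠ ⊤ := hb.measure_lt_top.ne
  have hQ := isOpen_spaceTime (T := T) hΩo
  have : (volume : Measure (EuclideanSpace ℝ (Fin n) × ℝ)).IsAddHaarMeasure :=
    inferInstanceAs (Measure.prod volume volume).IsAddHaarMeasure
  obtain ⟨Mχ, hMχ⟩ := hχc.exists_bound_of_continuous hχ.continuous
  set Y : EuclideanSpace ℝ (Fin n) × ℝ → Option (Fin n) → ℝ :=
    fun z j => j.elim (w z) fun j => F j z with hY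
  set dY : Fin n → EuclideanSpace ℝ (Fin n) × ℝ → Option (Fin n) → ℝ :=
    fun i z j => j.elim (dw i z) fun j => dF i j z with hdY
  have hYw : ∀ i j, HasWeakDeriv (spaceTime Ω T) (EuclideanSpace.single i 1, 0)
      (fun z => Y z j) (fun z => dY i z j) := by
    intro i j
    cases j with
    | none => exact hw i
    | some j => exact hF i j
  have hYL : MemLp Y 2 (volume.restrict (spaceTime Ω T)) := MemLp.of_eval fun j => by
    cases j with
    | none => exact hwL
    | some j => exact hFL j
  have hdYL : ∀ i, MemLp (dY i) 2 (volume.restrict (spaceTime Ω T)) := fun i =>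
    MemLp.of_eval fun j => by
      cases j with
      | none => exact hdwL i
      | some j => exact hdFL i j
  have hfinQ : IsFiniteMeasure (volume.restrict (spaceTime Ω T)) := by
    have : IsFiniteMeasure (volume.restrict Ω) := ⟨by simpa using hfin.lt_top⟩
    rw [spaceTime, restrict_spaceTime]
    infer_instance
  have hm : ∀ (δ : ℝ), 0 < δ → ∀ i, AEStronglyMeasurable
      (fun z => fderiv ℝ (truncProd δ i) (Y z) (dY i z)) (volume.restrict (spaceTime Ω T)) :=
    fun δ hδ i => isBoundedBilinearMap_apply.continuous.comp_aestronglyMeasurable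
      ((((contDiff_truncProd hδ.le i).continuous_fderiv
        (by simp)).comp_aestronglyMeasurable hYL.aestronglyMeasurable).prodMk
          (hdYL i).aestronglyMeasurable)
  have hdiv : ∀ δ : ℝ, 0 < δ → HasWeakDivergence Ω T (fun i z => truncProd δ i (Y z))
      (fun z => ∑ i, fderiv ℝ (truncProd δ i) (Y z) (dY i z)) := by
    intro δ hδ
    have hi : ∀ i, IntegrableOn (fun z => fderiv ℝ (truncProd δ i) (Y z) (dY i z))
        (spaceTime Ω T) := fun i =>
      Integrable.mono' (((hdYL i).integrable (by norm_num)).norm.const_mul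
        ((2 + 2 * (n + 1)) * (1 + 1 / δ))) (hm δ hδ i) (Eventually.of_forall fun z =>
          (ContinuousLinearMap.le_opNorm _ _).trans (mul_le_mul_of_nonneg_right
            (norm_fderiv_truncProd_le hδ i _) (norm_nonneg _)))
    have hGm : ∀ i, AEStronglyMeasurable (fun z => truncProd δ i (Y z))
        (volume.restrict (spaceTime Ω T)) := fun i =>
      (contDiff_truncProd hδ.le i).continuous.comp_aestronglyMeasurable hYL.aestronglyMeasurable
    refine ⟨hGm, ⟨1 / δ, fun i z => abs_truncProd_le hδ i _⟩,
      integrable_finsetSum _ fun i _ => hi i, fun ψ hψ hc hs => ?_⟩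
    obtain ⟨M, hM⟩ := hc.exists_bound_of_continuous hψ.continuous
    have hGi : ∀ i, IntegrableOn (fun z => truncProd δ i (Y z) *
        fderiv ℝ ψ z (EuclideanSpace.single i 1, 0)) (spaceTime Ω T) := fun i => by
      have hcont : Continuous fun z => fderiv ℝ ψ z (EuclideanSpace.single i 1, 0) :=
        (hψ.continuous_fderiv (by simp)).clm_apply continuous_const
      obtain ⟨M', hM'⟩ := (hc.fderiv_apply ℝ _).exists_bound_of_continuous hcont
      exact Integrable.mul_bdd (c := M') (Integrable.of_bound (hGm i) (1 / δ)
        (Eventually.of_forall fun z => abs_truncProd_le hδ i _)) hcont.aestronglyMeasurable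
        (Eventually.of_forall hM')
    have hDi : ∀ i, IntegrableOn (fun z => fderiv ℝ (truncProd δ i) (Y z) (dY i z) * ψ z)
        (spaceTime Ω T) := fun i =>
      Integrable.mul_bdd (c := M) (hi i) hψ.continuous.aestronglyMeasurable
        (Eventually.of_forall hM)
    simp only [Finset.sum_mul]
    rw [integral_finsetSum _ fun i _ => hGi i, integral_finsetSum _ fun i _ => hDi i,
      ← Finset.sum_neg_distrib]
    exact Finset.sum_congr rfl fun i _ => integral_comp_mul_fderiv hQ (hYw i)
      (contDiff_truncProd hδ.le i) (norm_fderiv_truncProd_le hδ i) hψ hc hs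
  have hnt : ∀ δ : ℝ, 0 < δ → NormalTraceVanishes Ω T (fun i z => truncProd δ i (Y z)) := by
    intro δ hδ p hp
    obtain ⟨V, ρ, hρ, hlim⟩ := hflux p hp
    refine ⟨V, ρ, hρ, ?_⟩
    have hl := hlim.const_mul (1 + 1 / δ)
    rw [mul_zero] at hl
    refine squeeze_zero' ?_ ?_ hl
    · filter_upwards [self_mem_nhdsWithin] with ε hε
      exact mul_nonneg (inv_nonneg.2 (le_of_lt hε)) (integral_nonneg fun _ => abs_nonneg _)
    · filter_upwards [self_mem_nhdsWithin] with ε hε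
      have hε0 : (0 : ℝ) < ε := hε
      have hi0 : IntegrableOn (fun z => |fieldPairing F z (fderiv ℝ ρ z.1)|) (spaceTime Ω T) :=
        (integrableOn_fieldPairing hb hΩo (fun i => (hFL i).integrable (by norm_num))
          (hρ.contDiff.continuous_fderiv (by simp))).abs
      have hi := hi0.mono_set
        (prod_mono_left (t := Ioo 0 T) fun x (hx : x ∈ Ω ∩ V ∩ {x | -ε < ρ x}) => hx.1.1)
      -- The truncated field is `F` times the bounded function `w / (1 + δ |Y|²)`.
      have hle : ∀ z l, |fieldPairing (fun i z => truncProd δ i (Y z)) z l| ≤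
          (1 + 1 / δ) * |fieldPairing F z l| := by
        intro z l
        have e : fieldPairing (fun i z => truncProd δ i (Y z)) z l =
            w z / (1 + δ * ∑ j, Y z j ^ 2) * fieldPairing F z l := by
          simp only [fieldPairing, truncProd, Finset.mul_sum]
          refine Finset.sum_congr rfl fun i _ => ?_
          rw [show Y z none = w z from rfl, show Y z (some i) = F i z from rfl]
          ring
        rw [e, abs_mul]
        refine mul_le_mul_of_nonneg_right ?_ (abs_nonneg _)
        have hq := zero_lt_one.trans_le (one_le_truncProd_denom hδ.le (Y z))
        rw [abs_div, abs_of_pos hq]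
        exact (div_le_div_of_nonneg_right (norm_le_pi_norm (Y z) none) hq.le).trans
          (norm_div_truncProd_denom_le hδ (Y z))
      have := integral_mono_of_nonneg (Eventually.of_forall fun _ => abs_nonneg _)
        (hi.const_mul (1 + 1 / δ)) (Eventually.of_forall fun z => hle z (fderiv ℝ ρ z.1))
      rw [integral_const_mul] at this
      calc _ ≤ ε⁻¹ * _ := mul_le_mul_of_nonneg_left this (inv_nonneg.2 hε0.le)
        _ = _ := by ring
  have hzero : ∀ k : ℕ, ∫ z in spaceTime Ω T,
      (∑ i, fderiv ℝ (truncProd (1 / ((k : ℝ) + 1)) i) (Y z) (dY i z)) * χ z.2 = 0 := fun k =>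
    (hdiv _ (by positivity)).integral_mul_time_eq_zero hΩ hn (hnt _ (by positivity)) hχ hχc hχs
  have hlim : Tendsto (fun k : ℕ => ∫ z in spaceTime Ω T,
      (∑ i, fderiv ℝ (truncProd (1 / ((k : ℝ) + 1)) i) (Y z) (dY i z)) * χ z.2) atTop
      (𝓝 (∫ z in spaceTime Ω T, (∑ i, (dw i z * F i z + w z * dF i i z)) * χ z.2)) := by
    refine tendsto_integral_of_dominated_convergence
      (fun z => (∑ i, (2 + 2 * (n + 1)) * (‖Y z‖ * ‖dY i z‖)) * Mχ) (fun k => ?_) ?_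
      (fun k => Eventually.of_forall fun z => ?_) (Eventually.of_forall fun z => ?_)
    · exact (Finset.aestronglyMeasurable_fun_sum _ fun i _ => hm _ (by positivity) i).mul
        (hχ.continuous.comp continuous_snd).aestronglyMeasurable
    · exact (integrable_finsetSum _ fun i _ =>
        (hYL.norm.integrable_mul (hdYL i).norm).const_mul _).mul_const _
    · rw [norm_mul]
      refine mul_le_mul ((norm_sum_le _ _).trans (Finset.sum_le_sum fun i _ => ?_)) (hMχ _)
        (norm_nonneg _) (Finset.sum_nonneg fun i _ => by positivity)
      refine (abs_fderiv_truncProd_le (by positivity) i _ _).trans ?_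
      rw [mul_assoc]
      refine mul_le_mul_of_nonneg_left (mul_le_mul_of_nonneg_right
        (div_le_self (norm_nonneg _) (one_le_truncProd_denom (by positivity) _)) (norm_nonneg _))
        (by positivity)
    · exact (tendsto_finsetSum _ fun i _ => tendsto_fderiv_truncProd i (Y z) (dY i z)).mul_const _
  simp only [hzero] at hlim
  exact tendsto_nhds_unique hlim tendsto_const_nhds

/-- Green's formula without boundary term, weighted by a function of time. The divergence theorem
for test functions of time gives it on almost every time slice, hence `θ` need not vanish at the
ends of the time interval. -/
theorem integral_mul_divergence (hΩ : IsPiecewiseSmoothDomain Ω)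
    {w : EuclideanSpace ℝ (Fin n) × ℝ → ℝ} {F dw : Fin n → EuclideanSpace ℝ (Fin n) × ℝ → ℝ}
    {dF : Fin n → Fin n → EuclideanSpace ℝ (Fin n) × ℝ → ℝ}
    (hw : ∀ i, HasWeakDeriv (spaceTime Ω T) (EuclideanSpace.single i 1, 0) w (dw i))
    (hF : ∀ i j, HasWeakDeriv (spaceTime Ω T) (EuclideanSpace.single i 1, 0) (F j) (dF i j))
    (hwL : MemLp w 2 (volume.restrict (spaceTime Ω T)))
    (hFL : ∀ i, MemLp (F i) 2 (volume.restrict (spaceTime Ω T)))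
    (hdwL : ∀ i, MemLp (dw i) 2 (volume.restrict (spaceTime Ω T)))
    (hdFL : ∀ i j, MemLp (dF i j) 2 (volume.restrict (spaceTime Ω T)))
    (hflux : NormalTraceVanishes Ω T F) {θ : ℝ → ℝ} (hθ : ContinuousOn θ (Icc 0 T)) :
    ∫ z in spaceTime Ω T, w z * (∑ i, dF i i z) * θ z.2 =
      - ∫ z in spaceTime Ω T, (∑ i, dw i z * F i z) * θ z.2 := by
  have i1 : IntegrableOn (fun z => ∑ i, dw i z * F i z) (spaceTime Ω T) :=
    integrable_finsetSum _ fun i _ => (hdwL i).integrable_mul (hFL i)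
  have i2 : IntegrableOn (fun z => w z * ∑ i, dF i i z) (spaceTime Ω T) :=
    hwL.integrable_mul (memLp_finsetSum _ fun i _ => hdFL i i)
  have e : ∀ z, ∑ i, (dw i z * F i z + w z * dF i i z) =
      (∑ i, dw i z * F i z) + w z * ∑ i, dF i i z := fun z => by
    rw [Finset.sum_add_distrib, Finset.mul_sum]
  have i3 : IntegrableOn (fun z => ∑ i, (dw i z * F i z + w z * dF i i z)) (spaceTime Ω T) := by
    simp only [e]
    exact i1.add i2
  have hslice := ae_integral_slice_eq_zero hΩ.isOpen i3 fun q hq hqc hqs =>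
    integral_div_mul_time_eq_zero hΩ hw hF hwL hFL hdwL hdFL hflux hq hqc hqs
  have j1 := IntegrableOn.mul_of_continuousOn_time hΩ.isOpen i1 hθ
  have j2 := IntegrableOn.mul_of_continuousOn_time hΩ.isOpen i2 hθ
  have j3 := IntegrableOn.mul_of_continuousOn_time hΩ.isOpen i3 hθ
  have h0 : ∫ z in spaceTime Ω T, (∑ i, (dw i z * F i z + w z * dF i i z)) * θ z.2 = 0 := by
    refine integral_eq_zero_of_ae_slice j3 ?_
    filter_upwards [hslice] with t ht
    rw [integral_mul_const, ht, zero_mul]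
  simp only [e, add_mul] at h0
  rw [integral_add j1 j2] at h0
  linarith

end Divergence

/-! ### Traces and integral identities in `H²` -/

section IntegralIdentities

variable {n : ℕ} {Ω : Set (EuclideanSpace ℝ (Fin n))} {T : ℝ}
  {u : EuclideanSpace ℝ (Fin n) × ℝ → ℝ}

lemma MemH1.exists_hasInitialTrace (hΩ : IsOpen Ω) (hfin : volume Ω ≠ ⊤) (hT : 0 < T)
    (hu : MemH1 (spaceTime Ω T) u) : ∃ w, HasInitialTrace Ω u w := by
  have hg := hu.memLp_weakDeriv (isOpen_spaceTime hΩ) (0, 1)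
  obtain ⟨c, hc, h⟩ :=
    (hu.hasWeakDeriv (0, 1)).exists_memLp_eq_add_time_primitive hΩ hfin hT hu.1 hg
  exact ⟨_, hasInitialTrace_of_eq_add_time_primitive hΩ hfin hT hg hc h⟩

lemma MemH1.exists_hasTerminalTrace (hΩ : IsOpen Ω) (hfin : volume Ω ≠ ⊤) (hT : 0 < T)
    (hu : MemH1 (spaceTime Ω T) u) : ∃ w, HasTerminalTrace Ω T u w := by
  have hg := hu.memLp_weakDeriv (isOpen_spaceTime hΩ) (0, 1)
  obtain ⟨c, hc, h⟩ :=
    (hu.hasWeakDeriv (0, 1)).exists_memLp_eq_add_time_primitive hΩ hfin hT hu.1 hg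
  exact ⟨c, hasTerminalTrace_of_eq_add_time_primitive hΩ hfin hT hg hc h⟩

/-- The trace of an `H²` function is in `H¹`: its weak derivatives are the traces of the spatial
derivatives. -/
lemma HasLayerTrace.memH1 (hΩ : IsOpen Ω) (hfin : volume Ω ≠ ⊤) {J : ℝ → Set ℝ}
    (hJ : IsTimeLayer T J) (hu : MemH2 (spaceTime Ω T) u)
    (hex : ∀ f, MemH1 (spaceTime Ω T) f → ∃ w, HasLayerTrace Ω J f w)
    {w : EuclideanSpace ℝ (Fin n) → ℝ} (hw : HasLayerTrace Ω J u w) : MemH1 Ω w := by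
  refine ⟨hw.1, fun v => ?_⟩
  obtain ⟨w', hw'⟩ := hex _ (hu.2 (v, 0))
  exact ⟨w', HasLayerTrace.hasWeakDeriv hΩ hfin hJ (hu.1.hasWeakDeriv (v, 0)) hu.1.1
    (hu.1.memLp_weakDeriv (isOpen_spaceTime hΩ) _) hw hw', hw'.1⟩

lemma HasLayerTrace.integral_gradSq (hΩ : IsOpen Ω) (hfin : volume Ω ≠ ⊤) {J : ℝ → Set ℝ}
    (hJ : IsTimeLayer T J) (hu : MemH1 (spaceTime Ω T) u)
    {w : EuclideanSpace ℝ (Fin n) → ℝ} (hw : HasLayerTrace Ω J u w)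
    {g : Fin n → EuclideanSpace ℝ (Fin n) → ℝ}
    (hg : ∀ i, HasLayerTrace Ω J (spaceDeriv Ω T i u) (g i)) :
    IntegrableOn (gradSq Ω w) Ω ∧ ∫ x in Ω, gradSq Ω w x = ∑ i, ∫ x in Ω, g i x ^ 2 := by
  have hd : ∀ i, HasWeakDeriv Ω (EuclideanSpace.single i 1) w (g i) := fun i =>
    HasLayerTrace.hasWeakDeriv hΩ hfin hJ (hu.hasWeakDeriv _) hu.1
      (hu.memLp_weakDeriv (isOpen_spaceTime hΩ) _) hw (hg i)
  have hae : gradSq Ω w =ᵐ[volume.restrict Ω] fun x => ∑ i, g i x ^ 2 := by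
    have h : ∀ᵐ x ∂(volume.restrict Ω), ∀ i,
        weakDeriv Ω (EuclideanSpace.single i 1) w x = g i x :=
      ae_all_iff.2 fun i => (hasWeakDeriv_weakDeriv ⟨_, hd i⟩).ae_unique hΩ (hd i)
    filter_upwards [h] with x hx
    simp only [gradSq, hx]
  have hi : ∀ i, IntegrableOn (fun x => g i x ^ 2) Ω := fun i => (hg i).1.integrable_sq
  refine ⟨Integrable.congr (integrable_finsetSum _ fun i _ => hi i) hae.symm, ?_⟩
  rw [integral_congr_ae hae, integral_finsetSum _ fun i _ => hi i]

lemma NormalDerivVanishes.normalTraceVanishes (h : NormalDerivVanishes Ω T u) :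
    NormalTraceVanishes Ω T (fun i => spaceDeriv Ω T i u) := h

/-- Green's formula for `u Δu` on functions with vanishing normal derivative. -/
lemma MemH2Neumann.integral_mul_laplacian (hΩ : IsPiecewiseSmoothDomain Ω)
    (hu : MemH2Neumann Ω T u) {θ : ℝ → ℝ} (hθ : ContinuousOn θ (Icc 0 T)) :
    ∫ z in spaceTime Ω T, u z * spaceLaplacian Ω T u z * θ z.2 =
      - ∫ z in spaceTime Ω T, spaceGradSq Ω T u z * θ z.2 := by
  have hQ := isOpen_spaceTime (T := T) hΩ.isOpen
  have := integral_mul_divergence hΩ (fun i => hu.1.1.hasWeakDeriv (EuclideanSpace.single i 1, 0))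
    (fun i j => (hu.1.2 (EuclideanSpace.single j 1, 0)).hasWeakDeriv (EuclideanSpace.single i 1, 0))
    hu.1.1.1 (fun i => hu.1.1.memLp_weakDeriv hQ _) (fun i => hu.1.1.memLp_weakDeriv hQ _)
    (fun i j => (hu.1.2 _).memLp_weakDeriv hQ _) hu.2.normalTraceVanishes hθ
  simp only [← sq] at this
  exact this

/-- Green's formula and the energy identity in time for `u_t Δu`: it is half the time derivative of
`-|∇u|²` up to a spatial divergence. -/
lemma MemH2Neumann.integral_timeDeriv_mul_laplacian (hΩ : IsPiecewiseSmoothDomain Ω) (hT : 0 < T)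
    (hu : MemH2Neumann Ω T u) {u₀ uT : EuclideanSpace ℝ (Fin n) → ℝ}
    (h₀ : HasInitialTrace Ω u u₀) (huT : HasTerminalTrace Ω T u uT) {θ θ' : ℝ → ℝ}
    (hθ : ∀ t ∈ Icc 0 T, HasDerivAt θ (θ' t) t) (hθ' : ContinuousOn θ' (Icc 0 T)) :
    2 * ∫ z in spaceTime Ω T, timeDeriv Ω T u z * spaceLaplacian Ω T u z * θ z.2 =
      (∫ z in spaceTime Ω T, spaceGradSq Ω T u z * θ' z.2)
        - θ T * (∫ x in Ω, gradSq Ω uT x) + θ 0 * ∫ x in Ω, gradSq Ω u₀ x := by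
  have hΩo := hΩ.isOpen
  have hfin : volume Ω ≠ ⊤ := hΩ.isBounded.measure_lt_top.ne
  have hQ := isOpen_spaceTime (T := T) hΩo
  have hθc : ContinuousOn θ (Icc 0 T) := fun t ht => (hθ t ht).continuousAt.continuousWithinAt
  set ut := timeDeriv Ω T u with hut
  set F : Fin n → EuclideanSpace ℝ (Fin n) × ℝ → ℝ := fun i => spaceDeriv Ω T i u with hF
  set uti : Fin n → EuclideanSpace ℝ (Fin n) × ℝ → ℝ := fun i => spaceDeriv Ω T i ut with huti
  have hFL : ∀ i, MemLp (F i) 2 (volume.restrict (spaceTime Ω T)) := fun i =>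
    hu.1.1.memLp_weakDeriv hQ _
  have hutiL : ∀ i, MemLp (uti i) 2 (volume.restrict (spaceTime Ω T)) := fun i =>
    (hu.1.2 _).memLp_weakDeriv hQ _
  have hwd : ∀ i, HasWeakDeriv (spaceTime Ω T) (EuclideanSpace.single i 1, 0) ut (uti i) := fun i =>
    (hu.1.2 (0, 1)).hasWeakDeriv _
  have hgreen := integral_mul_divergence hΩ hwd
    (fun i j => (hu.1.2 (EuclideanSpace.single j 1, 0)).hasWeakDeriv (EuclideanSpace.single i 1, 0))
    (hu.1.1.memLp_weakDeriv hQ _) hFL hutiL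
    (fun i j => (hu.1.2 _).memLp_weakDeriv hQ _) hu.2.normalTraceVanishes hθc
  -- The weak time derivative of `u_{x_i}` is the spatial derivative of `u_t`.
  have ht : ∀ i, HasWeakDeriv (spaceTime Ω T) (0, 1) (F i) (uti i) := fun i =>
    (hu.1.1.hasWeakDeriv _).swap (hu.1.1.hasWeakDeriv _) (hwd i)
  choose g₀ hg₀ using fun i => MemH1.exists_hasInitialTrace hΩo hfin hT
    (hu.1.2 (EuclideanSpace.single i 1, 0))
  choose gT hgT using fun i => MemH1.exists_hasTerminalTrace hΩo hfin hT
    (hu.1.2 (EuclideanSpace.single i 1, 0))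
  have hE : ∀ i, 2 * (∫ z in spaceTime Ω T, F i z * uti i z * θ z.2) +
      ∫ z in spaceTime Ω T, F i z ^ 2 * θ' z.2 =
        θ T * (∫ x in Ω, gT i x ^ 2) - θ 0 * ∫ x in Ω, g₀ i x ^ 2 := fun i =>
    (ht i).integral_deriv_mul_sq hΩo hfin hT (hFL i) (hutiL i) (hg₀ i) (hgT i) hθ hθ'
  have j1 : ∀ i, IntegrableOn (fun z => F i z * uti i z * θ z.2) (spaceTime Ω T) := fun i =>
    IntegrableOn.mul_of_continuousOn_time hΩo ((hFL i).integrable_mul (hutiL i)) hθc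
  have j2 : ∀ i, IntegrableOn (fun z => F i z ^ 2 * θ' z.2) (spaceTime Ω T) := fun i =>
    IntegrableOn.mul_of_continuousOn_time hΩo (hFL i).integrable_sq hθ'
  have hsum := Finset.sum_congr (rfl : (Finset.univ : Finset (Fin n)) = _) fun i _ => hE i
  rw [Finset.sum_add_distrib, ← Finset.mul_sum, Finset.sum_sub_distrib, ← Finset.mul_sum,
    ← Finset.mul_sum, ← integral_finsetSum _ fun i _ => j1 i,
    ← integral_finsetSum _ fun i _ => j2 i,
    ← (HasLayerTrace.integral_gradSq hΩo hfin (isTimeLayer_terminal hT) hu.1.1 huT hgT).2,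
    ← (HasLayerTrace.integral_gradSq hΩo hfin (isTimeLayer_initial hT) hu.1.1 h₀ hg₀).2] at hsum
  simp only [← Finset.sum_mul] at hsum
  have e : ∀ z, ∑ i, F i z * uti i z = ∑ i, uti i z * F i z := fun z =>
    Finset.sum_congr rfl fun i _ => mul_comm _ _
  simp only [e] at hsum
  have hgreen' : ∫ z in spaceTime Ω T, ut z * spaceLaplacian Ω T u z * θ z.2 =
      - ∫ z in spaceTime Ω T, (∑ i, uti i z * F i z) * θ z.2 := hgreen
  have hgrad : ∀ z, spaceGradSq Ω T u z = ∑ i, F i z ^ 2 := fun z => rfl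
  simp only [hgrad]
  rw [hgreen']
  linarith

end IntegralIdentities

/-! ### The Carleman weight -/

section Weight

variable {T a lam : ℝ}

/-- The rate of decay `p` of the Carleman weight, normalized so that `φ' = -2 p φ`. -/
def carlemanRate (T a lam t : ℝ) : ℝ :=
  lam * (T - t + a) ^ (lam - 1)

lemma add_pos_of_mem_Icc (ha : 2 < a) {t : ℝ} (ht : t ∈ Icc 0 T) : 0 < T - t + a := by
  linarith [ht.2]

lemma hasDerivAt_rpow_time (ha : 2 < a) (q : ℝ) {t : ℝ} (ht : t ∈ Icc 0 T) :
    HasDerivAt (fun t => (T - t + a) ^ q) (-(q * (T - t + a) ^ (q - 1))) t := by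
  have h : HasDerivAt (fun t : ℝ => T - t + a) (-1) t :=
    ((hasDerivAt_id t).const_sub T).add_const a
  refine (h.rpow_const (p := q) (Or.inl (add_pos_of_mem_Icc ha ht).ne')).congr_deriv ?_
  ring

lemma hasDerivAt_carlemanWeight (ha : 2 < a) {t : ℝ} (ht : t ∈ Icc 0 T) :
    HasDerivAt (carlemanWeight T a lam)
      (-2 * (carlemanRate T a lam t * carlemanWeight T a lam t)) t := by
  refine ((hasDerivAt_rpow_time ha lam ht).const_mul 2).exp.congr_deriv ?_
  rw [carlemanRate, carlemanWeight]
  ring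

lemma hasDerivAt_carlemanRate_mul_weight (ha : 2 < a) {t : ℝ} (ht : t ∈ Icc 0 T) :
    HasDerivAt (fun t => carlemanRate T a lam t * carlemanWeight T a lam t)
      (-(lam * (lam - 1) * (T - t + a) ^ (lam - 2) * carlemanWeight T a lam t)
        - 2 * (carlemanRate T a lam t ^ 2 * carlemanWeight T a lam t)) t := by
  have h : HasDerivAt (carlemanRate T a lam) _ t :=
    (hasDerivAt_rpow_time ha (lam - 1) ht).const_mul lam
  refine (h.fun_mul (hasDerivAt_carlemanWeight (lam := lam) ha ht)).congr_deriv ?_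
  rw [show lam - 1 - 1 = lam - 2 by ring]
  ring

lemma continuousOn_rpow_time (ha : 2 < a) (q : ℝ) :
    ContinuousOn (fun t => (T - t + a) ^ q) (Icc 0 T) := fun _ ht =>
  (hasDerivAt_rpow_time ha q ht).continuousAt.continuousWithinAt

lemma continuousOn_carlemanRate (ha : 2 < a) : ContinuousOn (carlemanRate T a lam) (Icc 0 T) :=
  continuousOn_const.mul (continuousOn_rpow_time ha _)

lemma continuousOn_carlemanWeight (ha : 2 < a) : ContinuousOn (carlemanWeight T a lam) (Icc 0 T) :=
  fun _ ht => (hasDerivAt_carlemanWeight ha ht).continuousAt.continuousWithinAt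

lemma carlemanThreshold_bounds (hT : 0 < T) (ha : 2 < a) (hlam : carlemanThreshold T a ≤ lam) :
    64 ≤ lam ∧ 4 * (T + a) ≤ √lam := by
  rw [carlemanThreshold] at hlam
  exact ⟨by nlinarith, Real.le_sqrt_of_sq_le (by linarith)⟩

/-- The threshold on `λ` makes `-p' - √λ p - λ / 2` at least `(λ² / 8) a^(λ - 2)`. Since
`λ ≥ 16 s²` for `s = T - t + a`, the term `√λ p = λ √λ s · s^(λ - 2)` is at most
`(λ² / 4) s^(λ - 2)`, a fixed part of the leading term `λ² s^(λ - 2)` of `-p'`. -/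
lemma le_deriv_carlemanRate (hT : 0 < T) (ha : 2 < a) (hlam : carlemanThreshold T a ≤ lam) {t : ℝ}
    (ht : t ∈ Icc 0 T) :
    lam ^ 2 / 8 * a ^ (lam - 2) ≤ lam * (lam - 1) * (T - t + a) ^ (lam - 2)
      - √lam * carlemanRate T a lam t - lam / 2 := by
  obtain ⟨h64, hr⟩ := carlemanThreshold_bounds hT ha hlam
  have hs0 := add_pos_of_mem_Icc ha ht
  set s := T - t + a with hs
  have hsa : a ≤ s := by linarith [ht.2]
  have hsT : s ≤ T + a := by linarith [ht.1]
  have hpow : s ^ (lam - 1) = s ^ (lam - 2) * s := by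
    rw [← Real.rpow_add_one hs0.ne']
    congr 1
    ring
  have hX : a ^ (lam - 2) ≤ s ^ (lam - 2) := Real.rpow_le_rpow (by linarith) hsa (by linarith)
  have hX1 : 1 ≤ s ^ (lam - 2) := Real.one_le_rpow (by linarith) (by linarith)
  have hrr : √lam * √lam = lam := Real.mul_self_sqrt (by linarith)
  have hrs : √lam * s ≤ lam / 4 := by
    nlinarith [mul_le_mul_of_nonneg_left (hsT.trans (by linarith : T + a ≤ √lam / 4))
      (Real.sqrt_nonneg lam)]
  rw [carlemanRate, ← hs, hpow]
  set X := s ^ (lam - 2)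
  have e1 : √lam * (lam * (X * s)) ≤ lam * X * (lam / 4) := by
    calc √lam * (lam * (X * s)) = lam * X * (√lam * s) := by ring
      _ ≤ _ := mul_le_mul_of_nonneg_left hrs (by positivity)
  have e2 : lam ^ 2 / 8 * a ^ (lam - 2) ≤ lam ^ 2 / 8 * X :=
    mul_le_mul_of_nonneg_left hX (by positivity)
  have e3 : lam / 2 ≤ lam / 2 * X := le_mul_of_one_le_right (by linarith) hX1
  have e4 : 0 ≤ lam * X * (5 / 8 * lam - 3 / 2) :=
    mul_nonneg (by positivity) (by linarith)
  linarith

end Weight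

/-! ### The Carleman estimate -/

section CarlemanEstimate

variable {n : ℕ} {Ω : Set (EuclideanSpace ℝ (Fin n))} {T β a lam : ℝ}
  {u : EuclideanSpace ℝ (Fin n) × ℝ → ℝ} {u₀ uT : EuclideanSpace ℝ (Fin n) → ℝ}

lemma MemH2.memLp_spaceLaplacian (hΩ : IsOpen Ω) (hu : MemH2 (spaceTime Ω T) u) :
    MemLp (spaceLaplacian Ω T u) 2 (volume.restrict (spaceTime Ω T)) :=
  memLp_finsetSum _ fun _ _ => (hu.2 _).memLp_weakDeriv (isOpen_spaceTime hΩ) _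

/-- The estimate with weight `λ(λ - 1) s^(λ - 2)`, from completing the square: with `p` the rate of
the weight, `u_t + βΔu = (u_t - p u) + (βΔu + p u)`, and twice the product of these two terms
integrates to boundary terms and a positive multiple of `u²`. -/
lemma MemH2Neumann.le_integral_sq_heat (hΩ : IsPiecewiseSmoothDomain Ω) (hT : 0 < T) (ha : 2 < a)
    (hu : MemH2Neumann Ω T u) (h₀ : HasInitialTrace Ω u u₀) (huT : HasTerminalTrace Ω T u uT) :
    (∫ z in spaceTime Ω T, u z ^ 2 *
        (lam * (lam - 1) * (T - z.2 + a) ^ (lam - 2) * carlemanWeight T a lam z.2))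
      + carlemanRate T a lam T * carlemanWeight T a lam T * (∫ x in Ω, uT x ^ 2)
      - carlemanRate T a lam 0 * carlemanWeight T a lam 0 * (∫ x in Ω, u₀ x ^ 2)
      - β * carlemanWeight T a lam T * (∫ x in Ω, gradSq Ω uT x)
      + β * carlemanWeight T a lam 0 * (∫ x in Ω, gradSq Ω u₀ x) ≤
    ∫ z in spaceTime Ω T,
      (timeDeriv Ω T u z + β * spaceLaplacian Ω T u z) ^ 2 * carlemanWeight T a lam z.2 := by
  have hΩo := hΩ.isOpen
  have hfin : volume Ω ≠ ⊤ := hΩ.isBounded.measure_lt_top.ne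
  have hQ := isOpen_spaceTime (T := T) hΩo
  have hutL : MemLp (timeDeriv Ω T u) 2 (volume.restrict (spaceTime Ω T)) :=
    hu.1.1.memLp_weakDeriv hQ _
  have hLL := hu.1.memLp_spaceLaplacian hΩo
  have huL := hu.1.1.1
  have hφ := continuousOn_carlemanWeight (T := T) (lam := lam) ha
  have hp := continuousOn_carlemanRate (T := T) (lam := lam) ha
  have hpφ : ContinuousOn (fun t => carlemanRate T a lam t * carlemanWeight T a lam t) (Icc 0 T) :=
    hp.mul hφ
  have hppφ : ContinuousOn (fun t => carlemanRate T a lam t ^ 2 * carlemanWeight T a lam t)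
      (Icc 0 T) := (hp.pow 2).mul hφ
  have hkφ : ContinuousOn (fun t => lam * (lam - 1) * (T - t + a) ^ (lam - 2) *
      carlemanWeight T a lam t) (Icc 0 T) :=
    (continuousOn_const.mul (continuousOn_rpow_time ha _)).mul hφ
  have g1 := hu.integral_timeDeriv_mul_laplacian hΩ hT h₀ huT
    (fun t ht => hasDerivAt_carlemanWeight (lam := lam) ha ht) (continuousOn_const.mul hpφ)
  have g2 := hu.integral_mul_laplacian hΩ hpφ
  have g3 := (hu.1.1.hasWeakDeriv (0, 1)).integral_deriv_mul_sq hΩo hfin hT huL hutL h₀ huT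
    (fun t ht => hasDerivAt_carlemanRate_mul_weight (lam := lam) ha ht)
    (hkφ.neg.sub (continuousOn_const.mul hppφ))
  have i1 : IntegrableOn (fun z => timeDeriv Ω T u z * spaceLaplacian Ω T u z *
      carlemanWeight T a lam z.2) (spaceTime Ω T) :=
    IntegrableOn.mul_of_continuousOn_time hΩo (hutL.integrable_mul hLL) hφ
  have i2 : IntegrableOn (fun z => u z * spaceLaplacian Ω T u z *
      (carlemanRate T a lam z.2 * carlemanWeight T a lam z.2)) (spaceTime Ω T) :=
    IntegrableOn.mul_of_continuousOn_time hΩo (huL.integrable_mul hLL) hpφ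
  have i3 : IntegrableOn (fun z => u z * timeDeriv Ω T u z *
      (carlemanRate T a lam z.2 * carlemanWeight T a lam z.2)) (spaceTime Ω T) :=
    IntegrableOn.mul_of_continuousOn_time hΩo (huL.integrable_mul hutL) hpφ
  have i4 := IntegrableOn.mul_of_continuousOn_time hΩo huL.integrable_sq hppφ
  have i5 := IntegrableOn.mul_of_continuousOn_time hΩo huL.integrable_sq hkφ
  have iJ := IntegrableOn.mul_of_continuousOn_time hΩo (hutL.add (hLL.const_mul β)).integrable_sq hφ
  have e1 : ∫ z in spaceTime Ω T, spaceGradSq Ω T u z *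
      (-2 * (carlemanRate T a lam z.2 * carlemanWeight T a lam z.2)) =
      -2 * ∫ z in spaceTime Ω T, spaceGradSq Ω T u z *
        (carlemanRate T a lam z.2 * carlemanWeight T a lam z.2) := by
    rw [← integral_const_mul]
    exact integral_congr_ae (Eventually.of_forall fun z => by ring)
  have e2 : ∫ z in spaceTime Ω T, u z ^ 2 *
      (-(lam * (lam - 1) * (T - z.2 + a) ^ (lam - 2) * carlemanWeight T a lam z.2)
        - 2 * (carlemanRate T a lam z.2 ^ 2 * carlemanWeight T a lam z.2)) =
      -(∫ z in spaceTime Ω T, u z ^ 2 *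
        (lam * (lam - 1) * (T - z.2 + a) ^ (lam - 2) * carlemanWeight T a lam z.2))
      - 2 * ∫ z in spaceTime Ω T, u z ^ 2 *
        (carlemanRate T a lam z.2 ^ 2 * carlemanWeight T a lam z.2) := by
    rw [← integral_const_mul, ← integral_neg, ← integral_sub i5.fun_neg (i4.const_mul 2)]
    exact integral_congr_ae (Eventually.of_forall fun z => by ring)
  rw [e1] at g1
  rw [e2] at g3
  have hmono := integral_mono ((((i1.const_mul (2 * β)).sub (i2.const_mul (2 * β))).add
    (i3.const_mul 2)).sub (i4.const_mul 2)) iJ fun z => by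
      have hw : 0 < carlemanWeight T a lam z.2 := Real.exp_pos _
      have h2 := mul_nonneg (sq_nonneg (timeDeriv Ω T u z - carlemanRate T a lam z.2 * u z)) hw.le
      have h3 := mul_nonneg (sq_nonneg
        (β * spaceLaplacian Ω T u z + carlemanRate T a lam z.2 * u z)) hw.le
      simp only [Pi.sub_apply, Pi.add_apply]
      linarith
  rw [integral_sub' (((i1.const_mul (2 * β)).sub (i2.const_mul (2 * β))).add
    (i3.const_mul 2)) (i4.const_mul 2), integral_add' ((i1.const_mul (2 * β)).sub
    (i2.const_mul (2 * β))) (i3.const_mul 2), integral_sub' (i1.const_mul (2 * β))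
    (i2.const_mul (2 * β))] at hmono
  simp only [integral_const_mul] at hmono
  refine le_trans (le_of_eq ?_) hmono
  change 2 * (∫ z in spaceTime Ω T, u z * timeDeriv Ω T u z *
    (carlemanRate T a lam z.2 * carlemanWeight T a lam z.2)) + _ = _ at g3
  linear_combination (-β) * g1 + 2 * β * g2 - g3

/-- The estimate for `|∇u|²`, from testing `u_t + βΔu` with `√λ u φ`. -/
lemma MemH2Neumann.sqrt_mul_integral_gradSq_le (hΩ : IsPiecewiseSmoothDomain Ω) (hT : 0 < T)
    (ha : 2 < a) (hlam : 0 ≤ lam)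
    (hu : MemH2Neumann Ω T u) (h₀ : HasInitialTrace Ω u u₀) (huT : HasTerminalTrace Ω T u uT) :
    √lam * β * (∫ z in spaceTime Ω T, spaceGradSq Ω T u z * carlemanWeight T a lam z.2) ≤
      √lam * (∫ z in spaceTime Ω T, u z ^ 2 *
        (carlemanRate T a lam z.2 * carlemanWeight T a lam z.2))
      + lam / 2 * (∫ z in spaceTime Ω T, u z ^ 2 * carlemanWeight T a lam z.2)
      + √lam / 2 * carlemanWeight T a lam T * (∫ x in Ω, uT x ^ 2)
      - √lam / 2 * carlemanWeight T a lam 0 * (∫ x in Ω, u₀ x ^ 2)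
      + 1 / 2 * ∫ z in spaceTime Ω T,
        (timeDeriv Ω T u z + β * spaceLaplacian Ω T u z) ^ 2 * carlemanWeight T a lam z.2 := by
  have hΩo := hΩ.isOpen
  have hfin : volume Ω ≠ ⊤ := hΩ.isBounded.measure_lt_top.ne
  have hQ := isOpen_spaceTime (T := T) hΩo
  have hutL : MemLp (timeDeriv Ω T u) 2 (volume.restrict (spaceTime Ω T)) :=
    hu.1.1.memLp_weakDeriv hQ _
  have hLL := hu.1.memLp_spaceLaplacian hΩo
  have huL := hu.1.1.1
  have hφ := continuousOn_carlemanWeight (T := T) (lam := lam) ha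
  have hpφ : ContinuousOn (fun t => carlemanRate T a lam t * carlemanWeight T a lam t) (Icc 0 T) :=
    (continuousOn_carlemanRate ha).mul hφ
  have g2 := hu.integral_mul_laplacian hΩ hφ
  have g3 := (hu.1.1.hasWeakDeriv (0, 1)).integral_deriv_mul_sq hΩo hfin hT huL hutL h₀ huT
    (fun t ht => hasDerivAt_carlemanWeight (lam := lam) ha ht) (continuousOn_const.mul hpφ)
  have i1 : IntegrableOn (fun z => u z * timeDeriv Ω T u z *
      carlemanWeight T a lam z.2) (spaceTime Ω T) :=
    IntegrableOn.mul_of_continuousOn_time hΩo (huL.integrable_mul hutL) hφ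
  have i2 : IntegrableOn (fun z => u z * spaceLaplacian Ω T u z *
      carlemanWeight T a lam z.2) (spaceTime Ω T) :=
    IntegrableOn.mul_of_continuousOn_time hΩo (huL.integrable_mul hLL) hφ
  have i3 := IntegrableOn.mul_of_continuousOn_time hΩo huL.integrable_sq hφ
  have iJ := IntegrableOn.mul_of_continuousOn_time hΩo (hutL.add (hLL.const_mul β)).integrable_sq hφ
  have e1 : ∫ z in spaceTime Ω T, u z ^ 2 *
      (-2 * (carlemanRate T a lam z.2 * carlemanWeight T a lam z.2)) =
      -2 * ∫ z in spaceTime Ω T, u z ^ 2 *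
        (carlemanRate T a lam z.2 * carlemanWeight T a lam z.2) := by
    rw [← integral_const_mul]
    exact integral_congr_ae (Eventually.of_forall fun z => by ring)
  rw [e1] at g3
  have hrr : √lam ^ 2 = lam := Real.sq_sqrt hlam
  have hmono := integral_mono ((i1.const_mul (-√lam)).sub (i2.const_mul (√lam * β)))
    ((i3.const_mul (lam / 2)).add (iJ.const_mul (1 / 2))) fun z => by
      have hw : 0 < carlemanWeight T a lam z.2 := Real.exp_pos _
      have := mul_nonneg (sq_nonneg (timeDeriv Ω T u z + β * spaceLaplacian Ω T u z +
        √lam * u z)) hw.le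
      rw [show ∀ x y : ℝ, (x + √lam * y) ^ 2 = x ^ 2 + 2 * √lam * x * y + √lam ^ 2 * y ^ 2 by
        intros; ring, hrr] at this
      simp only [Pi.sub_apply, Pi.add_apply]
      linarith
  rw [integral_sub' (i1.const_mul (-√lam)) (i2.const_mul (√lam * β)),
    integral_add' (i3.const_mul (lam / 2)) (iJ.const_mul (1 / 2))] at hmono
  simp only [integral_const_mul] at hmono
  change 2 * (∫ z in spaceTime Ω T, u z * timeDeriv Ω T u z * carlemanWeight T a lam z.2) + _ = _
    at g3
  change _ ≤ _ + 1 / 2 * (∫ z in spaceTime Ω T,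
    (timeDeriv Ω T u z + β * spaceLaplacian Ω T u z) ^ 2 * carlemanWeight T a lam z.2) at hmono
  linear_combination hmono + √lam / 2 * g3 + √lam * β * g2

end CarlemanEstimate

theorem theorem3p1 (n : ℕ) (Ω : Set (EuclideanSpace ℝ (Fin n))) (hΩ : IsPiecewiseSmoothDomain Ω)
    (T β a : ℝ) (hT : 0 < T) (hβ : 0 < β) (ha : 2 < a)
    (u : EuclideanSpace ℝ (Fin n) × ℝ → ℝ) (hu : MemH2Neumann Ω T u) :
    (∃ u₀, HasInitialTrace Ω u u₀ ∧ MemH1 Ω u₀) ∧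
    (∃ uT, HasTerminalTrace Ω T u uT ∧ MemH1 Ω uT) ∧
    ∀ u₀ uT : EuclideanSpace ℝ (Fin n) → ℝ,
      HasInitialTrace Ω u u₀ → HasTerminalTrace Ω T u uT →
      ∀ lam : ℝ, carlemanThreshold T a ≤ lam →
        (∫ z in spaceTime Ω T,
            (timeDeriv Ω T u z + β * spaceLaplacian Ω T u z) ^ 2 * carlemanWeight T a lam z.2) ≥
          2 / 3 * √lam * β *
              (∫ z in spaceTime Ω T, spaceGradSq Ω T u z * carlemanWeight T a lam z.2)
          + lam ^ 2 / 12 * a ^ (lam - 2) *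
              (∫ z in spaceTime Ω T, (u z) ^ 2 * carlemanWeight T a lam z.2)
          - 2 / 3 * Real.exp (2 * a ^ lam) *
              (∫ x in Ω, (β * gradSq Ω uT x + 1 / 2 * (uT x) ^ 2))
          - 2 / 3 * lam * (T + a) ^ (lam - 1) * Real.exp (2 * (T + a) ^ lam) *
              (∫ x in Ω, (u₀ x) ^ 2) := by
  have hΩo := hΩ.isOpen
  have hfin : volume Ω ≠ ⊤ := hΩ.isBounded.measure_lt_top.ne
  have hex₀ : ∀ f, MemH1 (spaceTime Ω T) f → ∃ w, HasInitialTrace Ω f w := fun f hf =>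
    hf.exists_hasInitialTrace hΩo hfin hT
  have hexT : ∀ f, MemH1 (spaceTime Ω T) f → ∃ w, HasTerminalTrace Ω T f w := fun f hf =>
    hf.exists_hasTerminalTrace hΩo hfin hT
  refine ⟨?_, ?_, fun u₀ uT h₀ huT lam hlam => ?_⟩
  · obtain ⟨w, hw⟩ := hex₀ u hu.1.1
    exact ⟨w, hw, HasLayerTrace.memH1 hΩo hfin (isTimeLayer_initial hT) hu.1 hex₀ hw⟩
  · obtain ⟨w, hw⟩ := hexT u hu.1.1
    exact ⟨w, hw, HasLayerTrace.memH1 hΩo hfin (isTimeLayer_terminal hT) hu.1 hexT hw⟩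
  obtain ⟨h64, -⟩ := carlemanThreshold_bounds hT ha hlam
  have hφ := continuousOn_carlemanWeight (T := T) (lam := lam) ha
  have i1 := IntegrableOn.mul_of_continuousOn_time hΩo hu.1.1.1.integrable_sq hφ
  have i2 : IntegrableOn (fun z => u z ^ 2 *
      (carlemanRate T a lam z.2 * carlemanWeight T a lam z.2)) (spaceTime Ω T) :=
    IntegrableOn.mul_of_continuousOn_time hΩo hu.1.1.1.integrable_sq
      ((continuousOn_carlemanRate ha).mul hφ)
  have i3 : IntegrableOn (fun z => u z ^ 2 *
      (lam * (lam - 1) * (T - z.2 + a) ^ (lam - 2) * carlemanWeight T a lam z.2))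
      (spaceTime Ω T) :=
    IntegrableOn.mul_of_continuousOn_time hΩo hu.1.1.1.integrable_sq
      ((continuousOn_const.mul (continuousOn_rpow_time ha (lam - 2))).mul hφ)
  have hE := hu.le_integral_sq_heat (β := β) (lam := lam) hΩ hT ha h₀ huT
  have hG := hu.sqrt_mul_integral_gradSq_le (β := β) (lam := lam) hΩ hT ha (by linarith) h₀ huT
  have hmono : lam ^ 2 / 8 * a ^ (lam - 2) *
      (∫ z in spaceTime Ω T, u z ^ 2 * carlemanWeight T a lam z.2) ≤
      (∫ z in spaceTime Ω T, u z ^ 2 *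
        (lam * (lam - 1) * (T - z.2 + a) ^ (lam - 2) * carlemanWeight T a lam z.2))
      - √lam * (∫ z in spaceTime Ω T, u z ^ 2 *
        (carlemanRate T a lam z.2 * carlemanWeight T a lam z.2))
      - lam / 2 * (∫ z in spaceTime Ω T, u z ^ 2 * carlemanWeight T a lam z.2) := by
    rw [← integral_const_mul, ← integral_const_mul, ← integral_const_mul,
      ← integral_sub i3 (i2.const_mul _),
      ← integral_sub (i3.fun_sub (i2.const_mul _)) (i1.const_mul _)]
    refine integral_mono_ae (i1.const_mul _)
      ((i3.fun_sub (i2.const_mul _)).fun_sub (i1.const_mul _)) ?_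
    filter_upwards [ae_mem_spaceTime hΩo] with z hz
    have h := mul_le_mul_of_nonneg_left
      (le_deriv_carlemanRate hT ha hlam (Ioo_subset_Icc_self hz.2))
      (mul_nonneg (sq_nonneg (u z)) (Real.exp_pos (2 * (T - z.2 + a) ^ lam)).le)
    simp only [carlemanWeight]
    linarith
  choose gT hgT using fun i => hexT _ (hu.1.2 (EuclideanSpace.single i 1, 0))
  have hgi := (HasLayerTrace.integral_gradSq hΩo hfin (isTimeLayer_terminal hT) hu.1.1 huT hgT).1
  have hsplit : ∫ x in Ω, (β * gradSq Ω uT x + 1 / 2 * (uT x) ^ 2) =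
      β * (∫ x in Ω, gradSq Ω uT x) + 1 / 2 * ∫ x in Ω, uT x ^ 2 := by
    rw [integral_add (hgi.const_mul β) (huT.1.integrable_sq.const_mul _), integral_const_mul,
      integral_const_mul]
  have hUT : 0 ≤ ∫ x in Ω, uT x ^ 2 := integral_nonneg fun _ => sq_nonneg _
  have hU₀ : 0 ≤ ∫ x in Ω, u₀ x ^ 2 := integral_nonneg fun _ => sq_nonneg _
  have hG₀ : 0 ≤ ∫ x in Ω, gradSq Ω u₀ x :=
    integral_nonneg fun _ => Finset.sum_nonneg fun _ _ => sq_nonneg _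
  have hT0 : carlemanWeight T a lam T = Real.exp (2 * a ^ lam) := by simp [carlemanWeight]
  have h00 : carlemanWeight T a lam 0 = Real.exp (2 * (T + a) ^ lam) := by simp [carlemanWeight]
  have hr0 : carlemanRate T a lam 0 = lam * (T + a) ^ (lam - 1) := by simp [carlemanRate]
  have hrT : √lam / 2 ≤ carlemanRate T a lam T := by
    have h1 : 1 ≤ a ^ (lam - 1) := Real.one_le_rpow (by linarith) (by linarith)
    have h2 : √lam ≤ lam := Real.sqrt_le_iff.2 ⟨by linarith, by nlinarith⟩
    have h3 : lam * 1 ≤ lam * a ^ (lam - 1) := mul_le_mul_of_nonneg_left h1 (by linarith)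
    simp only [carlemanRate, sub_self, zero_add]
    linarith
  rw [hsplit]
  rw [hT0, h00] at hE hG
  rw [hr0] at hE
  set eT := Real.exp (2 * a ^ lam) with heT
  set e0 := Real.exp (2 * (T + a) ^ lam) with he0
  have heT0 : 0 < eT := Real.exp_pos _
  have he00 : 0 < e0 := Real.exp_pos _
  -- The terms that are left over at `t = 0` and `t = T` have a favourable sign.
  have k1 := mul_nonneg (mul_nonneg (sub_nonneg.2 hrT) heT0.le) hUT
  have k2 := mul_nonneg (mul_nonneg (Real.sqrt_nonneg lam) he00.le) hU₀
  have k3 := mul_nonneg (mul_nonneg hβ.le he00.le) hG₀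
  have k4 := mul_nonneg heT0.le hUT
  linarith

end
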